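/- Let $\mathrm{M}$ be a loopless matroid on a finite ground set $E$, with lattice of flats $\mathcal{L}$ (minimum $\hat 0=\varnothing$, maximum $\hat 1=E$) and closure operator $\operatorname{cl}$. A set $\mathcal{G}\subseteq\mathcal{L}\setminus\{\hat 0\}$ is a *building set* if for every flat $F\neq\hat 0$ the join map $\prod_{G\in\max\mathcal{G}_{\leqslant F}}[\hat 0,G]\to[\hat 0,F]$ is an isomorphism of posets, where $\mathcal{G}_{\leqslant F}=\{G\in\mathcal{G}: G\leqslant F\}$; then $(\mathrm{M},\mathcal{G})$ is a *built matroid*. It is *complete* if there is a total order $\vartriangleleft$ on $E$ such that for every flat $F$ and every $G\in\mathcal{G}$ with $F\leqslant G$, writing $G\setminus F=\{e_1\vartriangleleft\dots\vartriangleleft e_k\}$, each of the flats $F,\ \operatorname{cl}(F\cup\{e_1\}),\ \dots,\ \operatorname{cl}(F\cup\{e_1,\dots,e_k\})$ belongs to $\{F\}\cup\{F\vee H : H\in\mathcal{G},\ F\vee H\leqslant G\}$. A subset $\mathcal{S}\subseteq\mathcal{G}$ is *nested* if no antichain in $\mathcal{S}$ with at least two elements has its join in $\mathcal{G}$. The *Chow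 ring* is the graded ring $$\operatorname{CH}(\mathrm{M},\mathcal{G})=\mathbb{Z}[x_G : G\in\mathcal{G}]\Big/\Big(\prod_{G\in\mathcal{S}}x_G\ (\mathcal{S}\subseteq\mathcal{G}\text{ not nested}),\ \ \sum_{G\ni e}x_G\ (e\in E)\Big),$$ and the *Chow polynomial* $\mathrm{H}(\mathrm{M},\mathcal{G})(t)=\sum_{i\geqslant 0} h_i t^i$ is its Hilbert--Poincaré series, $h_i=\operatorname{rank}_{\mathbb{Z}}\operatorname{CH}^i(\mathrm{M},\mathcal{G})$. **Corollary.** Let $(\mathrm{M},\mathcal{G})$ be a complete built matroid. Then $\mathrm{H}(\mathrm{M},\mathcal{G})(t)$ is a polynomial of degree $d=\operatorname{rk}(\mathrm{M})-|\max\mathcal{G}|$ (so $d=\operatorname{rk}(\mathrm{M})-1$ if $E\in\mathcal{G}$), where $\max\mathcal{G}$ is the set of maximal elements of $\mathcal{G}$, and its $g$-vector $$(h_0,\ h_1-h_0,\ \dots,\ h_{\lfloor d/2\rfloor}-h_{\lfloor d/2\rfloor-1})$$ is a pure $f$-vector: there is a pure simplicial complex (all facets of the same dimension) of dimension $\lfloor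 d/2\rfloor-1$, on a finite vertex set, whose number of faces of cardinality $i$ (including the empty face for $i=0$) is the $i$-th entry of this vector, for $0\leqslant i\leqslant\lfloor d/2\rfloor$. If moreover $\operatorname{rk}(\mathrm{M})\leqslant 6$, then $\mathrm{H}(\mathrm{M},\mathcal{G})(t)$ is log-concave, i.e. $h_i^2\geqslant h_{i-1}h_{i+1}$ for all $0<i<d$. -/

import Mathlib

open scoped Polynomial

noncomputable section

namespace BuiltMatroid

variable {α : Type*}

/-! ### Building sets

The lattice of flats `L(M)` is represented by the sets `F` with `M.IsFlat F`, ordered by inclusion.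
The join of a family of flats is the closure of their union, the bottom element is `M.closure ∅`
(which is `∅` when `M` is loopless), the top element is `M.E`. -/

/-- The interval `[0̂, F]` of the lattice of flats, as a poset. -/
abbrev FlatsBelow (M : Matroid α) (F : Set α) : Type _ := {H : Set α // M.IsFlat H ∧ H ⊆ F}

/-- The `𝒢`-factors of `F`: the maximal elements of `𝒢_{≤ F} = {G ∈ 𝒢 | G ⊆ F}`. -/
def factors (𝒢 : Finset (Set α)) (F : Set α) : Set (Set α) :=
  {G | Maximal (fun G' => G' ∈ 𝒢 ∧ G' ⊆ F) G}

/-- `𝒢` is a building set of the lattice of flats of `M`: it consists of flats different from `0̂`,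
and for every flat `F ≠ 0̂` the join map `∏_{G ∈ max 𝒢_{≤ F}} [0̂, G] → [0̂, F]` is (well defined
and) an isomorphism of posets. -/
def IsBuildingSet (M : Matroid α) (𝒢 : Finset (Set α)) : Prop :=
  (∀ G ∈ 𝒢, M.IsFlat G ∧ G ≠ M.closure ∅) ∧
  ∀ F : Set α, M.IsFlat F → F ≠ M.closure ∅ →
    ∃ ψ : ((G : factors 𝒢 F) → FlatsBelow M (G : Set α)) ≃o FlatsBelow M F,
      ∀ H, (ψ H : Set α) = M.closure (⋃ G, (H G : Set α))

/-! ### Complete built matroids -/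

/-- The building set `𝒢_F^G` of the interval `[F, G]` induced by `𝒢`:
the joins `F ∨ H` with `H ∈ 𝒢` that lie below `G`, except `F` itself. -/
def intervalBuildingSet (M : Matroid α) (𝒢 : Finset (Set α)) (F G : Set α) : Set (Set α) :=
  {C | (∃ H ∈ 𝒢, C = M.closure (F ∪ H)) ∧ C ⊆ G ∧ C ≠ F}

/-- The chain from `F` to `G` determined by a total order: if `G \ F = {e₁ < ⋯ < e_k}`, it consists
of `F` and of the flats `F_i = cl(F ∪ {e₁, …, e_i})`, `1 ≤ i ≤ k`. -/
def orderChain [LinearOrder α] (M : Matroid α) (F G : Set α) : Set (Set α) :=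
  insert F {C | ∃ e ∈ G \ F, C = M.closure (F ∪ {x ∈ G \ F | x ≤ e})}

/-- `(M, 𝒢)` is complete with respect to the given total order. -/
def IsCompleteFor [LinearOrder α] (M : Matroid α) (𝒢 : Finset (Set α)) : Prop :=
  ∀ F : Set α, M.IsFlat F → ∀ G ∈ 𝒢, F ⊆ G →
    orderChain M F G ⊆ insert F (intervalBuildingSet M 𝒢 F G)

/-- `(M, 𝒢)` is complete with respect to some total order of the ground set. Only the restriction of
the order to `M.E` matters, and every total order of `M.E` extends to a total order of `α`. -/
def IsComplete (M : Matroid α) (𝒢 : Finset (Set α)) : Prop :=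
  ∃ _ : LinearOrder α, IsCompleteFor M 𝒢

/-! ### The Chow ring and its Hilbert–Poincaré series -/

/-- `S ⊆ 𝒢` is nested if no antichain contained in `S` with at least two elements has its join
in `𝒢`. -/
def IsNested (M : Matroid α) (𝒢 : Finset (Set α)) (S : Set (Set α)) : Prop :=
  S ⊆ 𝒢 ∧ ∀ A ⊆ S, IsAntichain (· ⊆ ·) A → A.Nontrivial → M.closure (⋃₀ A) ∉ 𝒢

open Classical in
/-- The defining ideal of the Chow ring in `ℤ[x_G : G ∈ 𝒢]`. It is generated by the monomials
`∏_{G ∈ S} x_G`, for `S ⊆ 𝒢` not nested, and by the linear forms `∑_{G ∋ e} x_G`, for `e ∈ M.E`. -/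
def chowIdeal (M : Matroid α) (𝒢 : Finset (Set α)) : Ideal (MvPolynomial 𝒢 ℤ) :=
  Ideal.span {p | ∃ S : Finset 𝒢, ¬ IsNested M 𝒢 (Subtype.val '' (S : Set 𝒢)) ∧
      p = ∏ G ∈ S, MvPolynomial.X G} ⊔
  Ideal.span {p | ∃ e ∈ M.E, p = ∑ G : {G // G ∈ 𝒢} with e ∈ G.1, MvPolynomial.X G}

/-- The Feichtner–Yuzvinsky Chow ring `CH(M, 𝒢)`. -/
abbrev ChowRing (M : Matroid α) (𝒢 : Finset (Set α)) : Type _ :=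
  MvPolynomial 𝒢 ℤ ⧸ chowIdeal M 𝒢

/-- The degree `k` piece of the Chow ring: the classes of homogeneous polynomials of degree `k`. -/
def chowPiece (M : Matroid α) (𝒢 : Finset (Set α)) (k : ℕ) : Submodule ℤ (ChowRing M 𝒢) :=
  (MvPolynomial.homogeneousSubmodule 𝒢 ℤ k).map
    (Ideal.Quotient.mkₐ ℤ (chowIdeal M 𝒢)).toLinearMap

/-- The Hilbert–Poincaré series of the Chow ring. -/
def chowSeries (M : Matroid α) (𝒢 : Finset (Set α)) : PowerSeries ℤ :=
  PowerSeries.mk fun k => (Module.finrank ℤ (chowPiece M 𝒢 k) : ℤ)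

/-! ### Pure `f`-vectors, `g`-vectors and log-concavity -/

/-- The faces of a simplicial complex, the empty face included (the faces of Mathlib's
`AbstractSimplicialComplex` are the nonempty ones). -/
def allFaces {V : Type*} (K : AbstractSimplicialComplex V) : Set (Finset V) :=
  insert ∅ {s | s ∈ K}

/-- A simplicial complex is pure if all its facets (maximal faces) have the same dimension. -/
def IsPure {V : Type*} (K : AbstractSimplicialComplex V) : Prop :=
  ∀ s t : Finset V, Maximal (· ∈ allFaces K) s → Maximal (· ∈ allFaces K) t → s.card = t.card

/-- `(f 0, f 1, …, f m)` is a pure `f`-vector: there is a pure simplicial complex of dimension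
`m - 1` on a finite vertex set with exactly `f i` faces of cardinality `i`, for all `0 ≤ i ≤ m`. -/
def IsPureFVector (m : ℕ) (f : ℕ → ℤ) : Prop :=
  ∃ (V : Type) (_ : Finite V) (K : AbstractSimplicialComplex V),
    IsPure K ∧
    (∀ s ∈ allFaces K, s.card ≤ m) ∧ (∃ s ∈ allFaces K, s.card = m) ∧
    ∀ i ≤ m, f i = (({s ∈ allFaces K | s.card = i}.ncard : ℕ) : ℤ)

/-- The sequence of differences `(h₀, h₁ - h₀, h₂ - h₁, …)` of the coefficients of a polynomial;
the `g`-vector of a polynomial of degree `d` consists of its entries of index `0, …, ⌊d / 2⌋`. -/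
def gEntry (h : ℤ[X]) : ℕ → ℤ
  | 0 => h.coeff 0
  | i + 1 => h.coeff (i + 1) - h.coeff i

/-- The sequence of coefficients of `h` is log-concave. -/
def IsLogConcave (h : ℤ[X]) : Prop :=
  ∀ i : ℕ, 0 < i → i < h.natDegree → h.coeff (i - 1) * h.coeff (i + 1) ≤ h.coeff i ^ 2

end BuiltMatroid

end

open scoped Polynomial

noncomputable section

set_option linter.unusedSectionVars false

namespace BuiltMatroid

variable {α : Type*}

/-! ### The rank function -/

/-! The plan is to show that the Hilbert series has a γ-expansion `∑_S t^|S| (1+t)^(D-2|S|)`, where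
`D` is the rank minus the number of maximal elements of `𝒢`, and `S` runs over the faces of a
simplicial complex. Everything claimed is a formal consequence of that.

Basis. The monomials with nested support, in which each exponent is smaller than the rank of a
member relative to the join of the members strictly below it, form a basis of the Chow ring
(`finrank_chowPiece`). They span because the ideal contains the relations `x_A · (∑_{G ⊇ K} x_G)^r`,
with `r` that relative rank. They are independent by an induction that adjoins one variable at a
time and passes to links (`eq_zero_of_mem_fyIdeal`). So the series is a sum over nested sets `C`
containing `max 𝒢`, each maximal member of relative rank `m` contributing `1 + ⋯ + t^(m-1)` and each
other member `t + ⋯ + t^(m-1)`.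

γ-expansion. Deform these weights by a parameter `s`, so that `s = 0` gives them back and `s = 1`
gives `(1+t)^(m-1)` and `t(1+t)^(m-2)`. Multiply the term of `C` by `(1-s)^(number of ascents of
C)`. The derivative of a weight splits a relative rank `m` into `i` and `m - i`, which is the effect
of inserting a new child. Completeness provides exactly one child of relative rank `i` that is an
ascent (`exists_isAscent_insert`, `isAscent_insert_unique`), and removing an ascent changes the
ascent set only by that element. So the two parts of the derivative cancel (`derivative_nestedSum`),
and the sum at `s = 0` equals the sum at `s = 1`, where only ascent-free nested sets survive.
Deleting members creates no ascents, so the non-maximal parts of these sets form a simplicial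
complex.

Consequences. The `g`-vector of `t^s (1+t)^(D-2s)` counts ballot sets. Pairing each face with ballot
sets gives a complex realizing the `g`-vector, and it is pure since a small ballot set can always be
enlarged. In rank at most six only `γ₀ = 1`, `γ₁` and `γ₂` occur, and log-concavity follows from `γ₂
≤ γ₁²`. -/

/-- The rank of a set, as a natural number. -/
def rk (M : Matroid α) (X : Set α) : ℕ := (M.eRk X).toNat

section Rank

variable (M : Matroid α) [M.RankFinite]

lemma coe_rk (X : Set α) : (rk M X : ℕ∞) = M.eRk X :=
  ENat.natCast_toNat (Matroid.eRk_ne_top_iff.2 (M.isRkFinite_set X))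

lemma rk_empty : rk M ∅ = 0 := by simp [rk]

lemma rk_closure (X : Set α) : rk M (M.closure X) = rk M X := by simp [rk]

lemma rk_closure_union (X Y : Set α) : rk M (M.closure X ∪ Y) = rk M (X ∪ Y) := by simp [rk]

variable {M}

lemma rk_mono {X Y : Set α} (h : X ⊆ Y) : rk M X ≤ rk M Y := by
  have := M.eRk_mono h
  simp only [← coe_rk] at this
  exact_mod_cast this

lemma rk_submod (X Y : Set α) : rk M (X ∩ Y) + rk M (X ∪ Y) ≤ rk M X + rk M Y := by
  have := M.eRk_inter_add_eRk_union_le X Y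
  simp only [← coe_rk] at this
  exact_mod_cast this

lemma rk_union_le (X Y : Set α) : rk M (X ∪ Y) ≤ rk M X + rk M Y := by
  have := rk_submod (M := M) X Y
  omega

lemma rk_insert_le (e : α) (X : Set α) : rk M (insert e X) ≤ rk M X + 1 := by
  have := M.eRk_insert_le_add_one e X
  simp only [← coe_rk] at this
  exact_mod_cast this

lemma rk_insert_of_notMem {e : α} {X : Set α} (he : e ∈ M.E) (h : e ∉ M.closure X) :
    rk M (insert e X) = rk M X + 1 := by
  have := M.eRk_insert_eq_add_one ⟨he, h⟩
  simp only [← coe_rk] at this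
  exact_mod_cast this

lemma mem_closure_of_rk_le {e : α} {X : Set α} (he : e ∈ M.E)
    (h : rk M (insert e X) ≤ rk M X) : e ∈ M.closure X := by
  by_contra hc
  have := rk_insert_of_notMem he hc
  omega

lemma rk_union_of_subset_closure {X Y : Set α} (h : Y ⊆ M.closure X) :
    rk M (X ∪ Y) = rk M X := by
  refine le_antisymm ?_ (rk_mono Set.subset_union_left)
  rw [← rk_closure_union, Set.union_eq_left.2 h, rk_closure]

/-- A flat contained in another set of at most the same rank contains it. -/
lemma subset_of_rk_le {F X : Set α} (hF : M.IsFlat F) (hX : X ⊆ M.E) (h : F ⊆ X)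
    (hr : rk M X ≤ rk M F) : X ⊆ F := by
  intro e he
  rw [← hF.closure]
  exact mem_closure_of_rk_le (hX he) ((rk_mono (Set.insert_subset he h)).trans hr)

/-- Marginal ranks decrease. -/
lemma rk_union_add_rk_le {K X Y : Set α} (h : Y ⊆ X) :
    rk M (K ∪ X) + rk M Y ≤ rk M (K ∪ Y) + rk M X := by
  have h1 := rk_submod (M := M) (K ∪ Y) X
  have h2 : rk M Y ≤ rk M ((K ∪ Y) ∩ X) := rk_mono (Set.subset_inter Set.subset_union_right h)
  have h3 : K ∪ Y ∪ X = K ∪ X := by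
    rw [Set.union_assoc, Set.union_eq_right.2 h]
  rw [h3] at h1
  omega

/-- Marginal ranks decrease, so shrinking either side of a direct sum cannot create a dependency. -/
lemma skew_mono {X Y X' Y' : Set α} (h : rk M (X ∪ Y) = rk M X + rk M Y) (hX : X' ⊆ X)
    (hY : Y' ⊆ Y) : rk M (X' ∪ Y') = rk M X' + rk M Y' := by
  have h1 := rk_union_add_rk_le (M := M) (K := Y) hX
  have h2 := rk_union_add_rk_le (M := M) (K := X') hY
  have h3 := rk_union_le (M := M) X' Y'
  rw [Set.union_comm Y X, Set.union_comm Y X'] at h1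
  omega

/-- In a direct sum, adding `e ∈ X` raises the rank of `X'` exactly as much as that of `X' ∪ Y'`, so
the part in `Y` does not help to span `e`. -/
lemma mem_closure_left_of_skew {X Y X' Y' : Set α} (h : rk M (X ∪ Y) = rk M X + rk M Y)
    (hX : X' ⊆ X) (hY : Y' ⊆ Y) {e : α} (he : e ∈ M.closure (X' ∪ Y')) (heX : e ∈ X) :
    e ∈ M.closure X' := by
  refine mem_closure_of_rk_le (M.mem_ground_of_mem_closure he) ?_
  have h1 := skew_mono h hX hY
  have h2 := skew_mono h (Set.insert_subset heX hX) hY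
  have h3 : rk M (X' ∪ Y' ∪ {e}) = rk M (X' ∪ Y') :=
    rk_union_of_subset_closure (Set.singleton_subset_iff.2 he)
  rw [Set.union_singleton, ← Set.insert_union] at h3
  omega

end Rank

lemma closure_empty_eq (M : Matroid α) [M.Loopless] : M.closure ∅ = ∅ := by
  rw [M.closure_empty, M.loops_eq_empty]

lemma isFlat_empty (M : Matroid α) [M.Loopless] : M.IsFlat ∅ := by
  rw [Matroid.isFlat_iff_closure_eq, closure_empty_eq]

lemma closure_subset_of_isFlat {M : Matroid α} {X F : Set α} (hF : M.IsFlat F) (h : X ⊆ F) :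
    M.closure X ⊆ F := by
  rw [← hF.closure]
  exact M.closure_subset_closure h

lemma isFlat_inter {M : Matroid α} {F G : Set α} (hF : M.IsFlat F) (hG : M.IsFlat G) :
    M.IsFlat (F ∩ G) := by
  rw [Matroid.isFlat_iff_closure_eq]
  refine Set.Subset.antisymm (Set.subset_inter ?_ ?_)
    (M.subset_closure _ (Set.inter_subset_left.trans hF.subset_ground))
  · exact closure_subset_of_isFlat hF Set.inter_subset_left
  · exact closure_subset_of_isFlat hG Set.inter_subset_right

/-! ### Factors of a flat -/

section Building

variable {M : Matroid α} [M.Finite] [M.Loopless] {𝒢 : Finset (Set α)}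
  (h𝒢 : IsBuildingSet M 𝒢)
include h𝒢

lemma IsBuildingSet.isFlat {G : Set α} (hG : G ∈ 𝒢) : M.IsFlat G := (h𝒢.1 G hG).1

lemma IsBuildingSet.subset_ground {G : Set α} (hG : G ∈ 𝒢) : G ⊆ M.E :=
  (h𝒢.isFlat hG).subset_ground

lemma IsBuildingSet.nonempty {G : Set α} (hG : G ∈ 𝒢) : G.Nonempty := by
  have := (h𝒢.1 G hG).2
  rw [closure_empty_eq] at this
  exact Set.nonempty_iff_ne_empty.2 this

omit [M.Finite] [M.Loopless] h𝒢 in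
lemma mem_of_mem_factors {F G : Set α} (h : G ∈ factors 𝒢 F) : G ∈ 𝒢 :=
  (Maximal.prop (P := fun G' => G' ∈ 𝒢 ∧ G' ⊆ F) h).1

omit [M.Finite] [M.Loopless] h𝒢 in
lemma subset_of_mem_factors {F G : Set α} (h : G ∈ factors 𝒢 F) : G ⊆ F :=
  (Maximal.prop (P := fun G' => G' ∈ 𝒢 ∧ G' ⊆ F) h).2

omit [M.Finite] [M.Loopless] h𝒢 in
lemma eq_of_mem_factors {F G H : Set α} (h : G ∈ factors 𝒢 F) (hH : H ∈ 𝒢) (hHF : H ⊆ F)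
    (hGH : G ⊆ H) : G = H :=
  Maximal.eq_of_subset (P := fun G' => G' ∈ 𝒢 ∧ G' ⊆ F) h ⟨hH, hHF⟩ hGH

omit [M.Finite] [M.Loopless] h𝒢 in
lemma exists_factor_superset {F H : Set α} (hH : H ∈ 𝒢) (hHF : H ⊆ F) :
    ∃ G ∈ factors 𝒢 F, H ⊆ G := by
  have hfin : {G | G ∈ 𝒢 ∧ G ⊆ F}.Finite := 𝒢.finite_toSet.subset fun G h => h.1
  obtain ⟨G, hHG, hG⟩ := hfin.exists_le_maximal (a := H) ⟨hH, hHF⟩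
  exact ⟨G, hG, hHG⟩

/-- Joining flats below the factors of `F` does not create anything inside a factor. -/
lemma IsBuildingSet.closure_iUnion_inter_factor {F : Set α} (hF : M.IsFlat F) (hne : F.Nonempty)
    (K : (G : factors 𝒢 F) → FlatsBelow M (G : Set α)) (G : factors 𝒢 F) :
    M.closure (⋃ G, (K G : Set α)) ∩ G ⊆ K G := by
  obtain ⟨ψ, hψ⟩ := h𝒢.2 F hF (by rw [closure_empty_eq]; exact hne.ne_empty)
  let H : (G : factors 𝒢 F) → FlatsBelow M (G : Set α) := fun G =>
    ⟨M.closure (⋃ G, (K G : Set α)) ∩ G,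
      isFlat_inter (M.isFlat_closure _) (h𝒢.isFlat (mem_of_mem_factors G.2)), Set.inter_subset_right⟩
  have hle : ψ H ≤ ψ K := by
    change (ψ H : Set α) ⊆ (ψ K : Set α)
    rw [hψ, hψ]
    refine closure_subset_of_isFlat (M.isFlat_closure _) (Set.iUnion_subset fun G => ?_)
    exact Set.inter_subset_left
  exact (ψ.le_iff_le.1 hle) G

/-- Pull `cl {e}` back through the join isomorphism: some coordinate is nonempty, and any point of
it is parallel to `e`, so that coordinate contains `e`. -/
lemma IsBuildingSet.exists_factor_mem {F : Set α} (hF : M.IsFlat F) {e : α} (he : e ∈ F) :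
    ∃ G ∈ factors 𝒢 F, e ∈ G := by
  have heE := hF.subset_ground he
  obtain ⟨ψ, hψ⟩ := h𝒢.2 F hF (by rw [closure_empty_eq]; exact Set.Nonempty.ne_empty ⟨e, he⟩)
  obtain ⟨H, hH⟩ := ψ.surjective ⟨M.closure {e}, M.isFlat_closure _,
    closure_subset_of_isFlat hF (Set.singleton_subset_iff.2 he)⟩
  have hcl : M.closure (⋃ G, (H G : Set α)) = M.closure {e} := by rw [← hψ, hH]
  have hex : ∃ G, (H G : Set α).Nonempty := by
    by_contra hc
    push Not at hc
    have h0 : (⋃ G, (H G : Set α)) = ∅ := by simpa using hc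
    rw [h0, closure_empty_eq] at hcl
    have := M.mem_closure_self e heE
    rw [← hcl] at this
    exact this
  obtain ⟨G, x, hx⟩ := hex
  refine ⟨G, G.2, (H G).2.2 ?_⟩
  have hxE : x ∈ M.E := (H G).2.1.subset_ground hx
  have hx1 : x ∈ M.closure {e} := by
    rw [← hcl]
    refine M.mem_closure_of_mem' (Set.mem_iUnion.2 ⟨G, hx⟩) hxE
  have hx2 := (M.isNonloop_of_loopless hxE).closure_eq_of_mem_closure hx1
  have h3 : M.closure {x} ⊆ H G :=
    closure_subset_of_isFlat (H G).2.1 (Set.singleton_subset_iff.2 hx)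
  rw [hx2] at h3
  exact h3 (M.mem_closure_self e heE)

/-- Take the family that is empty in the coordinate `G` and full in all others. Its join meets `G`
only in `∅`, yet it would contain a common point of `G` and `H`. -/
lemma IsBuildingSet.factor_eq_of_mem {F G H : Set α} (hF : M.IsFlat F) (hG : G ∈ factors 𝒢 F)
    (hH : H ∈ factors 𝒢 F) {e : α} (heG : e ∈ G) (heH : e ∈ H) : G = H := by
  classical
  by_contra hne
  let K : (G : factors 𝒢 F) → FlatsBelow M (G : Set α) := fun G' =>
    if (G' : Set α) = G then ⟨∅, isFlat_empty M, Set.empty_subset _⟩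
    else ⟨G', h𝒢.isFlat (mem_of_mem_factors G'.2), subset_rfl⟩
  have h := h𝒢.closure_iUnion_inter_factor hF ⟨e, subset_of_mem_factors hG heG⟩ K ⟨G, hG⟩
  have heK : e ∈ M.closure (⋃ G, (K G : Set α)) := by
    refine M.mem_closure_of_mem' (Set.mem_iUnion.2 ⟨⟨H, hH⟩, ?_⟩)
      (hF.subset_ground (subset_of_mem_factors hG heG))
    simp only [K, if_neg (Ne.symm hne)]
    exact heH
  have := h ⟨heK, heG⟩
  simp [K] at this

/-- The order isomorphism yields an honest direct sum. Add a basis of `G` to the union of the other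
factors one element at a time: an element that does not raise the rank would, by
`closure_iUnion_inter_factor`, be spanned by the earlier basis elements alone. -/
lemma IsBuildingSet.rk_factor {F G : Set α} (hF : M.IsFlat F) (hG : G ∈ factors 𝒢 F) :
    rk M (G ∪ ⋃₀ (factors 𝒢 F \ {G})) = rk M G + rk M (⋃₀ (factors 𝒢 F \ {G})) := by
  classical
  set R := ⋃₀ (factors 𝒢 F \ {G}) with hR
  have hGE := h𝒢.subset_ground (mem_of_mem_factors hG)
  have hGne := h𝒢.nonempty (mem_of_mem_factors hG)
  obtain ⟨I, hI⟩ := M.exists_isBasis G hGE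
  have hIfin : I.Finite := M.ground_finite.subset (hI.subset.trans hGE)
  have key : ∀ J : Finset α, (J : Set α) ⊆ I → rk M (J ∪ R) = J.card + rk M R := by
    intro J
    induction J using Finset.induction_on with
    | empty => simp
    | insert e J he ih =>
      intro hJ
      rw [Finset.coe_insert, Set.insert_subset_iff] at hJ
      rw [Finset.coe_insert, Set.insert_union, rk_insert_of_notMem (hGE (hI.subset hJ.1)), ih hJ.2,
        Finset.card_insert_of_notMem he]
      · omega
      intro hc
      let K : (G : factors 𝒢 F) → FlatsBelow M (G : Set α) := fun G' =>
        if (G' : Set α) = G then ⟨M.closure J ∩ G', isFlat_inter (M.isFlat_closure _)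
          (h𝒢.isFlat (mem_of_mem_factors G'.2)), Set.inter_subset_right⟩
        else ⟨G', h𝒢.isFlat (mem_of_mem_factors G'.2), subset_rfl⟩
      have h := h𝒢.closure_iUnion_inter_factor hF
        (hGne.mono (subset_of_mem_factors hG)) K ⟨G, hG⟩
      have hsub : (J : Set α) ∪ R ⊆ ⋃ G, (K G : Set α) := by
        rintro x (hx | ⟨H, hH, hx⟩)
        · refine Set.mem_iUnion.2 ⟨⟨G, hG⟩, ?_⟩
          simp only [K, if_true]
          have hxG := hI.subset (hJ.2 hx)
          exact ⟨M.mem_closure_of_mem' hx (hGE hxG), hxG⟩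
        · refine Set.mem_iUnion.2 ⟨⟨H, hH.1⟩, ?_⟩
          have hHG : H ≠ G := hH.2
          simp only [K, if_neg hHG]
          exact hx
      have h2 := h ⟨M.closure_subset_closure hsub hc, hI.subset hJ.1⟩
      simp only [K, if_true] at h2
      refine hI.indep.notMem_closure_sdiff_of_mem hJ.1 (M.closure_subset_closure ?_ h2.1)
      exact fun x hx => ⟨hJ.2 hx, fun hxe => he (by rw [← Set.mem_singleton_iff.1 hxe]; exact hx)⟩
  have h1 := key hIfin.toFinset (by simp)
  have h2 : rk M G = hIfin.toFinset.card := by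
    have := hI.encard_eq_eRk
    rw [← coe_rk, hIfin.encard_eq_coe_toFinset_card] at this
    exact_mod_cast this.symm
  rw [Set.Finite.coe_toFinset] at h1
  rw [h2, ← h1, ← rk_closure_union, ← rk_closure_union M I, hI.closure_eq_closure]

lemma IsBuildingSet.closure_singleton_mem {e : α} (he : e ∈ M.E) : M.closure {e} ∈ 𝒢 := by
  obtain ⟨G, hG, heG⟩ := h𝒢.exists_factor_mem (M.isFlat_closure {e}) (M.mem_closure_self e he)
  have hG' := mem_of_mem_factors hG
  have : G = M.closure {e} := (subset_of_mem_factors hG).antisymm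
    (closure_subset_of_isFlat (h𝒢.isFlat hG') (Set.singleton_subset_iff.2 heG))
  exact this ▸ hG'

/-- The factors of `cl (G ∪ H)` containing `G` and `H` share a point, so they coincide, and the
common factor is the whole join. -/
lemma IsBuildingSet.closure_union_mem {G H : Set α} (hG : G ∈ 𝒢) (hH : H ∈ 𝒢)
    (hne : (G ∩ H).Nonempty) : M.closure (G ∪ H) ∈ 𝒢 := by
  have hsub : G ∪ H ⊆ M.closure (G ∪ H) :=
    M.subset_closure _ (Set.union_subset (h𝒢.subset_ground hG) (h𝒢.subset_ground hH))
  obtain ⟨A, hA, hGA⟩ := exists_factor_superset hG (Set.subset_union_left.trans hsub)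
  obtain ⟨B, hB, hHB⟩ := exists_factor_superset hH (Set.subset_union_right.trans hsub)
  obtain ⟨e, he⟩ := hne
  have hAB := h𝒢.factor_eq_of_mem (M.isFlat_closure _) hA hB (hGA he.1) (hHB he.2)
  subst hAB
  have hA' := mem_of_mem_factors hA
  have : A = M.closure (G ∪ H) := (subset_of_mem_factors hA).antisymm
    (closure_subset_of_isFlat (h𝒢.isFlat hA') (Set.union_subset hGA hHB))
  exact this ▸ hA'

lemma IsBuildingSet.sUnion_factors {F : Set α} (hF : M.IsFlat F) : ⋃₀ factors 𝒢 F = F := by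
  refine (Set.sUnion_subset fun G hG => subset_of_mem_factors hG).antisymm fun e he => ?_
  obtain ⟨G, hG, heG⟩ := h𝒢.exists_factor_mem hF he
  exact ⟨G, hG, heG⟩

lemma IsBuildingSet.sUnion_factors_eq {F G : Set α} (hF : M.IsFlat F) (hG : G ∈ factors 𝒢 F) :
    G ∪ ⋃₀ (factors 𝒢 F \ {G}) = F := by
  rw [← Set.sUnion_insert, Set.insert_sdiff_singleton, Set.insert_eq_of_mem hG,
    h𝒢.sUnion_factors hF]

end Building

/-! ### Nested sets -/

/-- The join of the elements of `T` strictly below `K`. -/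
def below (T : Set (Set α)) (K : Set α) : Set α := ⋃₀ {t ∈ T | t ⊂ K}

lemma below_subset (T : Set (Set α)) (K : Set α) : below T K ⊆ K :=
  Set.sUnion_subset fun _ h => h.2.subset

lemma below_mono {T T' : Set (Set α)} (h : T ⊆ T') (K : Set α) : below T K ⊆ below T' K :=
  Set.sUnion_subset_sUnion fun _ ht => ⟨h ht.1, ht.2⟩

lemma subset_below {T : Set (Set α)} {K t : Set α} (ht : t ∈ T) (h : t ⊂ K) : t ⊆ below T K :=
  Set.subset_sUnion_of_mem (show t ∈ {t ∈ T | t ⊂ K} from ⟨ht, h⟩)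

/-- The rank of the interval between `K` and the join of the elements of `T` strictly below `K`. -/
def relRk (M : Matroid α) (T : Set (Set α)) (K : Set α) : ℕ := rk M K - rk M (below T K)

section Nested

variable {M : Matroid α} {𝒢 : Finset (Set α)} {S T : Set (Set α)}

lemma IsNested.mono (hT : IsNested M 𝒢 T) (h : S ⊆ T) : IsNested M 𝒢 S :=
  ⟨h.trans hT.1, fun A hA => hT.2 A (hA.trans h)⟩

lemma IsNested.finite (hT : IsNested M 𝒢 T) : T.Finite := 𝒢.finite_toSet.subset hT.1

lemma IsNested.exists_maximal (hT : IsNested M 𝒢 T) {t : Set α} (ht : t ∈ T) :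
    ∃ s ∈ T, t ⊆ s ∧ ∀ u ∈ T, s ⊆ u → u = s := by
  obtain ⟨s, hts, hs⟩ := hT.finite.exists_le_maximal ht
  exact ⟨s, hs.prop, hts, fun u hu hsu => (hs.eq_of_subset hu hsu).symm⟩

variable [M.Finite] [M.Loopless] (h𝒢 : IsBuildingSet M 𝒢)

include h𝒢

lemma IsNested.subset_or_subset (hT : IsNested M 𝒢 T) {a b : Set α} (ha : a ∈ T) (hb : b ∈ T)
    {e : α} (hea : e ∈ a) (heb : e ∈ b) : a ⊆ b ∨ b ⊆ a := by
  by_contra! hc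
  refine hT.2 {a, b} (Set.insert_subset ha (Set.singleton_subset_iff.2 hb)) ?_ ?_ ?_
  · rintro x (rfl | rfl) y (rfl | rfl) hxy
    · exact absurd rfl hxy
    · exact hc.1
    · exact hc.2
    · exact absurd rfl hxy
  · refine ⟨a, by simp, b, by simp, ?_⟩
    rintro rfl
    exact hc.1 subset_rfl
  · rw [Set.sUnion_pair]
    exact h𝒢.closure_union_mem (hT.1 ha) (hT.1 hb) ⟨e, hea, heb⟩

lemma IsNested.sUnion_subset_ground (hT : IsNested M 𝒢 T) : ⋃₀ T ⊆ M.E :=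
  Set.sUnion_subset fun _ h => h𝒢.subset_ground (hT.1 h)

/-- The members of `S` in other factors are skew to `K`, so `K` is spanned by the members inside
`K`. The maximal ones among these form an antichain with join `K ∈ 𝒢`, which nestedness permits only
if there is just one. -/
lemma IsNested.mem_of_mem_factors (hS : IsNested M 𝒢 S) {K : Set α}
    (hK : K ∈ factors 𝒢 (M.closure (⋃₀ S))) : K ∈ S := by
  have hK𝒢 := BuiltMatroid.mem_of_mem_factors hK
  have hF := M.isFlat_closure (⋃₀ S)
  have hS' : {s ∈ S | s ⊆ K} ⊆ S := Set.sep_subset _ _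
  have hSK : K ⊆ M.closure (⋃₀ {s ∈ S | s ⊆ K}) := by
    intro e he
    refine mem_closure_left_of_skew (h𝒢.rk_factor hF hK)
      (Set.sUnion_subset fun s hs => hs.2) subset_rfl ?_ he
    refine M.closure_subset_closure ?_ (subset_of_mem_factors hK he)
    refine Set.sUnion_subset fun s hs => ?_
    have hsF : s ⊆ M.closure (⋃₀ S) :=
      (Set.subset_sUnion_of_mem hs).trans (M.subset_closure _ (hS.sUnion_subset_ground h𝒢))
    obtain ⟨K', hK', hsK'⟩ := exists_factor_superset (hS.1 hs) hsF
    by_cases h : K' = K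
    · subst h
      exact (Set.subset_sUnion_of_mem (show s ∈ {s ∈ S | s ⊆ K'} from ⟨hs, hsK'⟩)).trans
        Set.subset_union_left
    · exact (hsK'.trans (Set.subset_sUnion_of_mem
        (show K' ∈ factors 𝒢 (M.closure (⋃₀ S)) \ {K} from ⟨hK', h⟩))).trans Set.subset_union_right
  set A : Set (Set α) := {s | s ∈ S ∧ s ⊆ K ∧ ∀ u ∈ S, u ⊆ K → s ⊆ u → u = s} with hA
  have hAS : A ⊆ S := fun s hs => hs.1
  have hcov : ⋃₀ {s ∈ S | s ⊆ K} ⊆ ⋃₀ A := by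
    refine Set.sUnion_subset fun s hs => ?_
    obtain ⟨t, ht, hst, hmax⟩ := (hS.mono hS').exists_maximal hs
    exact hst.trans (Set.subset_sUnion_of_mem
      (show t ∈ A from ⟨ht.1, ht.2, fun u hu huK hsu => hmax u ⟨hu, huK⟩ hsu⟩))
  have hAK : M.closure (⋃₀ A) = K := by
    refine (closure_subset_of_isFlat (h𝒢.isFlat hK𝒢)
      (Set.sUnion_subset fun s hs => hs.2.1)).antisymm ?_
    exact hSK.trans (M.closure_subset_closure hcov)
  have hanti : IsAntichain (· ⊆ ·) A := by
    intro s hs t ht hne hst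
    exact hne (hs.2.2 t ht.1 ht.2.1 hst).symm
  have hnot : ¬ A.Nontrivial := fun h => hS.2 A hAS hanti h (by rw [hAK]; exact hK𝒢)
  rw [Set.not_nontrivial_iff] at hnot
  rcases hnot.eq_empty_or_singleton with h | ⟨s, h⟩
  · rw [h, Set.sUnion_empty, closure_empty_eq] at hAK
    exact absurd hAK.symm (h𝒢.nonempty hK𝒢).ne_empty
  · have hs : s ∈ S := hAS (by rw [h]; rfl)
    rw [h, Set.sUnion_singleton, (h𝒢.isFlat (hS.1 hs)).closure] at hAK
    exact hAK ▸ hs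

/-- The form in which nestedness is mostly used: an element of `𝒢` below the join of a nested set is
below a single member. -/
lemma IsNested.exists_superset (hS : IsNested M 𝒢 S) {H : Set α} (hH : H ∈ 𝒢)
    (h : H ⊆ M.closure (⋃₀ S)) : ∃ s ∈ S, H ⊆ s := by
  obtain ⟨K, hK, hHK⟩ := exists_factor_superset hH h
  exact ⟨K, hS.mem_of_mem_factors h𝒢 hK, hHK⟩

lemma IsNested.isFlat_sUnion (hS : IsNested M 𝒢 S) : M.IsFlat (⋃₀ S) := by
  rw [Matroid.isFlat_iff_closure_eq]
  refine Set.Subset.antisymm ?_ (M.subset_closure _ (hS.sUnion_subset_ground h𝒢))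
  rw [← h𝒢.sUnion_factors (M.isFlat_closure (⋃₀ S))]
  exact Set.sUnion_subset_sUnion fun K hK => hS.mem_of_mem_factors h𝒢 hK

lemma IsNested.isFlat_below (hT : IsNested M 𝒢 T) (K : Set α) : M.IsFlat (below T K) :=
  (hT.mono (Set.sep_subset _ _)).isFlat_sUnion h𝒢

lemma IsNested.mem_factors (hS : IsNested M 𝒢 S) {s : Set α} (hs : s ∈ S)
    (hmax : ∀ t ∈ S, s ⊆ t → t = s) : s ∈ factors 𝒢 (⋃₀ S) := by
  refine ⟨⟨hS.1 hs, Set.subset_sUnion_of_mem hs⟩, fun H hH hsH => ?_⟩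
  have h := hH.2
  rw [← (hS.isFlat_sUnion h𝒢).closure] at h
  obtain ⟨t, ht, hHt⟩ := hS.exists_superset h𝒢 hH.1 h
  rw [hmax t ht (Set.Subset.trans hsH hHt)] at hHt
  exact hHt

lemma IsNested.skew (hS : IsNested M 𝒢 S) {s : Set α} (hs : s ∈ S)
    (hmax : ∀ t ∈ S, s ⊆ t → t = s) :
    rk M (s ∪ ⋃₀ {t ∈ S | ¬ t ⊆ s}) = rk M s + rk M (⋃₀ {t ∈ S | ¬ t ⊆ s}) := by
  refine skew_mono (h𝒢.rk_factor (hS.isFlat_sUnion h𝒢) (hS.mem_factors h𝒢 hs hmax)) subset_rfl ?_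
  refine Set.sUnion_subset fun t ht => ?_
  obtain ⟨K, hK, htK⟩ := exists_factor_superset (hS.1 ht.1) (Set.subset_sUnion_of_mem ht.1)
  refine htK.trans (Set.subset_sUnion_of_mem ⟨hK, ?_⟩)
  rintro rfl
  exact ht.2 htK

/-- How the rank of the join changes when a maximal element is removed. -/
lemma IsNested.rk_sUnion_add (hS : IsNested M 𝒢 S) {s : Set α} (hs : s ∈ S)
    (hmax : ∀ t ∈ S, s ⊆ t → t = s) :
    rk M (⋃₀ S) + rk M (below S s) = rk M (⋃₀ (S \ {s})) + rk M s := by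
  have h1 := hS.skew h𝒢 hs hmax
  have h2 := skew_mono h1 (below_subset S s) subset_rfl
  have e1 : ⋃₀ S = s ∪ ⋃₀ {t ∈ S | ¬ t ⊆ s} := by
    refine Set.Subset.antisymm (Set.sUnion_subset fun t ht => ?_)
      (Set.union_subset (Set.subset_sUnion_of_mem hs)
        (Set.sUnion_subset_sUnion (Set.sep_subset _ _)))
    by_cases h : t ⊆ s
    · exact h.trans Set.subset_union_left
    · exact (Set.subset_sUnion_of_mem (show t ∈ {t ∈ S | ¬ t ⊆ s} from ⟨ht, h⟩)).trans
        Set.subset_union_right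
  have e2 : ⋃₀ (S \ {s}) = below S s ∪ ⋃₀ {t ∈ S | ¬ t ⊆ s} := by
    refine Set.Subset.antisymm (Set.sUnion_subset fun t ht => ?_)
      (Set.union_subset (Set.sUnion_subset_sUnion fun t ht => ⟨ht.1, ht.2.ne⟩)
        (Set.sUnion_subset_sUnion fun t ht => ⟨ht.1, ?_⟩))
    · by_cases h : t ⊆ s
      · exact (subset_below ht.1 (h.ssubset_of_ne ht.2)).trans Set.subset_union_left
      · exact (Set.subset_sUnion_of_mem (show t ∈ {t ∈ S | ¬ t ⊆ s} from ⟨ht.1, h⟩)).trans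
          Set.subset_union_right
    · rintro rfl
      exact ht.2 subset_rfl
  rw [e1, e2, h1, h2]
  omega

/-- Otherwise `K` would lie below the join of members strictly below it, hence inside one of them.
-/
lemma IsNested.rk_below_lt (hT : IsNested M 𝒢 T) {K : Set α} (hK : K ∈ 𝒢) :
    rk M (below T K) < rk M K := by
  by_contra! hc
  have h1 := subset_of_rk_le (hT.isFlat_below h𝒢 K) (h𝒢.subset_ground hK) (below_subset T K) hc
  have hT' : IsNested M 𝒢 {t ∈ T | t ⊂ K} := hT.mono (Set.sep_subset _ _)
  obtain ⟨t, ht, hKt⟩ := hT'.exists_superset h𝒢 hK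
    (h1.trans (M.subset_closure _ (hT'.sUnion_subset_ground h𝒢)))
  exact ht.2.2 hKt

lemma IsNested.relRk_pos (hT : IsNested M 𝒢 T) {K : Set α} (hK : K ∈ 𝒢) :
    0 < relRk M T K := Nat.sub_pos_of_lt (hT.rk_below_lt h𝒢 hK)

/-- A criterion for a factor of a flat to extend a nested set. -/
lemma IsNested.insert (hT : IsNested M 𝒢 T) {F X : Set α} (hF : M.IsFlat F)
    (hX : X ∈ factors 𝒢 F)
    (h : ∀ t ∈ T, t ⊆ F ∨ X ⊆ t ∨ ∃ P ∈ T, X ⊆ P ∧ ∀ e ∈ t, e ∉ P) :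
    IsNested M 𝒢 (insert X T) := by
  have hX𝒢 := BuiltMatroid.mem_of_mem_factors hX
  refine ⟨Set.insert_subset hX𝒢 hT.1, fun A hA hanti hnt hJ => ?_⟩
  by_cases hXA : X ∈ A
  swap
  · exact hT.2 A (fun a ha => (hA ha).resolve_left fun h => hXA (h ▸ ha)) hanti hnt hJ
  have hAE : ⋃₀ A ⊆ M.E := Set.sUnion_subset fun a ha => by
    rcases hA ha with rfl | h
    · exact h𝒢.subset_ground hX𝒢
    · exact h𝒢.subset_ground (hT.1 h)
  have hsubJ : ∀ a ∈ A, a ⊆ M.closure (⋃₀ A) := fun a ha =>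
    (Set.subset_sUnion_of_mem ha).trans (M.subset_closure _ hAE)
  by_cases hall : ∀ a ∈ A, a ⊆ F
  · have hJF : M.closure (⋃₀ A) ⊆ F := closure_subset_of_isFlat hF (Set.sUnion_subset hall)
    have heq := eq_of_mem_factors hX hJ hJF (hsubJ X hXA)
    obtain ⟨a, ha, hne⟩ := hnt.exists_ne X
    exact hanti ha hXA hne (by rw [heq]; exact hsubJ a ha)
  · push Not at hall
    obtain ⟨a, ha, haF⟩ := hall
    have haX : a ≠ X := by
      rintro rfl
      exact haF (subset_of_mem_factors hX)
    have haT : a ∈ T := (hA ha).resolve_left haX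
    rcases h a haT with h | h | ⟨P, hP, hXP, hdis⟩
    · exact haF h
    · exact hanti hXA ha haX.symm h
    -- Replace `X` by the larger `P`. The join of `A` is then below the join of a nested set, hence
    -- inside one member: `P` is impossible because it misses `a`, and a member of `A` other than
    -- `X` would contain `X`.
    have hB : Insert.insert P (A \ {X}) ⊆ T :=
      Set.insert_subset hP fun b hb => (hA hb.1).resolve_left hb.2
    obtain ⟨b, hb, hJb⟩ := (hT.mono hB).exists_superset h𝒢 hJ (by
      refine M.closure_subset_closure (Set.sUnion_subset fun b hb => ?_)
      by_cases hbX : b = X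
      · exact hbX ▸ hXP.trans (Set.subset_sUnion_of_mem (Set.mem_insert _ _))
      · exact Set.subset_sUnion_of_mem (Set.mem_insert_of_mem _ ⟨hb, hbX⟩))
    rcases hb with rfl | hb
    · obtain ⟨e, he⟩ := h𝒢.nonempty (hT.1 haT)
      exact hdis e he (hJb (hsubJ a ha he))
    · exact hanti hXA hb.1 (Ne.symm hb.2) ((hsubJ X hXA).trans hJb)

/-- The union of the elements of a nested set that do not contain `K` does not span `K`. -/
lemma IsNested.rk_lt_rk_union (hT : IsNested M 𝒢 T) {K : Set α} (hK : K ∈ 𝒢) :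
    rk M (⋃₀ {t ∈ T | ¬ K ⊆ t}) < rk M (K ∪ ⋃₀ {t ∈ T | ¬ K ⊆ t}) := by
  by_contra! hc
  have hT' : IsNested M 𝒢 {t ∈ T | ¬ K ⊆ t} := hT.mono (Set.sep_subset _ _)
  have h1 := subset_of_rk_le (hT'.isFlat_sUnion h𝒢)
    (Set.union_subset (h𝒢.subset_ground hK) (hT'.sUnion_subset_ground h𝒢))
    Set.subset_union_right hc
  obtain ⟨t, ht, hKt⟩ := hT'.exists_superset h𝒢 hK
    ((Set.subset_union_left.trans h1).trans (M.subset_closure _ (hT'.sUnion_subset_ground h𝒢)))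
  exact ht.2 hKt

/-- The smallest element of the building set that contains `K` and is compatible with the nested
set `T`. -/
lemma IsNested.exists_hull (hT : IsNested M 𝒢 T) {K : Set α} (hK : K ∈ 𝒢) :
    ∃ S ∈ 𝒢, K ⊆ S ∧ IsNested M 𝒢 (Insert.insert S T) ∧
      (∀ L ∈ 𝒢, K ⊆ L → IsNested M 𝒢 (Insert.insert L T) → S ⊆ L) ∧
      rk M S + rk M (⋃₀ {t ∈ T | ¬ K ⊆ t}) ≤
        rk M (K ∪ ⋃₀ {t ∈ T | ¬ K ⊆ t}) + rk M (below T S) := by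
  have hT' : IsNested M 𝒢 {t ∈ T | ¬ K ⊆ t} := hT.mono (Set.sep_subset _ _)
  set X := ⋃₀ {t ∈ T | ¬ K ⊆ t} with hX
  have hE : K ∪ X ⊆ M.E :=
    Set.union_subset (h𝒢.subset_ground hK) (hT'.sUnion_subset_ground h𝒢)
  have hF := M.isFlat_closure (K ∪ X)
  have hsub := M.subset_closure _ hE
  obtain ⟨S, hS, hKS⟩ := exists_factor_superset hK (Set.subset_union_left.trans hsub)
  have hS𝒢 := BuiltMatroid.mem_of_mem_factors hS
  -- For compatible `L ⊇ K`, the factor `S` is below the join of `L` and the members not containing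
  -- `K`, hence inside one of them. Since `K ⊆ S`, that one must be `L`.
  have hmin : ∀ L ∈ 𝒢, K ⊆ L → IsNested M 𝒢 (Insert.insert L T) → S ⊆ L := by
    intro L hL hKL hLT
    have hN : Insert.insert L {t ∈ T | ¬ K ⊆ t} ⊆ Insert.insert L T :=
      Set.insert_subset_insert (Set.sep_subset _ _)
    obtain ⟨t, ht, hSt⟩ := (hLT.mono hN).exists_superset h𝒢 hS𝒢 (by
      refine (subset_of_mem_factors hS).trans (M.closure_subset_closure ?_)
      rw [Set.sUnion_insert]
      exact Set.union_subset_union_left _ hKL)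
    rcases ht with rfl | ht
    · exact hSt
    · exact absurd (hKS.trans hSt) ht.2
  refine ⟨S, hS𝒢, hKS, hT.insert h𝒢 hF hS fun t ht => ?_, hmin, ?_⟩
  · by_cases hKt : K ⊆ t
    · exact Or.inr (Or.inl (hmin t (hT.1 ht) hKt (by rwa [Set.insert_eq_of_mem ht])))
    · refine Or.inl (Set.Subset.trans ?_ hsub)
      exact (Set.subset_sUnion_of_mem (show t ∈ {t ∈ T | ¬ K ⊆ t} from ⟨ht, hKt⟩)).trans
        Set.subset_union_right
  · have h1 := h𝒢.rk_factor hF hS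
    rw [h𝒢.sUnion_factors_eq hF hS, rk_closure] at h1
    -- A member not containing `K` lies either strictly below `S` or in another factor, and the
    -- other factors are skew to `S`. This is the source of the rank inequality.
    have h2 : X ⊆ below T S ∪ ⋃₀ (factors 𝒢 (M.closure (K ∪ X)) \ {S}) := by
      refine Set.sUnion_subset fun t ht => ?_
      obtain ⟨S', hS', htS'⟩ := exists_factor_superset (hT.1 ht.1)
        (((Set.subset_sUnion_of_mem ht).trans Set.subset_union_right).trans hsub)
      by_cases h : S' = S
      · subst h
        refine (subset_below ht.1 (htS'.ssubset_of_ne ?_)).trans Set.subset_union_left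
        rintro rfl
        exact ht.2 hKS
      · exact (htS'.trans (Set.subset_sUnion_of_mem
          (show S' ∈ factors 𝒢 (M.closure (K ∪ X)) \ {S} from ⟨hS', h⟩))).trans
          Set.subset_union_right
    have h3 := (rk_mono (M := M) h2).trans (rk_union_le _ _)
    omega

end Nested

/-! ### The Feichtner–Yuzvinsky relations -/

open Classical in
/-- The sum of the variables indexed by the elements of the building set that contain `K`. -/
def hsum (𝒢 : Finset (Set α)) (K : Set α) : MvPolynomial 𝒢 ℤ :=
  ∑ G : {G // G ∈ 𝒢} with K ⊆ G.1, MvPolynomial.X G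

/-- The square-free monomial with support `A`. -/
def xprod {𝒢 : Finset (Set α)} (A : Finset 𝒢) : MvPolynomial 𝒢 ℤ := ∏ G ∈ A, MvPolynomial.X G

/-- The set of sets underlying a finite subset of the building set. -/
def vals {𝒢 : Finset (Set α)} (A : Finset 𝒢) : Set (Set α) := Subtype.val '' (A : Set 𝒢)

/-- The generators of the ideal `fyIdeal`. -/
def fyGens (M : Matroid α) (𝒢 : Finset (Set α)) (U : Finset 𝒢) (B : Set (Set α)) :
    Set (MvPolynomial 𝒢 ℤ) :=
  {p | (∃ K ∉ U, p = MvPolynomial.X K) ∨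
    (∃ A : Finset 𝒢, ¬ IsNested M 𝒢 (vals A ∪ B) ∧ p = xprod A) ∨
    ∃ A : Finset 𝒢, ∃ K ∈ U, IsNested M 𝒢 (insert K.1 (vals A ∪ B)) ∧
      p = xprod A * hsum 𝒢 K.1 ^ relRk M (vals A ∪ B) K.1}

/-- The ideal of Feichtner–Yuzvinsky relations in the variables indexed by `U`, relative to a
nested set `B`. -/
def fyIdeal (M : Matroid α) (𝒢 : Finset (Set α)) (U : Finset 𝒢) (B : Set (Set α)) :
    Ideal (MvPolynomial 𝒢 ℤ) := Ideal.span (fyGens M 𝒢 U B)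

/-- The exponents of the standard monomials of `fyIdeal M 𝒢 U B`. -/
def IsStandard (M : Matroid α) (𝒢 : Finset (Set α)) (U : Finset 𝒢) (B : Set (Set α))
    (m : 𝒢 →₀ ℕ) : Prop :=
  m.support ⊆ U ∧ IsNested M 𝒢 (vals m.support ∪ B) ∧
    ∀ K ∈ m.support, m K < relRk M (vals m.support ∪ B) K.1

section FY

variable {M : Matroid α} {𝒢 : Finset (Set α)} {U : Finset 𝒢} {B : Set (Set α)} {A : Finset 𝒢}

lemma mem_vals {K : 𝒢} : K.1 ∈ vals A ↔ K ∈ A := by simp [vals]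

open Classical in
lemma vals_insert (K : 𝒢) : vals (insert K A) = insert K.1 (vals A) := by
  simp [vals, Set.image_insert_eq]

open Classical in
lemma vals_erase_union {G : 𝒢} (hG : G ∈ A) :
    vals (A.erase G) ∪ insert G.1 B = vals A ∪ B := by
  conv_rhs => rw [← Finset.insert_erase hG, vals_insert]
  simp [Set.insert_union]

lemma X_mem_fyIdeal {K : 𝒢} (hK : K ∉ U) : MvPolynomial.X K ∈ fyIdeal M 𝒢 U B :=
  Ideal.subset_span (Or.inl ⟨K, hK, rfl⟩)

lemma xprod_mem_of_mem {I : Ideal (MvPolynomial 𝒢 ℤ)} {K : 𝒢} (hK : K ∈ A)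
    (h : MvPolynomial.X K ∈ I) : xprod A ∈ I :=
  I.mem_of_dvd (Finset.dvd_prod_of_mem _ hK) h

lemma xprod_mem_fyIdeal (h : ¬ IsNested M 𝒢 (vals A ∪ B)) : xprod A ∈ fyIdeal M 𝒢 U B :=
  Ideal.subset_span (Or.inr (Or.inl ⟨A, h, rfl⟩))

lemma xprod_mul_hsum_pow_mem_fyIdeal {K : 𝒢} (hK : K ∈ U)
    (h : IsNested M 𝒢 (insert K.1 (vals A ∪ B))) {e : ℕ} (he : relRk M (vals A ∪ B) K.1 ≤ e) :
    xprod A * hsum 𝒢 K.1 ^ e ∈ fyIdeal M 𝒢 U B :=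
  Ideal.mem_of_dvd _ (mul_dvd_mul_left _ (pow_dvd_pow _ he))
    (Ideal.subset_span (Or.inr (Or.inr ⟨A, K, hK, h, rfl⟩)))

open Classical in
lemma xprod_insert_dvd (L : 𝒢) : xprod (insert L A) ∣ xprod A * MvPolynomial.X L := by
  by_cases h : L ∈ A
  · rw [Finset.insert_eq_of_mem h]
    exact dvd_mul_right _ _
  · rw [xprod, Finset.prod_insert h, mul_comm]
    rfl

open Classical in
lemma hsum_sub_hsum {K S : Set α} (h : K ⊆ S) :
    hsum 𝒢 K = hsum 𝒢 S + ∑ G : {G // G ∈ 𝒢} with K ⊆ G.1 ∧ ¬ S ⊆ G.1, MvPolynomial.X G := by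
  rw [hsum, hsum, ← Finset.sum_filter_add_sum_filter_not _ (fun G : {G // G ∈ 𝒢} => S ⊆ G.1),
    Finset.filter_filter, Finset.filter_filter]
  congr 2
  ext G
  simp only [Finset.mem_filter]
  exact ⟨fun h' => ⟨h'.1, h'.2.2⟩, fun h' => ⟨h'.1, h.trans h'.2, h'.2⟩⟩

variable [M.Finite] [M.Loopless] (h𝒢 : IsBuildingSet M 𝒢)

include h𝒢

/-- Let `S` be the hull of `K` relative to `A ∪ B`. A variable `x_L` with `K ⊆ L` and `S ⊄ L` is
incompatible with `A ∪ B`, so modulo non-nested monomials `hsum 𝒢 K` may be replaced by `hsum 𝒢 S`.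
The generating relation for `S` then applies: its exponent is at most the marginal rank of `K` over
all members not containing `K`, hence at most that over `Y`. -/
lemma xprod_mul_hsum_pow_mem (hT : IsNested M 𝒢 (vals A ∪ B)) {K : 𝒢} {Y : Set α}
    (hY : Y ⊆ ⋃₀ {t ∈ vals A ∪ B | ¬ K.1 ⊆ t}) {e : ℕ} (he : rk M (K.1 ∪ Y) ≤ e + rk M Y)
    (hU : ∀ S : 𝒢, K.1 ⊆ S.1 → IsNested M 𝒢 (insert S.1 (vals A ∪ B)) → S ∈ U) :
    xprod A * hsum 𝒢 K.1 ^ e ∈ fyIdeal M 𝒢 U B := by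
  classical
  obtain ⟨S, hS, hKS, hST, hmin, hrk⟩ := hT.exists_hull h𝒢 K.2
  have h1 : xprod A * hsum 𝒢 S ^ e ∈ fyIdeal M 𝒢 U B := by
    refine xprod_mul_hsum_pow_mem_fyIdeal (K := ⟨S, hS⟩) (hU ⟨S, hS⟩ hKS hST) hST ?_
    have := rk_union_add_rk_le (M := M) (K := K.1) hY
    unfold relRk
    change rk M S - rk M (below (vals A ∪ B) S) ≤ e
    omega
  have h2 : xprod A * (hsum 𝒢 K.1 - hsum 𝒢 S) ∈ fyIdeal M 𝒢 U B := by
    rw [hsum_sub_hsum hKS, add_sub_cancel_left, Finset.mul_sum]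
    refine Ideal.sum_mem _ fun L hL => Ideal.mem_of_dvd _ (xprod_insert_dvd L) ?_
    refine xprod_mem_fyIdeal fun hn => ?_
    rw [vals_insert, Set.insert_union] at hn
    rw [Finset.mem_filter] at hL
    exact hL.2.2 (hmin L.1 L.2 hL.2.1 hn)
  have h3 : xprod A * (hsum 𝒢 K.1 ^ e - hsum 𝒢 S ^ e) ∈ fyIdeal M 𝒢 U B :=
    Ideal.mem_of_dvd _ (mul_dvd_mul_left _ (sub_dvd_pow_sub_pow _ _ e)) h2
  have := Ideal.add_mem _ h3 h1
  rwa [← mul_add, sub_add_cancel] at this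

omit [M.Finite] [M.Loopless] h𝒢 in
lemma below_subset_sUnion (T : Set (Set α)) (K : Set α) : below T K ⊆ ⋃₀ {t ∈ T | ¬ K ⊆ t} :=
  Set.sUnion_subset_sUnion fun _ ht => ⟨ht.1, ht.2.2⟩

omit [M.Finite] [M.Loopless] h𝒢 in
lemma rk_le_relRk_add (T : Set (Set α)) (K : Set α) :
    rk M K ≤ relRk M T K + rk M (below T K) := by
  unfold relRk
  omega

omit [M.Finite] [M.Loopless] h𝒢 in
lemma rk_union_below_le (T : Set (Set α)) (K : Set α) :
    rk M (K ∪ below T K) ≤ relRk M T K + rk M (below T K) := by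
  rw [Set.union_eq_left.2 (below_subset T K)]
  exact rk_le_relRk_add T K

/-- The inductive step: multiplication by a power of `hsum 𝒢 G` maps the relations of the link of
`G` to relations. -/
lemma hsum_pow_mul_mem {G : 𝒢} (hGU : G ∉ U) (hup : ∀ K ∈ U, ∀ L : 𝒢, K.1 ⊆ L.1 → L ∈ U)
    (hG : ∀ L : 𝒢, G.1 ⊂ L.1 → L ∈ U)
    {p : MvPolynomial 𝒢 ℤ} (hp : p ∈ fyIdeal M 𝒢 U (insert G.1 B)) :
    hsum 𝒢 G.1 ^ relRk M B G.1 * p ∈ fyIdeal M 𝒢 U B := by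
  classical
  set n := relRk M B G.1 with hn
  suffices hsuff : fyIdeal M 𝒢 U (insert G.1 B) ≤
      Submodule.comap (LinearMap.mulLeft (MvPolynomial 𝒢 ℤ) (hsum 𝒢 G.1 ^ n))
        (fyIdeal M 𝒢 U B) from
    hsuff hp
  refine Submodule.span_le.2 ?_
  rintro _ (⟨K, hK, rfl⟩ | ⟨A, hA, rfl⟩ | ⟨A, K, hKU, hA, rfl⟩)
  · exact Ideal.mul_mem_left _ _ (X_mem_fyIdeal hK)
  · change hsum 𝒢 G.1 ^ n * xprod A ∈ fyIdeal M 𝒢 U B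
    by_cases hAB : IsNested M 𝒢 (vals A ∪ B)
    swap
    · exact Ideal.mul_mem_left _ _ (xprod_mem_fyIdeal hAB)
    rw [mul_comm]
    refine xprod_mul_hsum_pow_mem h𝒢 hAB (Y := below B G.1) ?_ (rk_union_below_le B G.1) ?_
    · exact (below_mono Set.subset_union_right G.1).trans (below_subset_sUnion _ _)
    · intro S hGS hS
      refine hG S (hGS.ssubset_of_ne fun h => hA ?_)
      rwa [Set.union_insert, h]
  · change hsum 𝒢 G.1 ^ n * (xprod A * hsum 𝒢 K.1 ^ relRk M (vals A ∪ insert G.1 B) K.1) ∈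
      fyIdeal M 𝒢 U B
    have hAB : IsNested M 𝒢 (insert K.1 (vals A ∪ B)) := hA.mono (Set.insert_subset_insert
      (Set.union_subset_union_right _ (Set.subset_insert _ _)))
    by_cases hGK : G.1 ⊂ K.1
    swap
    · refine Ideal.mul_mem_left _ _ (xprod_mul_hsum_pow_mem_fyIdeal hKU hAB (le_of_eq ?_))
      have : below (vals A ∪ insert G.1 B) K.1 = below (vals A ∪ B) K.1 := by
        refine Set.Subset.antisymm (Set.sUnion_subset ?_)
          (below_mono (Set.union_subset_union_right _ (Set.subset_insert _ _)) _)
        rintro t ⟨ht | rfl | ht, htK⟩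
        · exact subset_below (Or.inl ht) htK
        · exact absurd htK hGK
        · exact subset_below (Or.inr ht) htK
      rw [relRk, relRk, this]
    set m := relRk M (vals A ∪ insert G.1 B) K.1 with hm
    set Y := below (vals A ∪ insert G.1 B) K.1 with hYdef
    have hKY := rk_le_relRk_add (M := M) (vals A ∪ insert G.1 B) K.1
    rw [← hm, ← hYdef] at hKY
    -- Trade the `n` factors `hsum 𝒢 G` for factors `hsum 𝒢 K` one at a time, using that their
    -- difference is the sum of the `x_L` with `G ⊆ L` and `K ⊄ L`. At `j = 0` the exponent `m + n`
    -- suffices, since forgetting `G` increases the relative rank of `K` by at most `n`. In an error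
    -- term, either `L = G`, whose variable is a relation, or `L ⊇ G` takes over the role of `G`
    -- below `K` and the exponent `m` is enough.
    have key : ∀ j i, i + j = n →
        xprod A * hsum 𝒢 K.1 ^ (m + i) * hsum 𝒢 G.1 ^ j ∈ fyIdeal M 𝒢 U B := by
      intro j
      induction j with
      | zero =>
        intro i hi
        rw [pow_zero, mul_one]
        refine xprod_mul_hsum_pow_mem_fyIdeal hKU hAB ?_
        have h1 : Y ⊆ G.1 ∪ below (vals A ∪ B) K.1 := by
          refine Set.sUnion_subset ?_
          rintro t ⟨ht | rfl | ht, htK⟩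
          · exact (subset_below (Or.inl ht) htK).trans Set.subset_union_right
          · exact Set.subset_union_left
          · exact (subset_below (Or.inr ht) htK).trans Set.subset_union_right
        have h2 : below B G.1 ⊆ below (vals A ∪ B) K.1 :=
          Set.sUnion_subset fun t ht => subset_below (Or.inr ht.1) (ht.2.trans hGK)
        have h3 := rk_union_add_rk_le (M := M) (K := G.1) h2
        have h4 := rk_mono (M := M) h1
        have h5 := rk_union_below_le (M := M) B G.1
        unfold relRk
        omega
      | succ j ih =>
        intro i hi
        have e : xprod A * hsum 𝒢 K.1 ^ (m + i) * hsum 𝒢 G.1 ^ (j + 1) =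
            xprod A * hsum 𝒢 K.1 ^ (m + (i + 1)) * hsum 𝒢 G.1 ^ j +
            (∑ L : {L // L ∈ 𝒢} with G.1 ⊆ L.1 ∧ ¬ K.1 ⊆ L.1,
              xprod A * MvPolynomial.X L * hsum 𝒢 K.1 ^ m) *
              (hsum 𝒢 K.1 ^ i * hsum 𝒢 G.1 ^ j) := by
          rw [← Finset.sum_mul, ← Finset.mul_sum, pow_succ (hsum 𝒢 G.1) j]
          nth_rewrite 2 [hsum_sub_hsum hGK.subset]
          ring
        rw [e]
        refine Ideal.add_mem _ (ih (i + 1) (by omega)) (Ideal.mul_mem_right _ _ ?_)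
        refine Ideal.sum_mem _ fun L hL => ?_
        rw [Finset.mem_filter] at hL
        by_cases hLG : L = G
        · rw [hLG]
          exact Ideal.mul_mem_right _ _ (Ideal.mul_mem_left _ _ (X_mem_fyIdeal hGU))
        refine Ideal.mem_of_dvd _ (mul_dvd_mul_right (xprod_insert_dvd L) _) ?_
        by_cases hT : IsNested M 𝒢 (vals (insert L A) ∪ B)
        swap
        · exact Ideal.mul_mem_right _ _ (xprod_mem_fyIdeal hT)
        refine xprod_mul_hsum_pow_mem h𝒢 hT (Y := Y) ?_ ?_ fun S hKS _ => hup K hKU S hKS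
        · refine Set.sUnion_subset ?_
          have hLm : L.1 ∈ {t ∈ vals (insert L A) ∪ B | ¬ K.1 ⊆ t} := by
            refine ⟨Or.inl ?_, hL.2.2⟩
            rw [mem_vals]
            exact Finset.mem_insert_self _ _
          rintro t ⟨ht | rfl | ht, htK⟩
          · refine Set.subset_sUnion_of_mem ⟨Or.inl ?_, htK.2⟩
            rw [vals_insert]
            exact Or.inr ht
          · exact hL.2.1.trans (Set.subset_sUnion_of_mem hLm)
          · exact Set.subset_sUnion_of_mem ⟨Or.inr ht, htK.2⟩
        · rw [Set.union_eq_left.2 (below_subset _ _)]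
          exact hKY
    have := key n 0 (zero_add n)
    rw [add_zero] at this
    rwa [mul_comm]

end FY

/-! ### Independence of the standard monomials -/

section Split

variable {𝒢 : Finset (Set α)} (I : Ideal (MvPolynomial 𝒢 ℤ)) (G : 𝒢)

open Classical in
/-- Reduction modulo `I` of all variables except `G`, which becomes a polynomial variable. -/
def splitVar : MvPolynomial 𝒢 ℤ →ₐ[ℤ] (MvPolynomial 𝒢 ℤ ⧸ I)[X] :=
  MvPolynomial.aeval fun K => if K = G then Polynomial.X
    else Polynomial.C (Ideal.Quotient.mk I (MvPolynomial.X K))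

lemma splitVar_X_self : splitVar I G (MvPolynomial.X G) = Polynomial.X := by
  simp [splitVar]

lemma splitVar_X_of_ne {K : 𝒢} (h : K ≠ G) : splitVar I G (MvPolynomial.X K) =
    Polynomial.C (Ideal.Quotient.mk I (MvPolynomial.X K)) := by
  simp [splitVar, h]

lemma splitVar_xprod {A : Finset 𝒢} (h : G ∉ A) :
    splitVar I G (xprod A) = Polynomial.C (Ideal.Quotient.mk I (xprod A)) := by
  rw [xprod, map_prod, map_prod, map_prod]
  refine Finset.prod_congr rfl fun K hK => splitVar_X_of_ne I G ?_
  rintro rfl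
  exact h hK

open Classical in
lemma splitVar_hsum {K : Set α} (h : ¬ K ⊆ G.1) :
    splitVar I G (hsum 𝒢 K) = Polynomial.C (Ideal.Quotient.mk I (hsum 𝒢 K)) := by
  rw [hsum, map_sum, map_sum, map_sum]
  refine Finset.sum_congr rfl fun L hL => splitVar_X_of_ne I G ?_
  rintro rfl
  exact h (Finset.mem_filter.1 hL).2

-- Its powers are therefore monic in the variable of `G`, which makes the degree argument of the
-- elimination step possible over an arbitrary quotient ring.
open Classical in
lemma splitVar_hsum_self : ∃ c, splitVar I G (hsum 𝒢 G.1) = Polynomial.X + Polynomial.C c := by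
  refine ⟨Ideal.Quotient.mk I (∑ L ∈ (Finset.univ.filter
    (fun L : {L // L ∈ 𝒢} => G.1 ⊆ L.1)).erase G, MvPolynomial.X L), ?_⟩
  rw [hsum, ← Finset.add_sum_erase _ _ (show G ∈ Finset.univ.filter
    (fun L : {L // L ∈ 𝒢} => G.1 ⊆ L.1) by simp), map_add, splitVar_X_self, map_sum, map_sum,
    map_sum]
  congr 1
  exact Finset.sum_congr rfl fun L hL => splitVar_X_of_ne I G (Finset.ne_of_mem_erase hL)

lemma splitVar_monomial (m : 𝒢 →₀ ℕ) (c : ℤ) : splitVar I G (MvPolynomial.monomial m c) =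
    Polynomial.C (Ideal.Quotient.mk I (MvPolynomial.monomial (m.erase G) c)) *
      Polynomial.X ^ m G := by
  classical
  have h1 : MvPolynomial.monomial m c =
      MvPolynomial.monomial (m.erase G) c * MvPolynomial.X G ^ m G := by
    rw [MvPolynomial.X_pow_eq_monomial, MvPolynomial.monomial_mul, mul_one,
      Finsupp.erase_add_single]
  conv_lhs => rw [h1, map_mul, map_pow, splitVar_X_self]
  congr 1
  rw [MvPolynomial.monomial_eq, map_mul, map_mul, map_mul, Finsupp.prod, map_prod, map_prod,
    map_prod]
  congr 1
  · simp [splitVar]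
  · refine Finset.prod_congr rfl fun K hK => ?_
    rw [Finsupp.support_erase] at hK
    rw [map_pow, map_pow, map_pow, splitVar_X_of_ne I G (Finset.ne_of_mem_erase hK)]

/-- Setting the polynomial variable to zero is harmless because the variable of `G` already lies in
`I`. -/
lemma eval_splitVar (hG : MvPolynomial.X G ∈ I) (p : MvPolynomial 𝒢 ℤ) :
    (splitVar I G p).eval 0 = Ideal.Quotient.mk I p := by
  classical
  have h : ((Polynomial.evalRingHom (0 : MvPolynomial 𝒢 ℤ ⧸ I)).comp
      (splitVar I G : MvPolynomial 𝒢 ℤ →+* (MvPolynomial 𝒢 ℤ ⧸ I)[X])) = Ideal.Quotient.mk I := by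
    refine MvPolynomial.ringHom_ext (fun r => by simp) fun K => ?_
    by_cases hK : K = G
    · subst hK
      simp [splitVar_X_self, Ideal.Quotient.eq_zero_iff_mem.2 hG]
    · simp [splitVar_X_of_ne I G hK]
  exact DFunLike.congr_fun h p

end Split

/-! ### Eliminating a minimal variable. -/

section FY

variable {M : Matroid α} {𝒢 : Finset (Set α)} {U : Finset 𝒢} {B : Set (Set α)}

-- The only generators gained over `U` are the power relations at `G`, and these presuppose that `G`
-- is compatible with `B`.
open Classical in
lemma fyIdeal_insert_le_of_not_isNested {G : 𝒢} (hGB : ¬ IsNested M 𝒢 (insert G.1 B)) :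
    fyIdeal M 𝒢 (insert G U) B ≤ fyIdeal M 𝒢 U B := by
  refine Submodule.span_le.2 ?_
  rintro _ (⟨K, hK, rfl⟩ | ⟨A, hA, rfl⟩ | ⟨A, K, hKU, hA, rfl⟩)
  · exact X_mem_fyIdeal fun h => hK (Finset.mem_insert_of_mem h)
  · exact xprod_mem_fyIdeal hA
  · refine xprod_mul_hsum_pow_mem_fyIdeal ((Finset.mem_insert.1 hKU).resolve_left ?_) hA le_rfl
    rintro rfl
    exact hGB (hA.mono (Set.insert_subset_insert Set.subset_union_right))

variable [M.Finite] [M.Loopless] (h𝒢 : IsBuildingSet M 𝒢)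

include h𝒢

-- Apart from multiples of one monic power in the variable of `G`, every generator is already a
-- relation without `G`, and its coefficients with respect to that variable are relations of the
-- link of `G`. The link therefore controls the remainder.
open Classical in
lemma fyIdeal_insert_le {G : 𝒢} (hGU : G ∉ U) (hup : ∀ K ∈ U, ∀ L : 𝒢, K.1 ⊆ L.1 → L ∈ U)
    (hmin : ∀ K ∈ U, ¬ K.1 ⊆ G.1) :
    fyIdeal M 𝒢 (insert G U) B ≤ Ideal.span {hsum 𝒢 G.1 ^ relRk M B G.1} ⊔
      (fyIdeal M 𝒢 U B ⊓
        RingHom.ker (splitVar (fyIdeal M 𝒢 U (insert G.1 B)) G)) := by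
  set I₁ := fyIdeal M 𝒢 U (insert G.1 B) with hI₁
  have hker : ∀ {p}, Ideal.Quotient.mk I₁ p = 0 ↔ p ∈ I₁ := Ideal.Quotient.eq_zero_iff_mem
  have hX : ∀ K : 𝒢, K ∉ insert G U → MvPolynomial.X K ∈ Ideal.span
      {hsum 𝒢 G.1 ^ relRk M B G.1} ⊔ (fyIdeal M 𝒢 U B ⊓ RingHom.ker (splitVar I₁ G)) := by
    intro K hK
    rw [Finset.mem_insert, not_or] at hK
    refine Ideal.mem_sup_right ⟨X_mem_fyIdeal hK.2, ?_⟩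
    change splitVar I₁ G _ = 0
    rw [splitVar_X_of_ne I₁ G hK.1, hker.2 (X_mem_fyIdeal hK.2), map_zero]
  refine Submodule.span_le.2 ?_
  rintro _ (⟨K, hK, rfl⟩ | ⟨A, hA, rfl⟩ | ⟨A, K, hKU, hA, rfl⟩)
  · exact hX K hK
  · refine Ideal.mem_sup_right ⟨xprod_mem_fyIdeal hA, ?_⟩
    change splitVar I₁ G _ = 0
    by_cases hGA : G ∈ A
    · rw [xprod, ← Finset.mul_prod_erase _ _ hGA, map_mul]
      change _ * splitVar I₁ G (xprod (A.erase G)) = 0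
      rw [splitVar_xprod I₁ G (Finset.notMem_erase _ _), hker.2, map_zero, mul_zero]
      exact xprod_mem_fyIdeal (by rwa [vals_erase_union hGA])
    · rw [splitVar_xprod I₁ G hGA, hker.2, map_zero]
      exact xprod_mem_fyIdeal fun h => hA (h.mono
        (Set.union_subset_union_right _ (Set.subset_insert _ _)))
  · rw [Finset.mem_insert] at hKU
    by_cases hKG : K = G
    · subst hKG
      -- Such an `L` is outside `U` by minimality of `G`, so its variable is itself a relation.
      -- Without such an `L`, the set `A` does not affect the exponent at `G`.
      by_cases hL : ∃ L ∈ A, L.1 ⊂ K.1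
      · obtain ⟨L, hLA, hLK⟩ := hL
        refine Ideal.mul_mem_right _ _ (xprod_mem_of_mem hLA (hX L ?_))
        rw [Finset.mem_insert, not_or]
        refine ⟨?_, fun h => hmin L h hLK.subset⟩
        rintro rfl
        exact hLK.ne rfl
      · have : below (vals A ∪ B) K.1 = below B K.1 := by
          refine Set.Subset.antisymm (Set.sUnion_subset ?_) (below_mono Set.subset_union_right _)
          rintro t ⟨⟨L, hLA, rfl⟩ | ht, htK⟩
          · exact absurd ⟨L, hLA, htK⟩ hL
          · exact subset_below ht htK
        rw [show relRk M (vals A ∪ B) K.1 = relRk M B K.1 by rw [relRk, relRk, this]]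
        exact Ideal.mem_sup_left (Ideal.mul_mem_left _ _ (Ideal.mem_span_singleton_self _))
    · have hKU := hKU.resolve_left hKG
      refine Ideal.mem_sup_right ⟨xprod_mul_hsum_pow_mem_fyIdeal hKU hA le_rfl, ?_⟩
      change splitVar I₁ G _ = 0
      have hh := splitVar_hsum I₁ G (hmin K hKU)
      by_cases hGA : G ∈ A
      · rw [xprod, ← Finset.mul_prod_erase _ _ hGA, mul_assoc, map_mul]
        change _ * splitVar I₁ G (xprod (A.erase G) * _) = 0
        rw [map_mul, map_pow, hh, splitVar_xprod I₁ G (Finset.notMem_erase _ _), ← map_pow,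
          ← map_pow, ← map_mul, ← map_mul, hker.2, map_zero, mul_zero]
        refine xprod_mul_hsum_pow_mem_fyIdeal hKU ?_ ?_
        · rwa [vals_erase_union hGA]
        · rw [vals_erase_union hGA]
      · rw [map_mul, map_pow, hh, splitVar_xprod I₁ G hGA, ← map_pow,
          ← map_pow, ← map_mul, ← map_mul, hker.2, map_zero]
        by_cases hT : IsNested M 𝒢 (vals A ∪ insert G.1 B)
        · refine xprod_mul_hsum_pow_mem h𝒢 hT (Y := below (vals A ∪ B) K.1) ?_
            (rk_union_below_le _ _) fun S hKS _ => hup K hKU S hKS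
          exact (below_mono (Set.union_subset_union_right _ (Set.subset_insert _ _)) _).trans
            (below_subset_sUnion _ _)
        · exact Ideal.mul_mem_right _ _ (xprod_mem_fyIdeal hT)

-- Write `f` as `q · hsum^r` plus a remainder that vanishes in the link. The degree bound forces `q`
-- to vanish there too, so `q` is a relation of the link, and `hsum_pow_mul_mem` sends `q · hsum^r`
-- into the smaller ideal.
open Classical in
lemma mem_fyIdeal_of_splitVar {G : 𝒢} (hGU : G ∉ U)
    (hup : ∀ K ∈ U, ∀ L : 𝒢, K.1 ⊆ L.1 → L ∈ U) (hmin : ∀ K ∈ U, ¬ K.1 ⊆ G.1)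
    (hG : ∀ L : 𝒢, G.1 ⊂ L.1 → L ∈ U) {f : MvPolynomial 𝒢 ℤ}
    (hf : f ∈ fyIdeal M 𝒢 (insert G U) B)
    (hdeg : (splitVar (fyIdeal M 𝒢 U (insert G.1 B)) G f).degree < relRk M B G.1) :
    f ∈ fyIdeal M 𝒢 U B ∧ splitVar (fyIdeal M 𝒢 U (insert G.1 B)) G f = 0 := by
  set I₁ := fyIdeal M 𝒢 U (insert G.1 B) with hI₁
  have h1 := fyIdeal_insert_le h𝒢 (B := B) hGU hup hmin hf
  obtain ⟨a, ha, r, hr, rfl⟩ := Submodule.mem_sup.1 h1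
  obtain ⟨q, rfl⟩ := Ideal.mem_span_singleton'.1 ha
  have hr2 : splitVar I₁ G r = 0 := hr.2
  obtain ⟨c, hc⟩ := splitVar_hsum_self I₁ G
  have hmonic : ((Polynomial.X + Polynomial.C c) ^ relRk M B G.1).Monic :=
    (Polynomial.monic_X_add_C c).pow _
  rw [map_add, hr2, add_zero, map_mul, map_pow, hc] at hdeg ⊢
  -- Multiplying a nonzero polynomial by a monic one of degree `relRk M B G.1` gives degree at least
  -- that bound.
  have hq : splitVar I₁ G q = 0 := by
    by_contra hq
    rw [hmonic.degree_mul] at hdeg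
    have hnt : Nontrivial (MvPolynomial 𝒢 ℤ ⧸ I₁) := by
      by_contra hnt
      rw [not_nontrivial_iff_subsingleton] at hnt
      exact hq (Subsingleton.elim _ _)
    rw [Polynomial.degree_pow' (by simp), Polynomial.degree_X_add_C, nsmul_one,
      Polynomial.degree_eq_natDegree hq] at hdeg
    norm_cast at hdeg
    omega
  refine ⟨Ideal.add_mem _ ?_ hr.1, by rw [hq, zero_mul]⟩
  rw [mul_comm]
  refine hsum_pow_mul_mem h𝒢 hGU hup hG ?_
  have h2 := eval_splitVar I₁ G (X_mem_fyIdeal hGU) q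
  rw [hq, Polynomial.eval_zero] at h2
  exact Ideal.Quotient.eq_zero_iff_mem.1 h2.symm

-- This puts the coefficients of positive powers of the variable of `G` under the induction
-- hypothesis for the link.
omit [M.Finite] [M.Loopless] h𝒢 in
lemma isStandard_erase [DecidableEq 𝒢] {G : 𝒢} {m : 𝒢 →₀ ℕ}
    (hm : IsStandard M 𝒢 (insert G U) B m) (hG : G ∈ m.support) :
    IsStandard M 𝒢 U (insert G.1 B) (m.erase G) := by
  have hv : vals (m.erase G).support ∪ insert G.1 B = vals m.support ∪ B := by
    classical
    rw [Finsupp.support_erase]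
    convert vals_erase_union hG
  refine ⟨fun K hK => ?_, by rw [hv]; exact hm.2.1, fun K hK => ?_⟩
  · rw [Finsupp.support_erase, Finset.mem_erase] at hK
    exact (Finset.mem_insert.1 (hm.1 hK.2)).resolve_left hK.1
  · rw [hv]
    rw [Finsupp.support_erase, Finset.mem_erase] at hK
    rw [Finsupp.erase_ne hK.1]
    exact hm.2.2 K hK.2

omit [M.Finite] [M.Loopless] h𝒢 in
lemma isStandard_of_notMem [DecidableEq 𝒢] {G : 𝒢} {m : 𝒢 →₀ ℕ}
    (hm : IsStandard M 𝒢 (insert G U) B m) (hG : G ∉ m.support) : IsStandard M 𝒢 U B m := by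
  refine ⟨fun K hK => (Finset.mem_insert.1 (hm.1 hK)).resolve_left ?_, hm.2⟩
  rintro rfl
  exact hG hK

/-- No nontrivial combination of standard monomials is a relation. -/
theorem eq_zero_of_mem_fyIdeal (U : Finset 𝒢) :
    ∀ B : Set (Set α), IsNested M 𝒢 B → (∀ K ∈ U, ∀ L : 𝒢, K.1 ⊆ L.1 → L ∈ U) →
    ∀ f ∈ fyIdeal M 𝒢 U B, (∀ m ∈ f.support, IsStandard M 𝒢 U B m) → f = 0 := by
  classical
  induction U using Finset.strongInduction with
  | H U' ih =>
  intro B hB hup f hf hstd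
  rcases U'.eq_empty_or_nonempty with rfl | hne
  -- With no admissible variables, every generator has zero constant term (`A = ∅` gives no relation
  -- because `B` is nested), whereas a standard monomial is constant.
  · have hle : fyIdeal M 𝒢 ∅ B ≤ RingHom.ker (MvPolynomial.constantCoeff (σ := 𝒢) (R := ℤ)) := by
      refine Submodule.span_le.2 ?_
      rintro _ (⟨K, hK, rfl⟩ | ⟨A, hA, rfl⟩ | ⟨A, K, hKU, hA, rfl⟩)
      · simp
      · have hA : A.Nonempty := by
          by_contra h
          rw [Finset.not_nonempty_iff_eq_empty] at h
          subst h
          exact hA (by simpa [vals] using hB)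
        obtain ⟨K, hK⟩ := hA
        exact xprod_mem_of_mem hK (by simp)
      · simp at hKU
    have h0 : MvPolynomial.coeff 0 f = 0 := hle hf
    by_contra hf0
    obtain ⟨m, hm⟩ := MvPolynomial.support_nonempty.2 hf0
    have h1 : m = 0 := by
      have := (hstd m hm).1
      rwa [Finset.subset_empty, Finsupp.support_eq_empty] at this
    rw [MvPolynomial.mem_support_iff, h1] at hm
    exact hm h0
  · obtain ⟨G, hGmin⟩ := Finset.exists_minimal hne
    have hGU' : G ∈ U' := hGmin.prop
    set U := U'.erase G with hU
    have hins : insert G U = U' := Finset.insert_erase hGU'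
    have hGU : G ∉ U := Finset.notMem_erase _ _
    have hss : U ⊂ U' := Finset.erase_ssubset hGU'
    have hmin : ∀ K ∈ U, ¬ K.1 ⊆ G.1 := by
      intro K hK hKG
      rw [hU, Finset.mem_erase] at hK
      exact hK.1 (le_antisymm hKG (hGmin.le_of_le hK.2 hKG))
    have hupU : ∀ K ∈ U, ∀ L : 𝒢, K.1 ⊆ L.1 → L ∈ U := by
      intro K hK L hKL
      refine Finset.mem_erase.2 ⟨?_, hup K (Finset.mem_of_mem_erase hK) L hKL⟩
      rintro rfl
      exact hmin K hK hKL
    have hG : ∀ L : 𝒢, G.1 ⊂ L.1 → L ∈ U := by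
      intro L hL
      refine Finset.mem_erase.2 ⟨?_, hup G hGU' L hL.subset⟩
      rintro rfl
      exact hL.ne rfl
    rw [← hins] at hf hstd
    by_cases hGB : IsNested M 𝒢 (insert G.1 B)
    swap
    · refine ih U hss B hB hupU f (fyIdeal_insert_le_of_not_isNested hGB hf) fun m hm => ?_
      refine isStandard_of_notMem (hstd m hm) fun hGm => hGB ?_
      refine (hstd m hm).2.1.mono ?_
      exact Set.insert_subset (Or.inl (mem_vals.2 hGm)) Set.subset_union_right
    set I₁ := fyIdeal M 𝒢 U (insert G.1 B) with hI₁
    have hpos := (hGB.mono (Set.subset_insert _ _)).relRk_pos h𝒢 G.2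
    have hlt : ∀ m ∈ f.support, m G < relRk M B G.1 := by
      intro m hm
      by_cases hGm : G ∈ m.support
      · refine ((hstd m hm).2.2 G hGm).trans_le (Nat.sub_le_sub_left (rk_mono ?_) _)
        exact below_mono Set.subset_union_right _
      · rw [Finsupp.notMem_support_iff.1 hGm]
        exact hpos
    have hsum : splitVar I₁ G f = ∑ m ∈ f.support, Polynomial.C (Ideal.Quotient.mk I₁
        (MvPolynomial.monomial (m.erase G) (f.coeff m))) * Polynomial.X ^ m G := by
      conv_lhs => rw [f.as_sum, map_sum]
      exact Finset.sum_congr rfl fun m _ => splitVar_monomial I₁ G m _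
    have hdeg : (splitVar I₁ G f).degree < relRk M B G.1 := by
      rw [hsum]
      refine (Polynomial.degree_sum_le _ _).trans_lt ?_
      rw [Finset.sup_lt_iff (WithBot.bot_lt_coe _)]
      intro m hm
      exact (Polynomial.degree_C_mul_X_pow_le _ _).trans_lt (by exact_mod_cast hlt m hm)
    obtain ⟨hf0, hf1⟩ := mem_fyIdeal_of_splitVar h𝒢 hGU hupU hmin hG hf hdeg
    -- The coefficient of a positive power of the variable of `G` is a combination `g` of standard
    -- monomials of the link that lies in the ideal of the link. Induction with `B ∪ {G}` makes it
    -- zero.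
    have hzero : ∀ m ∈ f.support, m G = 0 := by
      intro m₀ hm₀
      by_contra hj
      set g : MvPolynomial 𝒢 ℤ := ∑ m ∈ f.support.filter (fun m => m G = m₀ G),
        MvPolynomial.monomial (m.erase G) (f.coeff m) with hg
      have hgI : g ∈ I₁ := by
        have h1 := congrArg (fun q => Polynomial.coeff q (m₀ G)) hf1
        simp only [Polynomial.coeff_zero] at h1
        rw [hsum, Polynomial.finsetSum_coeff] at h1
        simp only [Polynomial.coeff_C_mul_X_pow] at h1
        rw [← Ideal.Quotient.eq_zero_iff_mem, hg, map_sum, Finset.sum_filter]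
        refine Eq.trans (Finset.sum_congr rfl fun m _ => ?_) h1
        by_cases h : m G = m₀ G
        · rw [if_pos h, if_pos h.symm]
        · rw [if_neg h, if_neg (Ne.symm h)]
      have hcoeff : g.coeff (m₀.erase G) = f.coeff m₀ := by
        have hmem : m₀ ∈ f.support.filter (fun m => m G = m₀ G) :=
          Finset.mem_filter.2 ⟨hm₀, rfl⟩
        rw [hg, MvPolynomial.coeff_sum, Finset.sum_eq_single_of_mem m₀ hmem]
        · simp
        · intro m hm hne
          rw [MvPolynomial.coeff_monomial, if_neg]
          intro h
          apply hne
          rw [← Finsupp.erase_add_single G m, h, (Finset.mem_filter.1 hm).2,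
            Finsupp.erase_add_single]
      have hg0 : g = 0 := by
        refine ih U hss _ hGB hupU g hgI fun m' hm' => ?_
        rw [hg] at hm'
        obtain ⟨m, hm, hmm'⟩ := Finset.mem_biUnion.1 (MvPolynomial.support_sum hm')
        rw [Finset.mem_filter] at hm
        have := MvPolynomial.support_monomial_subset hmm'
        rw [Finset.mem_singleton] at this
        subst this
        refine isStandard_erase (hstd m hm.1) (Finsupp.mem_support_iff.2 ?_)
        rw [hm.2]
        exact hj
      rw [hg0, MvPolynomial.coeff_zero] at hcoeff
      exact MvPolynomial.mem_support_iff.1 hm₀ hcoeff.symm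
    refine ih U hss B hB hupU f hf0 fun m hm => isStandard_of_notMem (hstd m hm) ?_
    rw [Finsupp.notMem_support_iff]
    exact hzero m hm

end FY

/-! ### The monomial basis of the Chow ring -/

section Chow

variable {M : Matroid α} {𝒢 : Finset (Set α)} {A : Finset 𝒢}

lemma vals_union_empty : vals A ∪ (∅ : Set (Set α)) = vals A := Set.union_empty _

lemma xprod_mem_chowIdeal (h : ¬ IsNested M 𝒢 (vals A)) : xprod A ∈ chowIdeal M 𝒢 :=
  Ideal.mem_sup_left (Ideal.subset_span ⟨A, h, rfl⟩)

variable [M.Finite] [M.Loopless] (h𝒢 : IsBuildingSet M 𝒢)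

include h𝒢

lemma sum_X_eq_hsum_closure {e : α} (he : e ∈ M.E)
    [DecidablePred fun G : {G // G ∈ 𝒢} => e ∈ G.1] :
    ∑ G : {G // G ∈ 𝒢} with e ∈ G.1, MvPolynomial.X G = hsum 𝒢 (M.closure {e}) := by
  rw [hsum]
  refine Finset.sum_congr ?_ fun _ _ => rfl
  ext G
  simp only [Finset.mem_filter, Finset.mem_univ, true_and]
  refine ⟨fun h => closure_subset_of_isFlat (h𝒢.isFlat G.2) (Set.singleton_subset_iff.2 h),
    fun h => h (M.mem_closure_self e he)⟩

lemma hsum_closure_mem_chowIdeal {e : α} (he : e ∈ M.E) :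
    hsum 𝒢 (M.closure {e}) ∈ chowIdeal M 𝒢 := by
  classical
  rw [← sum_X_eq_hsum_closure h𝒢 he]
  exact Ideal.mem_sup_right (Ideal.subset_span ⟨e, he, by congr⟩)

/-- The linear relation at `e` is the power relation of the atom `cl {e}`, whose relative rank is at
most one. Only this inclusion is needed for independence. -/
lemma chowIdeal_le_fyIdeal : chowIdeal M 𝒢 ≤ fyIdeal M 𝒢 Finset.univ ∅ := by
  classical
  refine sup_le (Ideal.span_le.2 ?_) (Ideal.span_le.2 ?_)
  · rintro _ ⟨S, hS, rfl⟩
    exact xprod_mem_fyIdeal (A := S) (by rwa [vals_union_empty])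
  · rintro _ ⟨e, he, rfl⟩
    have h1 : (∑ G : {G // G ∈ 𝒢} with e ∈ G.1, MvPolynomial.X G : MvPolynomial 𝒢 ℤ) =
        xprod ∅ * hsum 𝒢 (M.closure {e}) ^ 1 := by
      rw [sum_X_eq_hsum_closure h𝒢 he, xprod, Finset.prod_empty, one_mul, pow_one]
    have h2 : xprod ∅ * hsum 𝒢 (M.closure {e}) ^ 1 ∈ fyIdeal M 𝒢 Finset.univ ∅ := by
      refine xprod_mul_hsum_pow_mem_fyIdeal
        (K := ⟨M.closure {e}, h𝒢.closure_singleton_mem he⟩) (Finset.mem_univ _) ?_ ?_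
      · have hv : vals (∅ : Finset 𝒢) = ∅ := by simp [vals]
        rw [hv, Set.union_empty, insert_empty_eq]
        refine ⟨Set.singleton_subset_iff.2 (h𝒢.closure_singleton_mem he), fun A hA _ hA' => ?_⟩
        exact absurd (Set.subsingleton_singleton.anti hA) (Set.not_subsingleton_iff.2 hA')
      · refine (Nat.sub_le _ _).trans ?_
        change rk M (M.closure {e}) ≤ 1
        rw [rk_closure]
        have := rk_insert_le (M := M) e ∅
        rw [rk_empty] at this
        simpa using this
    rw [← h1] at h2
    change _ ∈ fyIdeal M 𝒢 Finset.univ ∅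
    convert h2

/-- Induction on the marginal rank of `K` over `Y`, the join of the members of `A` not containing
`K`. Choose `x ∈ K` outside `cl Y`. The linear relation at `x` trades one factor `hsum 𝒢 K` for
variables `x_L` with `x ∈ L` and `K ⊄ L`, and adjoining `L` to `A` lowers the marginal rank.
Marginal rank zero cannot occur for a nested set. -/
lemma xprod_mul_hsum_pow_mem_chowIdeal (e : ℕ) : ∀ (A : Finset 𝒢) (K : 𝒢),
    IsNested M 𝒢 (vals A) →
    rk M (K.1 ∪ ⋃₀ {t ∈ vals A | ¬ K.1 ⊆ t}) ≤ e + rk M (⋃₀ {t ∈ vals A | ¬ K.1 ⊆ t}) →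
    xprod A * hsum 𝒢 K.1 ^ e ∈ chowIdeal M 𝒢 := by
  classical
  induction e with
  | zero =>
    intro A K hA hr
    have := hA.rk_lt_rk_union h𝒢 K.2
    omega
  | succ e ih =>
    intro A K hA hr
    set Y := ⋃₀ {t ∈ vals A | ¬ K.1 ⊆ t} with hY
    have hlt := hA.rk_lt_rk_union h𝒢 K.2
    rw [← hY] at hlt
    obtain ⟨x, hxK, hxY⟩ : ∃ x ∈ K.1, x ∉ M.closure Y := by
      by_contra! hc
      have := rk_union_of_subset_closure (M := M) (X := Y) (Y := K.1) hc
      rw [Set.union_comm] at this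
      omega
    have hxE := h𝒢.subset_ground K.2 hxK
    have hcl : M.closure {x} ⊆ K.1 :=
      closure_subset_of_isFlat (h𝒢.isFlat K.2) (Set.singleton_subset_iff.2 hxK)
    have e1 : xprod A * hsum 𝒢 K.1 ^ (e + 1) =
        xprod A * hsum 𝒢 K.1 ^ e * hsum 𝒢 (M.closure {x}) -
        ∑ L : {L // L ∈ 𝒢} with M.closure {x} ⊆ L.1 ∧ ¬ K.1 ⊆ L.1,
          xprod A * MvPolynomial.X L * hsum 𝒢 K.1 ^ e := by
      rw [← Finset.sum_mul, ← Finset.mul_sum, hsum_sub_hsum hcl]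
      ring
    rw [e1]
    refine Ideal.sub_mem _ (Ideal.mul_mem_left _ _ (hsum_closure_mem_chowIdeal h𝒢 hxE))
      (Ideal.sum_mem _ fun L hL => ?_)
    rw [Finset.mem_filter] at hL
    have hxL : x ∈ L.1 := hL.2.1 (M.mem_closure_self x hxE)
    refine Ideal.mem_of_dvd _ (mul_dvd_mul_right (xprod_insert_dvd L) _) ?_
    by_cases hT : IsNested M 𝒢 (vals (insert L A))
    swap
    · exact Ideal.mul_mem_right _ _ (xprod_mem_chowIdeal hT)
    refine ih _ K hT ?_
    set Y' := ⋃₀ {t ∈ vals (insert L A) | ¬ K.1 ⊆ t} with hY'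
    have hsub : insert x Y ⊆ Y' := by
      refine Set.insert_subset ⟨L.1, ⟨?_, hL.2.2⟩, hxL⟩ (Set.sUnion_subset_sUnion ?_)
      · rw [mem_vals]
        exact Finset.mem_insert_self _ _
      · rintro t ⟨ht, htK⟩
        refine ⟨?_, htK⟩
        rw [vals_insert]
        exact Or.inr ht
    have h1 := rk_union_add_rk_le (M := M) (K := K.1) hsub
    rw [rk_insert_of_notMem hxE hxY, Set.union_insert, ← Set.insert_union,
      Set.insert_eq_of_mem hxK] at h1
    omega

lemma xprod_mul_hsum_relRk_mem_chowIdeal {K : 𝒢} (hA : IsNested M 𝒢 (vals A)) :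
    xprod A * hsum 𝒢 K.1 ^ relRk M (vals A) K.1 ∈ chowIdeal M 𝒢 := by
  refine xprod_mul_hsum_pow_mem_chowIdeal h𝒢 _ A K hA ?_
  have h1 := rk_union_add_rk_le (M := M) (K := K.1) (below_subset_sUnion (vals A) K.1)
  have h2 := rk_union_below_le (M := M) (vals A) K.1
  omega

omit [M.Finite] [M.Loopless] h𝒢 in
lemma xprod_dvd_monomial {m : 𝒢 →₀ ℕ} (h : A ⊆ m.support) :
    xprod A ∣ MvPolynomial.monomial m (1 : ℤ) := by
  rw [MvPolynomial.monomial_eq, map_one, one_mul, Finsupp.prod]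
  refine (Finset.prod_dvd_prod_of_subset _ _ _ h).trans
    (Finset.prod_dvd_prod_of_dvd _ _ fun K hK => ?_)
  exact dvd_pow_self _ (Finsupp.mem_support_iff.1 hK)

/-- The class of a monomial in the Chow ring. -/
def monomialClass (M : Matroid α) (𝒢 : Finset (Set α)) (m : 𝒢 →₀ ℕ) : ChowRing M 𝒢 :=
  Ideal.Quotient.mk (chowIdeal M 𝒢) (MvPolynomial.monomial m 1)

/-- The rank weight of a monomial. -/
def rkWeight (M : Matroid α) (𝒢 : Finset (Set α)) : (𝒢 →₀ ℕ) →+ ℕ :=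
  Finsupp.weight fun G : 𝒢 => rk M G.1

lemma rkWeight_le (m : 𝒢 →₀ ℕ) : rkWeight M 𝒢 m ≤ m.degree * rk M M.E := by
  rw [rkWeight, Finsupp.weight_apply, Finsupp.degree_apply, Finsupp.sum, Finset.sum_mul]
  refine Finset.sum_le_sum fun G _ => ?_
  rw [smul_eq_mul]
  exact Nat.mul_le_mul_left _ (rk_mono (h𝒢.subset_ground G.2))

lemma rk_lt_rk {K L : 𝒢} (h : K.1 ⊂ L.1) : rk M K.1 < rk M L.1 := by
  by_contra! hc
  exact h.2 (subset_of_rk_le (h𝒢.isFlat K.2) (h𝒢.subset_ground L.2) h.1 hc)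

/-- A monomial that is not standard is a combination of monomials of larger weight. -/
lemma monomialClass_mem_span_of_not_isStandard {m : 𝒢 →₀ ℕ}
    (hm : ¬ IsStandard M 𝒢 Finset.univ ∅ m) :
    monomialClass M 𝒢 m ∈ Submodule.span ℤ (monomialClass M 𝒢 ''
      {m' | m'.degree = m.degree ∧ rkWeight M 𝒢 m < rkWeight M 𝒢 m'}) := by
  classical
  have hmk : ∀ {p}, Ideal.Quotient.mk (chowIdeal M 𝒢) p = 0 ↔ p ∈ chowIdeal M 𝒢 :=
    Ideal.Quotient.eq_zero_iff_mem
  by_cases hn : IsNested M 𝒢 (vals m.support)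
  swap
  · have : monomialClass M 𝒢 m = 0 :=
      hmk.2 (Ideal.mem_of_dvd _ (xprod_dvd_monomial subset_rfl) (xprod_mem_chowIdeal hn))
    rw [this]
    exact zero_mem _
  obtain ⟨K, hK, hKm⟩ : ∃ K ∈ m.support, relRk M (vals m.support) K.1 ≤ m K := by
    by_contra! hc
    exact hm ⟨Finset.subset_univ _, by rwa [vals_union_empty], by rwa [vals_union_empty]⟩
  -- Only the support strictly below `K` enters the exponent `d`, and it is still present in the
  -- monomial `b` left after dividing by the `d`-th power of the variable of `K`.
  set A := m.support.filter fun L => L.1 ⊂ K.1 with hA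
  set d := relRk M (vals m.support) K.1 with hd
  have hAm : A ⊆ m.support := Finset.filter_subset _ _
  have hbelow : below (vals A) K.1 = below (vals m.support) K.1 := by
    refine Set.Subset.antisymm (below_mono (Set.image_mono hAm) _) (Set.sUnion_subset ?_)
    rintro _ ⟨⟨L, hL, rfl⟩, hLK⟩
    exact subset_below (mem_vals.2 (Finset.mem_filter.2 ⟨hL, hLK⟩)) hLK
  have hrel := xprod_mul_hsum_relRk_mem_chowIdeal h𝒢 (A := A) (K := K)
    (hn.mono (Set.image_mono hAm))
  rw [show relRk M (vals A) K.1 = d by rw [hd, relRk, relRk, hbelow]] at hrel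
  set b := m - Finsupp.single K d with hb
  have hbm : b + Finsupp.single K d = m := by
    refine tsub_add_cancel_of_le (Finsupp.single_le_iff.2 hKm)
  have hAb : A ⊆ b.support := by
    intro L hL
    have hLK : L ≠ K := by
      rintro rfl
      exact (Finset.mem_filter.1 hL).2.ne rfl
    rw [Finsupp.mem_support_iff, hb, Finsupp.tsub_apply, Finsupp.single_eq_of_ne hLK, tsub_zero]
    exact Finsupp.mem_support_iff.1 (hAm hL)
  have hI : MvPolynomial.monomial b (1 : ℤ) * hsum 𝒢 K.1 ^ d ∈ chowIdeal M 𝒢 :=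
    Ideal.mem_of_dvd _ (mul_dvd_mul_right (xprod_dvd_monomial hAb) _) hrel
  set F := Finset.univ.filter (fun L : {L // L ∈ 𝒢} => K.1 ⊆ L.1) with hF
  have hKF : K ∈ F := by simp [hF]
  set E : (Fin d → 𝒢) → (𝒢 →₀ ℕ) := fun p => b + ∑ i, Finsupp.single (p i) 1 with hE
  have hexp : MvPolynomial.monomial b (1 : ℤ) * hsum 𝒢 K.1 ^ d =
      ∑ p ∈ Fintype.piFinset (fun _ : Fin d => F), MvPolynomial.monomial (E p) 1 := by
    rw [hsum, Finset.sum_pow', Finset.mul_sum]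
    refine Finset.sum_congr (by congr) fun p _ => ?_
    rw [hE]
    simp only
    rw [← mul_one (1 : ℤ), ← MvPolynomial.monomial_mul, mul_one, MvPolynomial.monomial_sum_one]
    rfl
  -- Choosing `K` from all `d` factors gives back `m`. Any other choice replaces some `K` by a
  -- strictly larger flat and so raises the rank weight.
  have hconst : (fun _ => K) ∈ Fintype.piFinset (fun _ : Fin d => F) :=
    Fintype.mem_piFinset.2 fun _ => hKF
  have hEK : E (fun _ => K) = m := by
    simp only [hE, Finset.sum_const, Finset.card_univ, Fintype.card_fin]
    rw [Finsupp.smul_single, smul_eq_mul, mul_one, hbm]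
  have hzero : ∑ p ∈ Fintype.piFinset (fun _ : Fin d => F), monomialClass M 𝒢 (E p) = 0 := by
    have := hmk.2 hI
    rw [hexp, map_sum] at this
    exact this
  rw [← Finset.add_sum_erase _ _ hconst, hEK, add_eq_zero_iff_eq_neg] at hzero
  rw [hzero]
  refine neg_mem (sum_mem fun p hp => Submodule.subset_span ⟨E p, ⟨?_, ?_⟩, rfl⟩)
  · rw [← hbm]
    simp [hE]
  · rw [Finset.mem_erase, Fintype.mem_piFinset] at hp
    rw [← hEK]
    simp only [hE, map_add, map_sum]
    refine Nat.add_lt_add_left (Finset.sum_lt_sum (fun i _ => ?_) ?_) _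
    · simp only [rkWeight, Finsupp.weight_single, one_smul]
      exact rk_mono (Finset.mem_filter.1 (hp.2 i)).2
    · obtain ⟨i, hi⟩ := Function.ne_iff.1 hp.1
      refine ⟨i, Finset.mem_univ _, ?_⟩
      simp only [rkWeight, Finsupp.weight_single, one_smul]
      refine rk_lt_rk h𝒢 ((Finset.mem_filter.1 (hp.2 i)).2.ssubset_of_ne ?_)
      exact fun h => hi (Subtype.ext h.symm)

/-- Straightening terminates because it preserves the degree and increases the rank weight, which is
bounded by the degree times the rank of `M`. -/
lemma monomialClass_mem_span (n : ℕ) : ∀ m : 𝒢 →₀ ℕ,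
    m.degree * rk M M.E - rkWeight M 𝒢 m < n →
    monomialClass M 𝒢 m ∈ Submodule.span ℤ (monomialClass M 𝒢 ''
      {m' | IsStandard M 𝒢 Finset.univ ∅ m' ∧ m'.degree = m.degree}) := by
  induction n with
  | zero => intro m hm; omega
  | succ n ih =>
    intro m hm
    by_cases hs : IsStandard M 𝒢 Finset.univ ∅ m
    · exact Submodule.subset_span ⟨m, ⟨hs, rfl⟩, rfl⟩
    refine (Submodule.span_le.2 ?_) (monomialClass_mem_span_of_not_isStandard h𝒢 hs)
    rintro _ ⟨m', ⟨hdeg, hw⟩, rfl⟩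
    have := rkWeight_le h𝒢 m'
    rw [← hdeg]
    refine ih m' ?_
    rw [← hdeg] at hm
    omega

lemma chowPiece_eq_span (k : ℕ) : chowPiece M 𝒢 k = Submodule.span ℤ (Set.range
    fun m : {m : 𝒢 →₀ ℕ // IsStandard M 𝒢 Finset.univ ∅ m ∧ m.degree = k} =>
      monomialClass M 𝒢 m.1) := by
  refine le_antisymm ?_ (Submodule.span_le.2 ?_)
  · rintro _ ⟨p, hp, rfl⟩
    rw [p.as_sum, map_sum]
    refine sum_mem fun m hm => ?_
    have hdeg : m.degree = k := by
      have := (MvPolynomial.mem_homogeneousSubmodule k p).1 hp (MvPolynomial.mem_support_iff.1 hm)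
      rw [Finsupp.degree_eq_weight_one]
      exact this
    have h1 : (MvPolynomial.monomial m (p.coeff m) : MvPolynomial 𝒢 ℤ) =
        p.coeff m • MvPolynomial.monomial m 1 := by
      rw [MvPolynomial.smul_monomial, smul_eq_mul, mul_one]
    rw [h1, map_smul]
    refine Submodule.smul_mem _ _ ?_
    have := monomialClass_mem_span h𝒢 _ m (Nat.lt_succ_self _)
    rw [hdeg] at this
    change monomialClass M 𝒢 m ∈ _
    convert this using 2
    · ext x
      simp only [Set.mem_range, Subtype.exists, Set.mem_image, Set.mem_ofPred_eq, exists_prop]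
  · rintro _ ⟨m, rfl⟩
    refine ⟨MvPolynomial.monomial m.1 1, ?_, rfl⟩
    exact (MvPolynomial.mem_homogeneousSubmodule k _).2
      (MvPolynomial.isHomogeneous_monomial _ m.2.2)

lemma linearIndependent_monomialClass (k : ℕ) : LinearIndependent ℤ
    fun m : {m : 𝒢 →₀ ℕ // IsStandard M 𝒢 Finset.univ ∅ m ∧ m.degree = k} =>
      monomialClass M 𝒢 m.1 := by
  classical
  rw [linearIndependent_iff]
  intro l hl
  set f : MvPolynomial 𝒢 ℤ := ∑ m ∈ l.support, MvPolynomial.monomial m.1 (l m) with hf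
  have hcoeff : ∀ m, f.coeff m.1 = l m := by
    intro m
    rw [hf, MvPolynomial.coeff_sum]
    simp only [MvPolynomial.coeff_monomial, Subtype.val_inj]
    rw [Finset.sum_ite_eq']
    split_ifs with h
    · rfl
    · exact (Finsupp.notMem_support_iff.1 h).symm
  have hfI : f ∈ chowIdeal M 𝒢 := by
    rw [← Ideal.Quotient.eq_zero_iff_mem, ← hl, Finsupp.linearCombination_apply, Finsupp.sum, hf,
      map_sum]
    refine Finset.sum_congr rfl fun m _ => ?_
    rw [monomialClass, ← map_zsmul, MvPolynomial.smul_monomial, smul_eq_mul, mul_one]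
  have hf0 : f = 0 := by
    refine eq_zero_of_mem_fyIdeal h𝒢 Finset.univ ∅ ?_ (by simp) f (chowIdeal_le_fyIdeal h𝒢 hfI) ?_
    · exact ⟨Set.empty_subset _, fun A hA _ hA' => absurd (Set.subset_empty_iff.1 hA)
        hA'.nonempty.ne_empty⟩
    · intro m hm
      obtain ⟨m', _, h⟩ := Finset.mem_biUnion.1 (MvPolynomial.support_sum hm)
      have := MvPolynomial.support_monomial_subset h
      rw [Finset.mem_singleton] at this
      rw [this]
      exact m'.2.1
  ext m
  rw [← hcoeff m, hf0, MvPolynomial.coeff_zero, Finsupp.zero_apply]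

/-- The Feichtner–Yuzvinsky basis: the rank of a graded piece of the Chow ring is the number of
standard monomials. -/
theorem finrank_chowPiece (k : ℕ) : Module.finrank ℤ (chowPiece M 𝒢 k) =
    Nat.card {m : 𝒢 →₀ ℕ // IsStandard M 𝒢 Finset.univ ∅ m ∧ m.degree = k} := by
  have : Finite {m : 𝒢 →₀ ℕ // IsStandard M 𝒢 Finset.univ ∅ m ∧ m.degree = k} :=
    ((Finsupp.finite_of_degree_le (σ := 𝒢) k).subset fun m hm => hm.2.le).to_subtype
  have := Fintype.ofFinite {m : 𝒢 →₀ ℕ // IsStandard M 𝒢 Finset.univ ∅ m ∧ m.degree = k}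
  rw [chowPiece_eq_span h𝒢, finrank_span_eq_card (linearIndependent_monomialClass h𝒢 k),
    Nat.card_eq_fintype_card]

end Chow

/-! ### Ascents of nested sets -/

/-- `P` is the smallest element of `C` strictly containing `X`. -/
def IsParent (C : Set (Set α)) (X P : Set α) : Prop :=
  P ∈ C ∧ X ⊂ P ∧ ∀ Q ∈ C, X ⊂ Q → P ⊆ Q

/-- `X` is an ascent of `C`: it is spanned, over the elements of `C` below it, by the elements that
precede everything in its parent `P` outside of the elements of `C` below `P`. -/
def IsAscent [LinearOrder α] (M : Matroid α) (C : Set (Set α)) (X : Set α) : Prop :=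
  X ∈ C ∧ ∃ P, IsParent C X P ∧
    X ⊆ M.closure (below C X ∪ {x ∈ X | ∀ p ∈ P \ below C P, x < p})

lemma IsParent.eq {C : Set (Set α)} {X P Q : Set α} (hP : IsParent C X P) (hQ : IsParent C X Q) :
    P = Q := (hP.2.2 Q hQ.1 hQ.2.1).antisymm (hQ.2.2 P hP.1 hP.2.1)

/-- Only the parent notices the removal of `X`: any other member above `X` lies strictly above `P`,
and `P` absorbs `X`. -/
lemma IsParent.below_diff {C : Set (Set α)} {X P Z : Set α} (hP : IsParent C X P) (hZ : Z ∈ C)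
    (hne : Z ≠ P) : below (C \ {X}) Z = below C Z := by
  refine (below_mono Set.sdiff_subset Z).antisymm (Set.sUnion_subset fun t ht => ?_)
  by_cases htX : t = X
  · subst htX
    have hPZ : P ⊂ Z := (hP.2.2 Z hZ ht.2).ssubset_of_ne (Ne.symm hne)
    exact hP.2.1.subset.trans (subset_below ⟨hP.1, hP.2.1.ne'⟩ hPZ)
  · exact subset_below ⟨ht.1, htX⟩ ht.2

lemma below_eq_union {C : Set (Set α)} {X P : Set α} (hX : X ∈ C) (hXP : X ⊂ P) :
    below C P = below (C \ {X}) P ∪ X := by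
  refine Set.Subset.antisymm (Set.sUnion_subset fun t ht => ?_)
    (Set.union_subset (below_mono Set.sdiff_subset P) (subset_below hX hXP))
  by_cases htX : t = X
  · subst htX
    exact Set.subset_union_right
  · exact (subset_below (show t ∈ C \ {X} from ⟨ht.1, htX⟩) ht.2).trans Set.subset_union_left

section Parent

variable {M : Matroid α} {𝒢 : Finset (Set α)} {C : Set (Set α)} {X Z P : Set α}
  [M.Finite] [M.Loopless] (h𝒢 : IsBuildingSet M 𝒢)

include h𝒢

lemma IsNested.subset_or_subset_of_subset (hC : IsNested M 𝒢 C) {a b : Set α} (hX : X ∈ 𝒢)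
    (ha : a ∈ C) (hb : b ∈ C) (hXa : X ⊆ a) (hXb : X ⊆ b) : a ⊆ b ∨ b ⊆ a := by
  obtain ⟨e, he⟩ := h𝒢.nonempty hX
  exact hC.subset_or_subset h𝒢 ha hb (hXa he) (hXb he)

lemma IsParent.subset_of_mem (hC : IsNested M 𝒢 C) (hP : IsParent C X P) (hX : X ∈ C)
    {t : Set α} (ht : t ∈ C) (htP : t ⊂ P) {e : α} (het : e ∈ t) (heX : e ∈ X) : t ⊆ X := by
  rcases hC.subset_or_subset h𝒢 ht hX het heX with h | h
  · exact h
  · by_contra hne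
    exact htP.2 (hP.2.2 t ht ⟨h, hne⟩)

lemma IsParent.maximal (hP : IsParent C X P) : ∀ t ∈ {t ∈ C | t ⊂ P}, X ⊆ t → t = X := by
  intro t ht hXt
  by_contra hne
  exact ht.2.2 (hP.2.2 t ht.1 (hXt.ssubset_of_ne (Ne.symm hne)))

/-- Removing an element adds its relative rank to the one of its parent. -/
lemma IsParent.relRk_diff (hC : IsNested M 𝒢 C) (hX : X ∈ C) (hP : IsParent C X P) :
    relRk M (C \ {X}) P = relRk M C P + relRk M C X := by
  have h1 := (hC.mono (Set.sep_subset C fun t => t ⊂ P)).rk_sUnion_add h𝒢 (s := X)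
    ⟨hX, hP.2.1⟩ (hP.maximal h𝒢)
  have e1 : below {t ∈ C | t ⊂ P} X = below C X :=
    (below_mono (Set.sep_subset _ _) X).antisymm (Set.sUnion_subset fun t ht =>
      subset_below ⟨ht.1, ht.2.trans hP.2.1⟩ ht.2)
  have e2 : ⋃₀ ({t ∈ C | t ⊂ P} \ {X}) = below (C \ {X}) P := by
    rw [below]
    congr 1
    ext t
    exact ⟨fun h => ⟨⟨h.1.1, h.2⟩, h.1.2⟩, fun h => ⟨⟨h.1.1, h.2⟩, h.1.2⟩⟩
  change rk M (below C P) + _ = _ at h1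
  rw [e1, e2] at h1
  have h2 := rk_mono (M := M) (below_subset C P)
  have h3 := rk_mono (M := M) (below_subset C X)
  have h4 := rk_mono (M := M) (below_subset (C \ {X}) P)
  unfold relRk
  omega

/-- The members below `P` not contained in `X` are skew to `X`, since `X` is a factor of the join of
everything in `C` strictly below `P`. -/
lemma IsParent.mem_closure (hC : IsNested M 𝒢 C) (hX : X ∈ C) (hP : IsParent C X P)
    {Y R : Set α} (hY : Y ⊆ X) (hR : R ⊆ ⋃₀ {t ∈ C | t ⊂ P ∧ ¬ t ⊆ X}) {e : α} (he : e ∈ X)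
    (h : e ∈ M.closure (Y ∪ R)) : e ∈ M.closure Y := by
  have h1 := (hC.mono (Set.sep_subset C fun t => t ⊂ P)).skew h𝒢 (s := X)
    ⟨hX, hP.2.1⟩ (hP.maximal h𝒢)
  refine mem_closure_left_of_skew h1 hY (hR.trans ?_) h he
  exact Set.sUnion_subset_sUnion fun t ht => ⟨⟨ht.1, ht.2.1⟩, ht.2.2⟩

variable [LinearOrder α]

/-- If all the initial elements were in the join of the members below `X`, that join would span `X`.
The element found here serves for comparing orders across several levels of the forest. -/
lemma exists_lt_of_isAscent (hC : IsNested M 𝒢 C) (hX : IsAscent M C X) (hP : IsParent C X P) :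
    ∃ x ∈ X, x ∉ below C X ∧ ∀ p ∈ P \ below C P, x < p := by
  obtain ⟨hXC, P', hP', hcl⟩ := hX
  obtain rfl := hP.eq hP'
  by_contra! hc
  have h1 : below C X ∪ {x ∈ X | ∀ p ∈ P \ below C P, x < p} ⊆ below C X := by
    refine Set.union_subset subset_rfl fun x hx => ?_
    by_contra hxb
    obtain ⟨p, hp, hpx⟩ := hc x hx.1 hxb
    exact absurd (hx.2 p hp) (not_lt.2 hpx)
  have h2 := hcl.trans (closure_subset_of_isFlat (hC.isFlat_below h𝒢 X) h1)
  exact absurd (rk_mono (M := M) h2) (not_le.2 (hC.rk_below_lt h𝒢 (hC.1 hXC)))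

/-- Removing an element creates no new ascents. -/
lemma IsAscent.of_diff (hC : IsNested M 𝒢 C) (hX : X ∈ C) (hZ : IsAscent M (C \ {X}) Z) :
    IsAscent M C Z := by
  obtain ⟨hZC, Q, hQ, hcl⟩ := hZ
  -- In passing to `C` the spanning set can only grow, so it suffices that no new elements have to
  -- be preceded.
  have hmono : ∀ P, IsParent C Z P → (∀ p ∈ P \ below C P, p ∈ Q \ below (C \ {X}) Q) →
      IsAscent M C Z := by
    refine fun P hP h => ⟨hZC.1, P, hP, hcl.trans (M.closure_subset_closure ?_)⟩
    refine Set.union_subset_union (below_mono Set.sdiff_subset Z) fun z hz => ⟨hz.1, fun p hp => ?_⟩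
    exact hz.2 p (h p hp)
  by_cases hZX : Z ⊂ X
  swap
  · refine hmono Q ⟨hQ.1.1, hQ.2.1, fun Q' hQ' hZQ' => hQ.2.2 Q' ⟨hQ', ?_⟩ hZQ'⟩
      fun p hp => ⟨hp.1, fun h => hp.2 (below_mono Set.sdiff_subset Q h)⟩
    rintro rfl
    exact hZX hZQ'
  -- If `X` lies between `Z` and `Q`, it is the parent of `Z` in `C`. An element of `X` outside its
  -- own join is also outside the join of the members other than `X` strictly below `Q`, so the
  -- condition in `C` is the weaker one.
  by_cases hXQ : X ⊂ Q
  · refine hmono X ⟨hX, hZX, fun Q' hQ' hZQ' => ?_⟩ fun x hx => ⟨hXQ.subset hx.1, ?_⟩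
    · by_cases h : Q' = X
      · exact h.symm.subset
      · exact hXQ.subset.trans (hQ.2.2 Q' ⟨hQ', h⟩ hZQ')
    · rintro ⟨t, ht, hxt⟩
      rcases hC.subset_or_subset h𝒢 ht.1.1 hX hxt hx.1 with h | h
      · exact hx.2 (subset_below ht.1.1 (h.ssubset_of_ne ht.1.2) hxt)
      · exact ht.2.2 (hQ.2.2 t ht.1 (hZX.trans_subset h))
  · refine hmono Q ⟨hQ.1.1, hQ.2.1, fun Q' hQ' hZQ' => ?_⟩
      fun p hp => ⟨hp.1, fun h => hp.2 (below_mono Set.sdiff_subset Q h)⟩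
    by_cases h : Q' = X
    · subst h
      rcases hC.subset_or_subset_of_subset h𝒢 (hC.1 hZC.1) hX hQ.1.1 hZX.subset hQ.2.1.subset
        with h | h
      · by_contra hne
        exact hXQ ⟨h, hne⟩
      · exact h
    · exact hQ.2.2 Q' ⟨hQ', h⟩ hZQ'

/-- In a complete built matroid, siblings are not both ascents. -/
lemma not_isAscent_of_sibling (hc : IsCompleteFor M 𝒢) (hC : IsNested M 𝒢 C) (hne : X ≠ Z)
    (hPX : IsParent C X P) (hPZ : IsParent C Z P) (hX : IsAscent M C X) (hZ : IsAscent M C Z) :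
    False := by
  -- The chain from `F` to `P` must reach both `x` and `z` before it leaves the join of the children
  -- of `P`. Completeness makes the flat `W` reached at `max x z` a join `F ∨ H` with `H ∈ 𝒢`, and
  -- `H` lies in a single member `t` strictly below `P`. Since `W` contains `x` and `z`, this `t`
  -- would be inside both `X` and `Z`.
  set F := below (C \ {X, Z}) P with hF
  have hflat : M.IsFlat F := (hC.mono Set.sdiff_subset).isFlat_below h𝒢 P
  obtain ⟨x, hxX, hxb, hxlt⟩ := exists_lt_of_isAscent h𝒢 hC hX hPX
  obtain ⟨z, hzZ, hzb, hzlt⟩ := exists_lt_of_isAscent h𝒢 hC hZ hPZ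
  have hnotF : ∀ {Y y}, IsParent C Y P → IsAscent M C Y → (Y = X ∨ Y = Z) → y ∈ Y →
      y ∉ below C Y → y ∉ F := by
    rintro Y y hPY hY hYXZ hyY hyb ⟨t, ht, hyt⟩
    have h1 := hPY.subset_of_mem h𝒢 hC hY.1 ht.1.1 ht.2 hyt hyY
    refine hyb (subset_below ht.1.1 (h1.ssubset_of_ne ?_) hyt)
    rintro rfl
    exact ht.1.2 hYXZ
  have hxF := hnotF hPX hX (Or.inl rfl) hxX hxb
  have hzF := hnotF hPZ hZ (Or.inr rfl) hzZ hzb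
  have hxP := hPX.2.1.subset hxX
  have hzP := hPZ.2.1.subset hzZ
  have hP𝒢 := hC.1 hPX.1
  have hPE := h𝒢.subset_ground hP𝒢
  set W := M.closure (F ∪ {y ∈ P \ F | y ≤ max x z}) with hW
  have hWE : F ∪ {y ∈ P \ F | y ≤ max x z} ⊆ M.E :=
    Set.union_subset hflat.subset_ground fun y hy => hPE hy.1.1
  have hmaxlt : ∀ p ∈ P \ below C P, max x z < p := fun p hp => max_lt (hxlt p hp) (hzlt p hp)
  have hmaxPF : max x z ∈ P \ F := by
    rcases max_choice x z with h | h <;> rw [h]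
    · exact ⟨hxP, hxF⟩
    · exact ⟨hzP, hzF⟩
  have hxW : x ∈ W := M.subset_closure _ hWE (Or.inr ⟨⟨hxP, hxF⟩, le_max_left _ _⟩)
  have hzW : z ∈ W := M.subset_closure _ hWE (Or.inr ⟨⟨hzP, hzF⟩, le_max_right _ _⟩)
  have hWb : W ⊆ below C P := by
    refine closure_subset_of_isFlat (hC.isFlat_below h𝒢 P)
      (Set.union_subset (below_mono Set.sdiff_subset P) fun y hy => ?_)
    by_contra hyb
    exact absurd (hmaxlt y ⟨hy.1.1, hyb⟩) (not_lt.2 hy.2)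
  have hmem := hc F hflat P hP𝒢 (below_subset _ _) (Or.inr ⟨max x z, hmaxPF, hW⟩)
  rcases hmem with h | ⟨⟨H, hH, hWH⟩, -, -⟩
  · exact hxF (h ▸ hxW)
  have hHW : H ⊆ W := by
    rw [hWH]
    exact Set.subset_union_right.trans
      (M.subset_closure _ (Set.union_subset hflat.subset_ground (h𝒢.subset_ground hH)))
  obtain ⟨t, ht, hHt⟩ := (hC.mono (Set.sep_subset C fun t => t ⊂ P)).exists_superset h𝒢 hH
    ((hHW.trans hWb).trans (M.subset_closure _
      ((hC.isFlat_below h𝒢 P).subset_ground)))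
  have key : ∀ {Y y}, IsParent C Y P → IsAscent M C Y → (Y = X ∨ Y = Z) → y ∈ Y →
      y ∉ below C Y → y ∈ W → t ⊆ Y := by
    intro Y y hPY hY hYXZ hyY hyb hyW
    by_contra htY
    rw [hWH] at hyW
    have h1 : F ∪ H ⊆ below C Y ∪ ⋃₀ {t ∈ C | t ⊂ P ∧ ¬ t ⊆ Y} := by
      refine Set.union_subset (Set.sUnion_subset fun s hs => ?_) ?_
      · by_cases hsY : s ⊆ Y
        · refine (subset_below hs.1.1 (hsY.ssubset_of_ne ?_)).trans Set.subset_union_left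
          rintro rfl
          exact hs.1.2 hYXZ
        · exact (Set.subset_sUnion_of_mem (show s ∈ {t ∈ C | t ⊂ P ∧ ¬ t ⊆ Y} from
            ⟨hs.1.1, hs.2, hsY⟩)).trans Set.subset_union_right
      · exact (hHt.trans (Set.subset_sUnion_of_mem (show t ∈ {t ∈ C | t ⊂ P ∧ ¬ t ⊆ Y} from
            ⟨ht.1, ht.2, htY⟩))).trans Set.subset_union_right
    have h2 := hPY.mem_closure h𝒢 hC hY.1 (below_subset C Y) subset_rfl hyY
      (M.closure_subset_closure h1 hyW)
    rw [(hC.isFlat_below h𝒢 Y).closure] at h2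
    exact hyb h2
  have htX := key hPX hX (Or.inl rfl) hxX hxb hxW
  have htZ := key hPZ hZ (Or.inr rfl) hzZ hzb hzW
  obtain ⟨e, he⟩ := h𝒢.nonempty hH
  have h1 := hPX.subset_of_mem h𝒢 hC hX.1 hZ.1 hPZ.2.1 (htZ (hHt he)) (htX (hHt he))
  have h2 := hPZ.subset_of_mem h𝒢 hC hZ.1 hX.1 hPX.2.1 (htX (hHt he)) (htZ (hHt he))
  exact hne (h2.antisymm h1)

/-- Removing an ascent keeps the other ascents. -/
lemma IsAscent.diff (hc : IsCompleteFor M 𝒢) (hC : IsNested M 𝒢 C) (hX : IsAscent M C X)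
    (hZ : IsAscent M C Z) (hne : Z ≠ X) : IsAscent M (C \ {X}) Z := by
  obtain ⟨hXC, P, hP, hclX⟩ := id hX
  obtain ⟨hZC, Q, hQ, hclZ⟩ := id hZ
  refine ⟨⟨hZC, hne⟩, ?_⟩
  obtain ⟨x, hxX, hxb, hxlt⟩ := exists_lt_of_isAscent h𝒢 hC hX hP
  -- After removal of the parent `X` of `Z`, its parent `P` takes over. Newly exposed elements of
  -- `P` lie in `X` and were already preceded; the others come after `x`, which comes after the
  -- initial elements of `Z`.
  by_cases hQX : Q = X
  · subst hQX
    have hZP : Z ⊂ P := hQ.2.1.trans hP.2.1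
    refine ⟨P, ⟨⟨hP.1, hP.2.1.ne'⟩, hZP, fun Q' hQ' hZQ' => ?_⟩, ?_⟩
    · exact hP.2.2 Q' hQ'.1 ((hQ.2.2 Q' hQ'.1 hZQ').ssubset_of_ne (Ne.symm hQ'.2))
    rw [hP.below_diff hZC hZP.ne]
    refine hclZ.trans (M.closure_subset_closure (Set.union_subset_union_right _ fun z hz => ?_))
    refine ⟨hz.1, fun q hq => ?_⟩
    by_cases hqb : q ∈ below C P
    · rw [below_eq_union hXC hP.2.1] at hqb
      have hqQ := hqb.resolve_left hq.2
      refine hz.2 q ⟨hqQ, ?_⟩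
      rintro ⟨s, hs, hqs⟩
      exact hq.2 (subset_below (show s ∈ C \ {Q} from ⟨hs.1, hs.2.ne⟩) (hs.2.trans hP.2.1) hqs)
    · exact (hz.2 x ⟨hxX, hxb⟩).trans (hxlt q ⟨hq.1, hqb⟩)
  by_cases hQP : Q = P
  · subst hQP
    exact (not_isAscent_of_sibling h𝒢 hc hC hne hQ hP hZ hX).elim
  refine ⟨Q, ⟨⟨hQ.1, hQX⟩, hQ.2.1, fun Q' hQ' => hQ.2.2 Q' hQ'.1⟩, ?_⟩
  rw [hP.below_diff hQ.1 hQP]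
  by_cases hZP : Z = P
  swap
  · rwa [hP.below_diff hZC hZP]
  -- Here `X` is a child of `Z`, so its elements drop out of the join below `Z`. They are recovered
  -- because the initial elements spanning `X` over its own children precede `z`, hence are initial
  -- in `Z` too.
  subst hZP
  obtain ⟨z, hzZ, hzb, hzlt⟩ := exists_lt_of_isAscent h𝒢 hC hZ hQ
  have hZE := h𝒢.subset_ground (hC.1 hZC)
  set L := {z ∈ Z | ∀ q ∈ Q \ below C Q, z < q} with hL
  have hE : below (C \ {X}) Z ∪ L ⊆ M.E :=
    Set.union_subset ((below_subset _ _).trans hZE) fun y hy => hZE hy.1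
  have hsub := M.subset_closure _ hE
  refine hclZ.trans (M.closure_subset_closure_of_subset_closure ?_)
  rw [below_eq_union hXC hP.2.1]
  refine Set.union_subset (Set.union_subset (Set.subset_union_left.trans hsub) ?_)
    (Set.subset_union_right.trans hsub)
  refine hclX.trans (M.closure_subset_closure (Set.union_subset_union ?_ ?_))
  · exact Set.sUnion_subset fun s hs => subset_below ⟨hs.1, hs.2.ne⟩ (hs.2.trans hP.2.1)
  · exact fun y hy => ⟨hP.2.1.subset hy.1, fun q hq => (hy.2 z ⟨hzZ, hzb⟩).trans (hzlt q hq)⟩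

end Parent

/-! ### Inserting ascents -/

section Insertion

variable {M : Matroid α} {𝒢 : Finset (Set α)} {C : Set (Set α)} {X Z P : Set α}
  [M.Finite] [M.Loopless] (h𝒢 : IsBuildingSet M 𝒢) [LinearOrder α]

/-- Some initial segment of `P`, relative to a flat `F ⊆ P`, has a prescribed intermediate rank. -/
lemma exists_rk_initial_eq {F : Set α} (hF : F ⊆ P) (hPE : P ⊆ M.E) {i : ℕ} (hi : 1 ≤ i)
    (hiP : rk M F + i ≤ rk M P) :
    ∃ e ∈ P \ F, rk M (F ∪ {y ∈ P \ F | y ≤ e}) = rk M F + i := by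
  have hfin : (P \ F).Finite := M.ground_finite.subset (Set.sdiff_subset.trans hPE)
  have hfin' : {e ∈ P \ F | rk M F + i ≤ rk M (F ∪ {y ∈ P \ F | y ≤ e})}.Finite :=
    hfin.subset (Set.sep_subset _ _)
  have hne : (P \ F).Nonempty := by
    by_contra h
    rw [Set.not_nonempty_iff_eq_empty, Set.sdiff_eq_empty] at h
    have := rk_mono (M := M) h
    omega
  -- Take the first `e` at which the rank reaches the target. The segment strictly before `e` falls
  -- short and `e` adds at most one, so the target is hit exactly.
  obtain ⟨e, he⟩ := hfin'.exists_minimal (by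
    obtain ⟨m, hm⟩ := hfin.exists_maximal hne
    refine ⟨m, hm.prop, ?_⟩
    have : F ∪ {y ∈ P \ F | y ≤ m} = P := by
      refine (Set.union_subset hF fun y hy => hy.1.1).antisymm fun y hy => ?_
      by_cases hyF : y ∈ F
      · exact Or.inl hyF
      · exact Or.inr ⟨⟨hy, hyF⟩, not_lt.1 fun h => h.not_ge (hm.le_of_ge ⟨hy, hyF⟩ h.le)⟩
    rw [this]
    exact hiP)
  refine ⟨e, he.prop.1, le_antisymm ?_ he.prop.2⟩
  have h1 : F ∪ {y ∈ P \ F | y ≤ e} = insert e (F ∪ {y ∈ P \ F | y < e}) := by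
    ext y
    constructor
    · rintro (hy | hy)
      · exact Or.inr (Or.inl hy)
      · rcases hy.2.eq_or_lt with h | h
        · exact Or.inl h
        · exact Or.inr (Or.inr ⟨hy.1, h⟩)
    · rintro (rfl | hy | hy)
      · exact Or.inr ⟨he.prop.1, le_rfl⟩
      · exact Or.inl hy
      · exact Or.inr ⟨hy.1, hy.2.le⟩
  have h2 : rk M (F ∪ {y ∈ P \ F | y < e}) < rk M F + i := by
    rcases Set.eq_empty_or_nonempty {y ∈ P \ F | y < e} with h | h
    · rw [h, Set.union_empty]
      omega
    · obtain ⟨m, hm⟩ := (hfin.subset (Set.sep_subset _ fun y => y < e)).exists_maximal h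
      by_contra! hc
      have h3 : {y ∈ P \ F | y < e} ⊆ {y ∈ P \ F | y ≤ m} := fun y hy =>
        ⟨hy.1, not_lt.1 fun h => h.not_ge (hm.le_of_ge hy h.le)⟩
      have h4 : rk M F + i ≤ rk M (F ∪ {y ∈ P \ F | y ≤ m}) :=
        hc.trans (rk_mono (Set.union_subset_union_right _ h3))
      exact absurd (he.le_of_le ⟨hm.prop.1, h4⟩ hm.prop.2.le) (not_le.2 hm.prop.2)
  rw [h1]
  have := rk_insert_le (M := M) e (F ∪ {y ∈ P \ F | y < e})
  omega

include h𝒢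

/-- In a complete built matroid, an ascent of every possible relative rank can be inserted below
every element of a nested set. -/
lemma exists_isAscent_insert (hc : IsCompleteFor M 𝒢) (hC : IsNested M 𝒢 C) (hP : P ∈ C) {i : ℕ}
    (hi : 1 ≤ i) (hiP : i < relRk M C P) :
    ∃ X, X ∉ C ∧ IsNested M 𝒢 (insert X C) ∧ IsParent (insert X C) X P ∧
      IsAscent M (insert X C) X ∧ relRk M (insert X C) X = i := by
  have hP𝒢 := hC.1 hP
  have hPE := h𝒢.subset_ground hP𝒢
  set F := below C P with hFdef
  have hF : M.IsFlat F := hC.isFlat_below h𝒢 P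
  have hFP : F ⊆ P := below_subset C P
  have hrk := rk_le_relRk_add (M := M) C P
  have hrk' : relRk M C P = rk M P - rk M F := rfl
  obtain ⟨e, hePF, he⟩ := exists_rk_initial_eq hFP hPE hi (by omega)
  set L := {y ∈ P \ F | y ≤ e} with hL
  set W := M.closure (F ∪ L) with hW
  have hWrk : rk M W = rk M F + i := by rw [hW, rk_closure, he]
  have hWE : F ∪ L ⊆ M.E := Set.union_subset hF.subset_ground fun y hy => hPE hy.1.1
  have hsub : F ∪ L ⊆ W := M.subset_closure _ hWE
  have hWP : W ⊆ P := closure_subset_of_isFlat (h𝒢.isFlat hP𝒢)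
    (Set.union_subset hFP fun y hy => hy.1.1)
  -- Completeness writes the flat of rank `rk F + i` in the chain as `F ∨ H`. The ascent to insert
  -- is the factor `X` of this flat that contains `H`.
  have hmem := hc F hF P hP𝒢 hFP (Or.inr ⟨e, hePF, hW⟩)
  rcases hmem with h | ⟨⟨H, hH, hWH⟩, -, -⟩
  · rw [h] at hWrk
    omega
  have hFHE : F ∪ H ⊆ M.E := Set.union_subset hF.subset_ground (h𝒢.subset_ground hH)
  have hHW : H ⊆ W := by
    rw [hWH]
    exact Set.subset_union_right.trans (M.subset_closure _ hFHE)
  have hWflat : M.IsFlat W := M.isFlat_closure _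
  obtain ⟨X, hX, hHX⟩ := exists_factor_superset hH hHW
  have hXW := subset_of_mem_factors hX
  have hX𝒢 := mem_of_mem_factors hX
  have hFX : M.closure (F ∪ X) = W := by
    refine (closure_subset_of_isFlat hWflat
      (Set.union_subset (Set.subset_union_left.trans hsub) hXW)).antisymm ?_
    rw [hWH]
    exact M.closure_subset_closure (Set.union_subset_union_right _ hHX)
  have hXF : ¬ X ⊆ F := by
    intro h
    rw [Set.union_eq_left.2 h, hF.closure] at hFX
    rw [← hFX] at hWrk
    omega
  -- The flat `W` is spanned by `F` and `H ⊆ X`. Another factor is skew to `X`, so it is spanned by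
  -- its intersection with `F`.
  have hother : ∀ K ∈ factors 𝒢 W, K ≠ X → K ⊆ F := by
    intro K hK hne x hx
    have h1 : F ∪ H ⊆ (F ∩ K) ∪ ⋃₀ (factors 𝒢 W \ {K}) := by
      refine Set.union_subset (Set.sUnion_subset fun t ht => ?_) ?_
      · have htF : t ⊆ F := subset_below ht.1 ht.2
        obtain ⟨K', hK', htK'⟩ := exists_factor_superset (hC.1 ht.1)
          ((htF.trans Set.subset_union_left).trans hsub)
        by_cases h : K' = K
        · subst h
          exact (Set.subset_inter htF htK').trans Set.subset_union_left
        · exact (htK'.trans (Set.subset_sUnion_of_mem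
            (show K' ∈ factors 𝒢 W \ {K} from ⟨hK', h⟩))).trans Set.subset_union_right
      · exact (hHX.trans (Set.subset_sUnion_of_mem
          (show X ∈ factors 𝒢 W \ {K} from ⟨hX, Ne.symm hne⟩))).trans Set.subset_union_right
    have h2 := mem_closure_left_of_skew (h𝒢.rk_factor hWflat hK) Set.inter_subset_right
      subset_rfl (M.closure_subset_closure h1 (hWH ▸ subset_of_mem_factors hK hx)) hx
    exact closure_subset_of_isFlat hF Set.inter_subset_left h2
  have hXP : X ⊂ P := by
    refine (hXW.trans hWP).ssubset_of_ne ?_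
    rintro rfl
    have := rk_mono (M := M) hXW
    omega
  have hXC : X ∉ C := fun h => hXF (subset_below h hXP)
  have htri : ∀ t ∈ C, t ⊂ P ∨ P ⊆ t ∨ ∀ a ∈ t, a ∉ P := by
    intro t ht
    by_cases h : P ⊆ t
    · exact Or.inr (Or.inl h)
    by_cases h' : ∀ a ∈ t, a ∉ P
    · exact Or.inr (Or.inr h')
    push Not at h'
    obtain ⟨a, hat, haP⟩ := h'
    exact Or.inl ⟨(hC.subset_or_subset h𝒢 ht hP hat haP).resolve_right h, h⟩
  have hnest : IsNested M 𝒢 (insert X C) := by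
    refine hC.insert h𝒢 hWflat hX fun t ht => ?_
    rcases htri t ht with h | h | h
    · exact Or.inl ((subset_below ht h).trans (Set.subset_union_left.trans hsub))
    · exact Or.inr (Or.inl (hXP.subset.trans h))
    · exact Or.inr (Or.inr ⟨P, hP, hXP.subset, h⟩)
  have hpar : IsParent (insert X C) X P := by
    refine ⟨Or.inr hP, hXP, ?_⟩
    rintro Q (rfl | hQ) hXQ
    · exact absurd rfl hXQ.ne
    rcases htri Q hQ with h | h | h
    · exact absurd (hXQ.subset.trans (subset_below hQ h)) hXF
    · exact h
    · obtain ⟨a, ha⟩ := h𝒢.nonempty hX𝒢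
      exact absurd (hXP.subset ha) (h a (hXQ.subset ha))
  have hdiff : insert X C \ {X} = C := by
    rw [Set.insert_sdiff_of_mem _ (Set.mem_singleton X), Set.sdiff_singleton_eq_self hXC]
  have hbelow : below (insert X C) P = W := by
    have h1 : below (insert X C) P = F ∪ X := by
      rw [below_eq_union (Set.mem_insert X C) hXP, hdiff]
    rw [← (hnest.isFlat_below h𝒢 P).closure, h1, hFX]
  refine ⟨X, hXC, hnest, hpar, ⟨Or.inl rfl, P, hpar, fun x hx => ?_⟩, ?_⟩
  · rw [hbelow]
    -- An element of `L` is outside `F`, so its factor can only be `X`; and every element of `P` up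
    -- to `e` is in `W`, so `L` precedes `P \ W`.
    have hLX : L ⊆ {x ∈ X | ∀ p ∈ P \ W, x < p} := by
      intro y hy
      obtain ⟨K, hK, hyK⟩ := h𝒢.exists_factor_mem hWflat (hsub (Or.inr hy))
      have hKX : K = X := by
        by_contra hne
        exact hy.1.2 (hother K hK hne hyK)
      refine ⟨hKX ▸ hyK, fun p hp => hy.2.trans_lt (not_le.1 fun hpe => hp.2 (hsub ?_))⟩
      by_cases hpF : p ∈ F
      · exact Or.inl hpF
      · exact Or.inr ⟨⟨hp.1, hpF⟩, hpe⟩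
    refine hpar.mem_closure h𝒢 hnest (Or.inl rfl)
      (R := ⋃₀ {t ∈ insert X C | t ⊂ P ∧ ¬ t ⊆ X}) (Set.union_subset (below_subset _ _)
        (Set.sep_subset _ _)) subset_rfl hx ?_
    refine M.closure_subset_closure ?_ (hXW hx)
    refine Set.union_subset (Set.sUnion_subset fun t ht => ?_)
      ((hLX.trans Set.subset_union_right).trans Set.subset_union_left)
    by_cases htX : t ⊆ X
    · refine ((subset_below (Or.inr ht.1) (htX.ssubset_of_ne ?_)).trans
        Set.subset_union_left).trans Set.subset_union_left
      rintro rfl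
      exact hXC ht.1
    · exact (Set.subset_sUnion_of_mem (show t ∈ {t ∈ insert X C | t ⊂ P ∧ ¬ t ⊆ X} from
        ⟨Or.inr ht.1, ht.2, htX⟩)).trans Set.subset_union_right
  · have h1 := hpar.relRk_diff h𝒢 hnest (Or.inl rfl)
    rw [hdiff] at h1
    have h2 : relRk M (insert X C) P = rk M P - rk M W := by rw [relRk, hbelow]
    omega

/-- The inserted ascent is unique. -/
lemma isAscent_insert_unique (hXC : X ∉ C) (hZC : Z ∉ C)
    (hCX : IsNested M 𝒢 (insert X C)) (hCZ : IsNested M 𝒢 (insert Z C))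
    (hPX : IsParent (insert X C) X P) (hPZ : IsParent (insert Z C) Z P)
    (hX : IsAscent M (insert X C) X) (hZ : IsAscent M (insert Z C) Z)
    (hr : relRk M (insert X C) X = relRk M (insert Z C) Z) : X = Z := by
  have hdiff : ∀ {Y}, Y ∉ C → insert Y C \ {Y} = C := fun {Y} hY => by
    rw [Set.insert_sdiff_of_mem _ (Set.mem_singleton Y), Set.sdiff_singleton_eq_self hY]
  have hb : ∀ {Y}, Y ∉ C → IsParent (insert Y C) Y P →
      below (insert Y C) P = below C P ∪ Y := fun {Y} hY hPY => by
    rw [below_eq_union (Set.mem_insert Y C) hPY.2.1, hdiff hY]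
  have hWX := hCX.isFlat_below h𝒢 P
  have hWZ := hCZ.isFlat_below h𝒢 P
  have hrX := hPX.relRk_diff h𝒢 hCX hX.1
  have hrZ := hPZ.relRk_diff h𝒢 hCZ hZ.1
  rw [hdiff hXC] at hrX
  rw [hdiff hZC] at hrZ
  have hrk : rk M (below (insert X C) P) = rk M (below (insert Z C) P) := by
    have h1 := rk_mono (M := M) (below_subset (insert X C) P)
    have h2 := rk_mono (M := M) (below_subset (insert Z C) P)
    unfold relRk at hrX hrZ hr
    omega
  -- If one join below `P` is not inside the other, some initial element of `Y` escapes the second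
  -- join while preceding everything outside the first. Two incomparable joins would give such
  -- elements `a < b` and `b < a`, so equality of ranks forces the joins to coincide.
  have hnot : ∀ {Y T}, Y ∉ C → T ∉ C → IsNested M 𝒢 (insert T C) → IsParent (insert Y C) Y P →
      IsParent (insert T C) T P → IsAscent M (insert Y C) Y →
      ¬ below (insert Y C) P ⊆ below (insert T C) P →
      ∃ a ∈ P \ below (insert T C) P, ∀ p ∈ P \ below (insert Y C) P, a < p := by
    intro Y T hYC hTC hCT hPY hPT hY hnsub
    by_contra! hcon
    apply hnsub
    have hF : below C P ⊆ below (insert T C) P := below_mono (Set.subset_insert _ _) P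
    rw [hb hYC hPY]
    refine Set.union_subset hF ?_
    obtain ⟨-, P', hP', hcl⟩ := hY
    obtain rfl := hPY.eq hP'
    refine hcl.trans (closure_subset_of_isFlat (hCT.isFlat_below h𝒢 P)
      (Set.union_subset (Set.sUnion_subset ?_) ?_))
    · rintro t ⟨ht, htY⟩
      have htC : t ∈ C := ht.resolve_left htY.ne
      exact (subset_below htC (htY.trans hPY.2.1)).trans hF
    · intro y hy
      by_contra hyT
      obtain ⟨p, hp, hpy⟩ := hcon y ⟨hPY.2.1.subset hy.1, hyT⟩
      exact absurd (hy.2 p hp) (not_lt.2 hpy)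
  have heq : below (insert X C) P = below (insert Z C) P := by
    have hPE : P ⊆ M.E := h𝒢.subset_ground (hCX.1 hPX.1)
    by_cases h1 : below (insert X C) P ⊆ below (insert Z C) P
    · exact h1.antisymm (subset_of_rk_le hWX ((below_subset _ _).trans hPE) h1 hrk.ge)
    by_cases h2 : below (insert Z C) P ⊆ below (insert X C) P
    · exact (h2.antisymm (subset_of_rk_le hWZ ((below_subset _ _).trans hPE) h2 hrk.le)).symm
    obtain ⟨a, ha, ha'⟩ := hnot hXC hZC hCZ hPX hPZ hX h1
    obtain ⟨b, hb, hb'⟩ := hnot hZC hXC hCX hPZ hPX hZ h2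
    exact absurd (ha' b hb) (hb' a ha).asymm
  have hSX := hCX.mono (Set.sep_subset _ fun t => t ⊂ P)
  have hSZ := hCZ.mono (Set.sep_subset _ fun t => t ⊂ P)
  -- The join determines its factors, and all of them belong to `insert Z C`; as `X ∉ C`, it must be
  -- `Z`.
  have hXf : X ∈ factors 𝒢 (below (insert X C) P) :=
    hSX.mem_factors h𝒢 ⟨Or.inl rfl, hPX.2.1⟩ (hPX.maximal h𝒢)
  rw [heq, ← hWZ.closure] at hXf
  have := (hSZ.mem_of_mem_factors h𝒢 hXf).1
  exact this.resolve_right hXC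

end Insertion

/-! ### Interpolating polynomials -/

/-- Polynomials in `s` over `ℤ[t]` with generating function
`∑ chainPoly n xⁿ = 1 / (1 - (1 + t) x + t (1 - s) x²)`. -/
def chainPoly : ℕ → ℤ[X][X]
  | 0 => 1
  | 1 => 1 + Polynomial.C Polynomial.X
  | n + 2 => (1 + Polynomial.C Polynomial.X) * chainPoly (n + 1) -
      Polynomial.C Polynomial.X * (1 - Polynomial.X) * chainPoly n

/-- The weight of a non-maximal element of a nested set, as a function of its relative rank. -/
def innerWeight : ℕ → ℤ[X][X]
  | 0 => 0
  | 1 => 0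
  | n + 2 => Polynomial.C Polynomial.X * chainPoly n

/-- The weight of a maximal element of a nested set, as a function of its relative rank. -/
def topWeight : ℕ → ℤ[X][X]
  | 0 => 0
  | n + 1 => chainPoly n

/-- The generating function is `1/Q` with `∂Q/∂s = -t x²`, so its derivative is `(t x²/Q) · (1/Q)`,
and `t x²/Q` is the generating function of `innerWeight`. -/
lemma derivative_chainPoly (n : ℕ) : Polynomial.derivative (chainPoly n) =
    ∑ p ∈ Finset.HasAntidiagonal.antidiagonal n, innerWeight p.1 * chainPoly p.2 := by
  induction n using Nat.strong_induction_on with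
  | _ n ih =>
    match n with
    | 0 => simp [chainPoly, innerWeight]
    | 1 => simp [chainPoly, innerWeight, Finset.Nat.antidiagonal_succ]
    | n + 2 =>
      rw [Finset.Nat.sum_antidiagonal_succ', Finset.Nat.sum_antidiagonal_succ']
      have h1 : ∑ p ∈ Finset.HasAntidiagonal.antidiagonal n, innerWeight p.1 * chainPoly (p.2 + 1 + 1) =
          (1 + Polynomial.C Polynomial.X) *
            (∑ p ∈ Finset.HasAntidiagonal.antidiagonal n, innerWeight p.1 * chainPoly (p.2 + 1)) -
          Polynomial.C Polynomial.X * (1 - Polynomial.X) *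
            ∑ p ∈ Finset.HasAntidiagonal.antidiagonal n, innerWeight p.1 * chainPoly p.2 := by
        rw [Finset.mul_sum, Finset.mul_sum, ← Finset.sum_sub_distrib]
        refine Finset.sum_congr rfl fun p _ => ?_
        rw [chainPoly]
        ring
      have h2 := ih (n + 1) (by omega)
      rw [Finset.Nat.sum_antidiagonal_succ'] at h2
      rw [h1, ← ih n (by omega), chainPoly]
      simp only [Polynomial.derivative_sub, Polynomial.derivative_mul, Polynomial.derivative_add,
        Polynomial.derivative_one, Polynomial.derivative_C, Polynomial.derivative_X, h2,
        zero_add, innerWeight, chainPoly]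
      ring

lemma sum_antidiagonal_eq_sum_Ioo {R : Type*} [CommRing R] (f g : ℕ → R) (hf : f 0 = 0)
    (hg : g 0 = 0) (m : ℕ) : ∑ p ∈ Finset.HasAntidiagonal.antidiagonal m, f p.1 * g p.2 =
      ∑ i ∈ Finset.Ioo 0 m, f i * g (m - i) := by
  rw [Finset.Nat.sum_antidiagonal_eq_sum_range_succ_mk]
  refine (Finset.sum_subset (fun i hi => ?_) fun i hi hi' => ?_).symm
  · rw [Finset.mem_Ioo] at hi
    rw [Finset.mem_range]
    omega
  · rw [Finset.mem_range] at hi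
    rw [Finset.mem_Ioo] at hi'
    rcases Nat.eq_zero_or_pos i with h | h
    · rw [h, hf, zero_mul]
    · have : m - i = 0 := by omega
      change f i * g (m - i) = 0
      rw [this, hg, mul_zero]

/-- Differentiation in `s` amounts to splitting off a new inner node of relative rank `i` and
leaving `m - i` to the old one; inner nodes obey the same rule. -/
lemma derivative_topWeight (m : ℕ) : Polynomial.derivative (topWeight m) =
    ∑ i ∈ Finset.Ioo 0 m, innerWeight i * topWeight (m - i) := by
  rw [← sum_antidiagonal_eq_sum_Ioo _ _ rfl rfl]
  cases m with
  | zero => simp [topWeight]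
  | succ m =>
    rw [Finset.Nat.sum_antidiagonal_succ']
    simp only [topWeight, mul_zero, zero_add]
    exact derivative_chainPoly m

lemma derivative_innerWeight (m : ℕ) : Polynomial.derivative (innerWeight m) =
    ∑ i ∈ Finset.Ioo 0 m, innerWeight i * innerWeight (m - i) := by
  rw [← sum_antidiagonal_eq_sum_Ioo _ _ rfl rfl]
  match m with
  | 0 => simp [innerWeight]
  | 1 => simp [innerWeight, Finset.Nat.antidiagonal_succ]
  | m + 2 =>
    rw [Finset.Nat.sum_antidiagonal_succ', Finset.Nat.sum_antidiagonal_succ']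
    simp only [innerWeight, mul_zero, zero_add, Polynomial.derivative_mul,
      Polynomial.derivative_C, zero_mul, derivative_chainPoly m, Finset.mul_sum]
    exact Finset.sum_congr rfl fun p _ => by ring

/-- At `s = 0` the denominator factors as `(1 - x)(1 - t x)`; at `s = 1` it is `1 - (1 + t) x`. -/
lemma eval_zero_chainPoly (n : ℕ) :
    (chainPoly n).eval 0 = ∑ i ∈ Finset.range (n + 1), (Polynomial.X : ℤ[X]) ^ i := by
  induction n using Nat.strong_induction_on with
  | _ n ih =>
    match n with
    | 0 => simp [chainPoly]
    | 1 => simp [chainPoly, Finset.sum_range_succ]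
    | n + 2 =>
      rw [chainPoly]
      simp only [Polynomial.eval_sub, Polynomial.eval_mul, Polynomial.eval_add,
        Polynomial.eval_one, Polynomial.eval_C, Polynomial.eval_X, ih n (by omega),
        ih (n + 1) (by omega), Finset.sum_range_succ _ (n + 2), Finset.sum_range_succ _ (n + 1)]
      ring

lemma eval_one_chainPoly (n : ℕ) : (chainPoly n).eval 1 = (1 + Polynomial.X : ℤ[X]) ^ n := by
  induction n using Nat.strong_induction_on with
  | _ n ih =>
    match n with
    | 0 => simp [chainPoly]
    | 1 => simp [chainPoly]
    | n + 2 =>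
      rw [chainPoly]
      simp only [Polynomial.eval_sub, Polynomial.eval_mul, Polynomial.eval_add,
        Polynomial.eval_one, Polynomial.eval_C, Polynomial.eval_X, ih n (by omega),
        ih (n + 1) (by omega)]
      ring

lemma eval_zero_topWeight (m : ℕ) :
    (topWeight m).eval 0 = ∑ i ∈ Finset.range m, (Polynomial.X : ℤ[X]) ^ i := by
  cases m with
  | zero => simp [topWeight]
  | succ m => exact eval_zero_chainPoly m

lemma eval_zero_innerWeight (m : ℕ) :
    (innerWeight m).eval 0 = ∑ i ∈ Finset.Ioo 0 m, (Polynomial.X : ℤ[X]) ^ i := by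
  match m with
  | 0 => simp [innerWeight]
  | 1 => simp [innerWeight, show Finset.Ioo 0 1 = ∅ from rfl]
  | m + 2 =>
    rw [innerWeight, Polynomial.eval_mul, Polynomial.eval_C, eval_zero_chainPoly, Finset.mul_sum]
    have : Finset.Ioo 0 (m + 2) = (Finset.range (m + 1)).map ⟨(· + 1), add_left_injective 1⟩ := by
      ext i
      simp only [Finset.mem_Ioo, Finset.mem_map, Finset.mem_range, Function.Embedding.coeFn_mk]
      exact ⟨fun h => ⟨i - 1, by omega, by omega⟩, by rintro ⟨j, hj, rfl⟩; omega⟩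
    rw [this, Finset.sum_map]
    exact Finset.sum_congr rfl fun i _ => by simp [pow_succ']

/-! ### The expansion over ascent-free nested sets -/

open Classical in
/-- The nested sets that contain all maximal elements of the building set. -/
def fullNested (M : Matroid α) (𝒢 : Finset (Set α)) : Finset (Finset (Set α)) :=
  𝒢.powerset.filter fun C => IsNested M 𝒢 C ∧ factors 𝒢 M.E ⊆ C

open Classical in
/-- The set of ascents of `C`. -/
def ascents [LinearOrder α] (M : Matroid α) (C : Finset (Set α)) : Finset (Set α) :=
  C.filter (IsAscent M C)

open Classical in
/-- The weight of an element of a nested set. -/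
def nodeWeight (M : Matroid α) (𝒢 : Finset (Set α)) (P : Set α) (m : ℕ) : ℤ[X][X] :=
  if P ∈ factors 𝒢 M.E then topWeight m else innerWeight m

/-- The weighted sum over nested sets interpolating between the Hilbert series of the Chow ring and
its expansion over ascent-free nested sets. -/
def nestedSum [LinearOrder α] (M : Matroid α) (𝒢 : Finset (Set α)) : ℤ[X][X] :=
  ∑ C ∈ fullNested M 𝒢, (1 - Polynomial.X) ^ (ascents M C).card *
    ∏ P ∈ C, nodeWeight M 𝒢 P (relRk M C P)

section Sum

variable {M : Matroid α} {𝒢 : Finset (Set α)}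

lemma mem_fullNested {C : Finset (Set α)} :
    C ∈ fullNested M 𝒢 ↔ IsNested M 𝒢 C ∧ factors 𝒢 M.E ⊆ C := by
  classical
  rw [fullNested, Finset.mem_filter, Finset.mem_powerset, and_iff_right_iff_imp]
  exact fun h => Finset.coe_subset.1 h.1.1

lemma mem_ascents [LinearOrder α] {C : Finset (Set α)} {X : Set α} :
    X ∈ ascents M C ↔ IsAscent M C X := by
  classical
  rw [ascents, Finset.mem_filter, and_iff_right_iff_imp]
  exact fun h => h.1

lemma derivative_nodeWeight (P : Set α) (m : ℕ) : Polynomial.derivative (nodeWeight M 𝒢 P m) =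
    ∑ i ∈ Finset.Ioo 0 m, innerWeight i * nodeWeight M 𝒢 P (m - i) := by
  unfold nodeWeight
  split_ifs
  · exact derivative_topWeight m
  · exact derivative_innerWeight m

variable [M.Finite] [M.Loopless] (h𝒢 : IsBuildingSet M 𝒢)

include h𝒢

lemma notMem_factors_of_isParent {C : Finset (Set α)} (hC : C ∈ fullNested M 𝒢) {X P : Set α}
    (hP : IsParent (C : Set (Set α)) X P) : X ∉ factors 𝒢 M.E := by
  intro hX
  have hP𝒢 := (mem_fullNested.1 hC).1.1 hP.1
  exact hP.2.1.ne (eq_of_mem_factors hX hP𝒢 (h𝒢.subset_ground hP𝒢) hP.2.1.subset)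

lemma erase_mem_fullNested [DecidableEq (Set α)] {C : Finset (Set α)} (hC : C ∈ fullNested M 𝒢)
    {X : Set α} (hX : X ∉ factors 𝒢 M.E) : C.erase X ∈ fullNested M 𝒢 := by
  obtain ⟨h1, h2⟩ := mem_fullNested.1 hC
  rw [mem_fullNested, Finset.coe_erase]
  exact ⟨h1.mono Set.sdiff_subset, fun Y hY => ⟨h2 hY, fun h => hX (h ▸ hY)⟩⟩

variable [LinearOrder α] (hc : IsCompleteFor M 𝒢)

include hc

lemma ascents_erase [DecidableEq (Set α)] {C : Finset (Set α)} (hC : C ∈ fullNested M 𝒢)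
    {X : Set α} (hX : X ∈ ascents M C) : ascents M (C.erase X) = (ascents M C).erase X := by
  have hn := (mem_fullNested.1 hC).1
  rw [mem_ascents] at hX
  ext Z
  rw [Finset.mem_erase, mem_ascents, mem_ascents, Finset.coe_erase]
  exact ⟨fun h => ⟨h.1.2, h.of_diff h𝒢 hn hX.1⟩, fun h => hX.diff h𝒢 hc hn h.2 h.1⟩

/-- Differentiating the power of `1 - s` marks an ascent `X` of `C`. Differentiating the weights
marks a node `P` and a splitting of its relative rank. Deleting `X` while remembering its parent and
its relative rank matches the two kinds of terms, which have opposite signs. The products agree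
because only the parent changes relative rank and the ascents drop by exactly one. -/
lemma derivative_nestedSum : Polynomial.derivative (nestedSum M 𝒢) = 0 := by
  classical
  set w : Finset (Set α) → Set α → ℤ[X][X] := fun C P => nodeWeight M 𝒢 P (relRk M C P) with hw
  have hsum1 : ∀ C, ((ascents M C).card : ℤ[X][X]) * (1 - Polynomial.X) ^ ((ascents M C).card - 1) *
      ∏ P ∈ C, w C P = ∑ _X ∈ ascents M C, (1 - Polynomial.X) ^ ((ascents M C).card - 1) *
      ∏ P ∈ C, w C P := by
    intro C
    rw [Finset.sum_const, nsmul_eq_mul, mul_assoc]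
  have hsum2 : ∀ C, (1 - Polynomial.X) ^ (ascents M C).card *
      Polynomial.derivative (∏ P ∈ C, w C P) =
      ∑ q ∈ C.sigma (fun P => Finset.Ioo 0 (relRk M C P)), (1 - Polynomial.X) ^ (ascents M C).card *
        ((∏ Q ∈ C.erase q.1, w C Q) *
          (innerWeight q.2 * nodeWeight M 𝒢 q.1 (relRk M C q.1 - q.2))) := by
    intro C
    rw [Polynomial.derivative_prod_finset, Finset.sum_sigma, Finset.mul_sum]
    refine Finset.sum_congr rfl fun P _ => ?_
    rw [hw]
    simp only
    rw [derivative_nodeWeight, Finset.mul_sum, Finset.mul_sum]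
  have hder : ∀ C, Polynomial.derivative ((1 - Polynomial.X) ^ (ascents M C).card *
      ∏ P ∈ C, w C P) =
      -(∑ _X ∈ ascents M C, (1 - Polynomial.X) ^ ((ascents M C).card - 1) * ∏ P ∈ C, w C P) +
      ∑ q ∈ C.sigma (fun P => Finset.Ioo 0 (relRk M C P)), (1 - Polynomial.X) ^ (ascents M C).card *
        ((∏ Q ∈ C.erase q.1, w C Q) *
          (innerWeight q.2 * nodeWeight M 𝒢 q.1 (relRk M C q.1 - q.2))) := by
    intro C
    rw [Polynomial.derivative_mul, ← hsum1, ← hsum2, Polynomial.derivative_pow]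
    simp only [Polynomial.derivative_sub, Polynomial.derivative_one, Polynomial.derivative_X,
      map_natCast]
    ring
  rw [nestedSum, Polynomial.derivative_sum]
  rw [Finset.sum_congr rfl fun C _ => hder C, Finset.sum_add_distrib, Finset.sum_neg_distrib,
    neg_add_eq_zero, Finset.sum_sigma', Finset.sum_sigma']
  have hpar : ∀ C ∈ fullNested M 𝒢, ∀ X ∈ ascents M C, ∃ P, IsParent (C : Set (Set α)) X P :=
    fun C _ X hX => by
      obtain ⟨-, P, hP, -⟩ := mem_ascents.1 hX
      exact ⟨P, hP⟩
  -- The default `∅` is never used: an ascent has a parent by definition.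
  let par : Finset (Set α) → Set α → Set α := fun C X =>
    if h : ∃ P, IsParent (C : Set (Set α)) X P then h.choose else ∅
  have hpar' : ∀ {C X}, C ∈ fullNested M 𝒢 → X ∈ ascents M C →
      IsParent (C : Set (Set α)) X (par C X) := by
    intro C X hC hX
    have h := hpar C hC X hX
    simp only [par, dif_pos h]
    exact h.choose_spec
  have hrel : ∀ {C X}, C ∈ fullNested M 𝒢 → X ∈ ascents M C →
      relRk M (C.erase X : Finset (Set α)) (par C X) = relRk M C (par C X) + relRk M C X := by
    intro C X hC hX
    have := (hpar' hC hX).relRk_diff h𝒢 (mem_fullNested.1 hC).1 (mem_ascents.1 hX).1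
    rwa [← Finset.coe_erase] at this
  have hnest : ∀ {C}, C ∈ fullNested M 𝒢 → IsNested M 𝒢 C := fun h => (mem_fullNested.1 h).1
  refine Finset.sum_bij (fun p _ => ⟨p.1.erase p.2, ⟨par p.1 p.2, relRk M p.1 p.2⟩⟩) ?_ ?_ ?_ ?_
  · rintro ⟨C, X⟩ hp
    simp only [Finset.mem_sigma] at hp
    obtain ⟨hC, hX⟩ := hp
    have hP := hpar' hC hX
    have hn := hnest hC
    simp only [Finset.mem_sigma, Finset.mem_Ioo]
    refine ⟨erase_mem_fullNested h𝒢 hC (notMem_factors_of_isParent h𝒢 hC hP),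
      Finset.mem_erase.2 ⟨hP.2.1.ne', hP.1⟩, ?_, ?_⟩
    · exact hn.relRk_pos h𝒢 (hn.1 (mem_ascents.1 hX).1)
    · rw [hrel hC hX]
      have := hn.relRk_pos h𝒢 (hn.1 hP.1)
      omega
  · rintro ⟨C₁, X₁⟩ h₁ ⟨C₂, X₂⟩ h₂ heq
    simp only [Finset.mem_sigma] at h₁ h₂
    simp only [Sigma.mk.injEq, heq_eq_eq] at heq
    obtain ⟨hCC, hPP, hrr⟩ := heq
    have hP₁ := hpar' h₁.1 h₁.2
    have hP₂ := hpar' h₂.1 h₂.2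
    rw [← hPP] at hP₂
    have hX₁ := mem_ascents.1 h₁.2
    have hX₂ := mem_ascents.1 h₂.2
    have e₁ : insert X₁ ((C₁.erase X₁ : Finset (Set α)) : Set (Set α)) = C₁ := by
      rw [← Finset.coe_insert, Finset.insert_erase hX₁.1]
    have e₂ : insert X₂ ((C₁.erase X₁ : Finset (Set α)) : Set (Set α)) = C₂ := by
      rw [hCC, ← Finset.coe_insert, Finset.insert_erase hX₂.1]
    have hXX : X₁ = X₂ := by
      refine isAscent_insert_unique h𝒢 (C := (C₁.erase X₁ : Finset (Set α))) (P := par C₁ X₁)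
        ?_ ?_ ?_ ?_ ?_ ?_ ?_ ?_ ?_
      · simp
      · rw [hCC]
        simp
      · rw [e₁]
        exact hnest h₁.1
      · rw [e₂]
        exact hnest h₂.1
      · rwa [e₁]
      · rwa [e₂]
      · rwa [e₁]
      · rwa [e₂]
      · rw [e₁, e₂, hrr]
    subst hXX
    have : C₁ = C₂ := by
      rw [← Finset.insert_erase hX₁.1, hCC, Finset.insert_erase hX₂.1]
    rw [this]
  · rintro ⟨C, P, i⟩ hp
    simp only [Finset.mem_sigma, Finset.mem_Ioo] at hp
    obtain ⟨hC, hP, hi⟩ := hp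
    obtain ⟨X, hXC, hn, hpX, hX, hr⟩ :=
      exists_isAscent_insert h𝒢 hc (hnest hC) hP hi.1 hi.2
    rw [← Finset.coe_insert] at hn hpX hX hr
    have hC' : insert X C ∈ fullNested M 𝒢 := by
      refine mem_fullNested.2 ⟨hn, (mem_fullNested.1 hC).2.trans ?_⟩
      rw [Finset.coe_insert]
      exact Set.subset_insert _ _
    have hX' := mem_ascents.2 hX
    refine ⟨⟨insert X C, X⟩, Finset.mem_sigma.2 ⟨hC', hX'⟩, ?_⟩
    simp only [Sigma.mk.injEq, heq_eq_eq]
    rw [Finset.erase_insert (by exact_mod_cast hXC)]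
    exact ⟨rfl, (hpar' hC' hX').eq hpX, hr⟩
  · rintro ⟨C, X⟩ hp
    simp only [Finset.mem_sigma] at hp
    obtain ⟨hC, hX⟩ := hp
    have hP := hpar' hC hX
    have hXC : X ∈ C := (mem_ascents.1 hX).1
    simp only
    rw [ascents_erase h𝒢 hc hC hX, Finset.card_erase_of_mem hX]
    congr 1
    have hPC : par C X ∈ C.erase X := Finset.mem_erase.2 ⟨hP.2.1.ne', hP.1⟩
    rw [← Finset.mul_prod_erase _ _ hXC, ← Finset.mul_prod_erase _ _ hPC]
    have h1 : w C X = innerWeight (relRk M C X) := by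
      simp only [hw, nodeWeight, if_neg (notMem_factors_of_isParent h𝒢 hC hP)]
    have h2 : ∏ Q ∈ (C.erase X).erase (par C X), w (C.erase X) Q =
        ∏ Q ∈ (C.erase X).erase (par C X), w C Q := by
      refine Finset.prod_congr rfl fun Q hQ => ?_
      rw [Finset.mem_erase, Finset.mem_erase] at hQ
      simp only [hw, relRk]
      rw [Finset.coe_erase, hP.below_diff hQ.2.2 hQ.1]
    rw [h1, h2, hrel hC hX, Nat.add_sub_cancel]
    simp only [hw]
    ring

/-- The Hilbert series, written as a sum over nested sets, equals a sum over ascent-free nested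
sets. -/
theorem sum_eval_zero_eq_sum_eval_one :
    ∑ C ∈ fullNested M 𝒢, ∏ P ∈ C, (nodeWeight M 𝒢 P (relRk M C P)).eval 0 =
    ∑ C ∈ (fullNested M 𝒢).filter (fun C => ascents M C = ∅),
      ∏ P ∈ C, (nodeWeight M 𝒢 P (relRk M C P)).eval 1 := by
  have h := Polynomial.eq_C_of_natDegree_eq_zero
    (Polynomial.derivative_eq_zero.1 (derivative_nestedSum h𝒢 hc))
  have h01 : (nestedSum M 𝒢).eval 0 = (nestedSum M 𝒢).eval 1 := by
    rw [h, Polynomial.eval_C, Polynomial.eval_C]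
  rw [nestedSum, Polynomial.eval_finsetSum, Polynomial.eval_finsetSum] at h01
  rw [Finset.sum_filter]
  refine Eq.trans (Finset.sum_congr rfl fun C _ => ?_)
    (h01.trans (Finset.sum_congr rfl fun C _ => ?_))
  · simp [Polynomial.eval_prod]
  · split_ifs with hA
    · simp [Polynomial.eval_prod, hA]
    · rw [← Finset.card_eq_zero] at hA
      simp [hA]

end Sum

/-! ### Counting standard monomials -/

section Count

variable {M : Matroid α} {𝒢 : Finset (Set α)}

lemma below_union_factors (T : Set (Set α)) {K : Set α} (hK : K ∈ 𝒢) (hKE : K ⊆ M.E) :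
    below (T ∪ factors 𝒢 M.E) K = below T K := by
  refine (Set.sUnion_subset fun t ht => ?_).antisymm (below_mono Set.subset_union_left K)
  rcases ht.1 with h | h
  · exact subset_below h ht.2
  · exact absurd (eq_of_mem_factors h hK hKE ht.2.subset) ht.2.ne

lemma relRk_union_factors (T : Set (Set α)) {K : Set α} (hK : K ∈ 𝒢) (hKE : K ⊆ M.E) :
    relRk M (T ∪ factors 𝒢 M.E) K = relRk M T K := by
  rw [relRk, relRk, below_union_factors T hK hKE]

open Classical in
/-- The possible exponents of a variable of a standard monomial. -/
def exponents (M : Matroid α) (𝒢 : Finset (Set α)) (P : Set α) (d : ℕ) : Finset ℕ :=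
  if P ∈ factors 𝒢 M.E then Finset.range d else Finset.Ioo 0 d

lemma mem_exponents {P : Set α} {d i : ℕ} :
    i ∈ exponents M 𝒢 P d ↔ i < d ∧ (P ∈ factors 𝒢 M.E ∨ i ≠ 0) := by
  unfold exponents
  split_ifs with h
  · simp [h]
  · simp only [Finset.mem_Ioo, h, false_or]
    omega

lemma eval_zero_nodeWeight (P : Set α) (d : ℕ) :
    (nodeWeight M 𝒢 P d).eval 0 = ∑ i ∈ exponents M 𝒢 P d, (Polynomial.X : ℤ[X]) ^ i := by
  unfold nodeWeight exponents
  split_ifs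
  · exact eval_zero_topWeight d
  · exact eval_zero_innerWeight d

open Classical in
/-- The exponent vectors supported on the nested set `C`. -/
def exponentVectors (M : Matroid α) (𝒢 : Finset (Set α)) (C : Finset (Set α)) :
    Finset (𝒢 → ℕ) :=
  Fintype.piFinset fun G : {G // G ∈ 𝒢} => if G.1 ∈ C then exponents M 𝒢 G.1 (relRk M C G.1) else {0}

lemma prod_eval_zero_nodeWeight {C : Finset (Set α)} (hC : C ⊆ 𝒢) :
    ∏ P ∈ C, (nodeWeight M 𝒢 P (relRk M C P)).eval 0 =
      ∑ f ∈ exponentVectors M 𝒢 C, (Polynomial.X : ℤ[X]) ^ (∑ G, f G) := by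
  classical
  rw [exponentVectors]
  simp_rw [← Finset.prod_pow_eq_pow_sum]
  rw [← Finset.prod_univ_sum]
  have h1 : ∀ G : {G // G ∈ 𝒢}, ∑ i ∈ (if G.1 ∈ C then exponents M 𝒢 G.1 (relRk M C G.1) else {0}),
      (Polynomial.X : ℤ[X]) ^ i =
      (fun P => if P ∈ C then (nodeWeight M 𝒢 P (relRk M C P)).eval 0 else 1) G.1 := by
    intro G
    simp only
    split_ifs
    · rw [eval_zero_nodeWeight]
    · simp
  rw [Finset.prod_congr rfl fun G _ => h1 G, Finset.prod_coe_sort 𝒢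
    (fun P => if P ∈ C then (nodeWeight M 𝒢 P (relRk M C P)).eval 0 else 1),
    Finset.prod_ite_mem, Finset.inter_eq_right.2 hC]

lemma coeff_prod_eval_zero_nodeWeight {C : Finset (Set α)} (hC : C ⊆ 𝒢) (k : ℕ) :
    (∏ P ∈ C, (nodeWeight M 𝒢 P (relRk M C P)).eval 0).coeff k =
      (((exponentVectors M 𝒢 C).filter fun f => ∑ G, f G = k).card : ℤ) := by
  rw [prod_eval_zero_nodeWeight hC, Polynomial.finsetSum_coeff, Finset.card_filter]
  push_cast
  exact Finset.sum_congr rfl fun f _ => by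
    rw [Polynomial.coeff_X_pow]
    exact if_congr eq_comm rfl rfl

variable [M.Finite] [M.Loopless] (h𝒢 : IsBuildingSet M 𝒢)

include h𝒢

lemma IsNested.union_factors {T : Set (Set α)} (hT : IsNested M 𝒢 T) :
    IsNested M 𝒢 (T ∪ factors 𝒢 M.E) := by
  classical
  have hfin : (factors 𝒢 M.E).Finite := 𝒢.finite_toSet.subset fun _ h => BuiltMatroid.mem_of_mem_factors h
  have key : ∀ A : Set (Set α), A.Finite → A ⊆ factors 𝒢 M.E → IsNested M 𝒢 (A ∪ T) := by
    intro A hA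
    induction A, hA using Set.Finite.induction_on with
    | empty => simpa using hT
    | insert hxA _ ih =>
      intro hsub
      rw [Set.insert_union]
      have h := ih fun x hx => hsub (Set.mem_insert_of_mem _ hx)
      exact h.insert h𝒢 M.ground_isFlat (hsub (Set.mem_insert _ _))
        fun t ht => Or.inl (h𝒢.subset_ground (h.1 ht))
  rw [Set.union_comm]
  exact key _ hfin subset_rfl

-- A standard monomial corresponds to its support enlarged by all maximal elements of `𝒢`, together
-- with its exponents. This is why the exponent zero is allowed exactly at maximal elements;
-- enlarging the support does not change relative ranks.
open Classical in
lemma card_isStandard (k : ℕ) :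
    Nat.card {m : 𝒢 →₀ ℕ // IsStandard M 𝒢 Finset.univ ∅ m ∧ m.degree = k} =
    ((fullNested M 𝒢).sigma fun C =>
      (exponentVectors M 𝒢 C).filter fun f => ∑ G, f G = k).card := by
  have hdeg : ∀ m : 𝒢 →₀ ℕ, m.degree = ∑ G, m G := fun m => by
    rw [Finsupp.degree]
    exact Finset.sum_subset (Finset.subset_univ _) (by simp)
  have hmax : ∀ P ∈ factors 𝒢 M.E, P ∈ 𝒢 := fun _ h => mem_of_mem_factors h
  let Φ : (𝒢 →₀ ℕ) → Finset (Set α) := fun m =>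
    𝒢.filter fun P => P ∈ vals m.support ∪ factors 𝒢 M.E
  have hΦ : ∀ m, ((Φ m : Finset (Set α)) : Set (Set α)) = vals m.support ∪ factors 𝒢 M.E := by
    intro m
    ext P
    simp only [Φ, Finset.coe_filter, Set.mem_ofPred_eq, and_iff_right_iff_imp]
    rintro (⟨G, -, rfl⟩ | h)
    · exact G.2
    · exact hmax P h
  have hmemΦ : ∀ m (G : {G // G ∈ 𝒢}), G.1 ∈ Φ m ↔ m G ≠ 0 ∨ G.1 ∈ factors 𝒢 M.E := by
    intro m G
    rw [← Finset.mem_coe, hΦ, Set.mem_union, mem_vals, Finsupp.mem_support_iff]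
  have hrel : ∀ m, ∀ G ∈ 𝒢, relRk M (Φ m : Set (Set α)) G = relRk M (vals m.support ∪ ∅) G := by
    intro m G hG
    rw [hΦ, relRk_union_factors _ hG (h𝒢.subset_ground hG), Set.union_empty]
  have hmem : ∀ (m : 𝒢 →₀ ℕ) C, C ∈ fullNested M 𝒢 → ⇑m ∈ exponentVectors M 𝒢 C → Φ m = C := by
    intro m C hC hm
    rw [exponentVectors, Fintype.mem_piFinset] at hm
    ext P
    constructor
    · intro hP
      have hP𝒢 : P ∈ 𝒢 := (Finset.mem_filter.1 hP).1
      rcases (hmemΦ m ⟨P, hP𝒢⟩).1 hP with h | h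
      · by_contra hPC
        have := hm ⟨P, hP𝒢⟩
        rw [if_neg hPC, Finset.mem_singleton] at this
        exact h this
      · exact (mem_fullNested.1 hC).2 h
    · intro hP
      have hP𝒢 := (mem_fullNested.1 hC).1.1 hP
      rw [hmemΦ m ⟨P, hP𝒢⟩]
      have := hm ⟨P, hP𝒢⟩
      rw [if_pos hP, mem_exponents] at this
      exact this.2.symm
  rw [← Nat.card_eq_finsetCard]
  refine Nat.card_eq_of_bijective (fun m => ⟨⟨Φ m.1, m.1⟩, ?_⟩) ⟨?_, ?_⟩
  · obtain ⟨m, hm, hk⟩ := m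
    have hn : IsNested M 𝒢 (vals m.support) := by simpa using hm.2.1
    simp only [Finset.mem_sigma, Finset.mem_filter]
    refine ⟨mem_fullNested.2 ⟨?_, ?_⟩, ?_, by rw [← hdeg, hk]⟩
    · rw [hΦ]
      exact hn.union_factors h𝒢
    · rw [hΦ]
      exact Set.subset_union_right
    · rw [exponentVectors, Fintype.mem_piFinset]
      intro G
      split_ifs with hG
      · rw [mem_exponents, hrel m G.1 G.2]
        refine ⟨?_, ((hmemΦ m G).1 hG).symm⟩
        by_cases h0 : m G = 0
        · rw [h0]
          exact hm.2.1.relRk_pos h𝒢 G.2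
        · exact hm.2.2 G (Finsupp.mem_support_iff.2 h0)
      · rw [hmemΦ] at hG
        push Not at hG
        exact Finset.mem_singleton.2 hG.1
  · rintro ⟨m, hm⟩ ⟨m', hm'⟩ h
    simp only [Subtype.mk.injEq, Sigma.mk.injEq] at h
    exact Subtype.ext (DFunLike.coe_injective (eq_of_heq h.2))
  · rintro ⟨⟨C, f⟩, h⟩
    rw [Finset.mem_sigma, Finset.mem_filter] at h
    obtain ⟨hC, hf, hk⟩ := h
    let m : 𝒢 →₀ ℕ := Finsupp.equivFunOnFinite.symm f
    have hmf : ⇑m = f := rfl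
    have hΦC : Φ m = C := hmem m C hC hf
    have hn := (mem_fullNested.1 hC).1
    refine ⟨⟨m, ⟨Finset.subset_univ _, ?_, ?_⟩, ?_⟩, ?_⟩
    · rw [Set.union_empty]
      refine hn.mono ?_
      rw [← hΦC, hΦ]
      exact Set.subset_union_left
    · intro K hK
      rw [← hrel m K.1 K.2, hΦC]
      have h1 := hf
      simp only [exponentVectors, Fintype.mem_piFinset] at h1
      have h2 := h1 K
      rw [if_pos, mem_exponents] at h2
      · exact h2.1
      · rw [← hΦC, hmemΦ]
        exact Or.inl (Finsupp.mem_support_iff.1 hK)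
    · rw [hdeg]
      exact hk
    · exact Subtype.ext (Sigma.ext hΦC (heq_of_eq hmf))

/-- The ranks of the pieces of the Chow ring are the coefficients of a sum over nested sets. -/
theorem finrank_chowPiece_eq_coeff (k : ℕ) :
    (Module.finrank ℤ (chowPiece M 𝒢 k) : ℤ) =
      (∑ C ∈ fullNested M 𝒢, ∏ P ∈ C, (nodeWeight M 𝒢 P (relRk M C P)).eval 0).coeff k := by
  classical
  rw [finrank_chowPiece h𝒢, card_isStandard h𝒢, Finset.card_sigma, Polynomial.finsetSum_coeff]
  push_cast
  refine Finset.sum_congr rfl fun C hC => ?_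
  rw [coeff_prod_eval_zero_nodeWeight (Finset.coe_subset.1 (mem_fullNested.1 hC).1.1)]

end Count

/-! ### The expansion over ascent-free nested sets, evaluated -/

section Gamma

variable {M : Matroid α} {𝒢 : Finset (Set α)}

lemma eval_one_topWeight {m : ℕ} (hm : 0 < m) :
    (topWeight m).eval 1 = (1 + Polynomial.X : ℤ[X]) ^ (m - 1) := by
  obtain ⟨n, rfl⟩ := Nat.exists_eq_succ_of_ne_zero hm.ne'
  exact eval_one_chainPoly n

lemma eval_one_innerWeight_of_lt {m : ℕ} (hm : m < 2) : (innerWeight m).eval 1 = 0 := by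
  interval_cases m <;> simp [innerWeight]

lemma eval_one_innerWeight {m : ℕ} (hm : 2 ≤ m) :
    (innerWeight m).eval 1 = Polynomial.X * (1 + Polynomial.X : ℤ[X]) ^ (m - 2) := by
  obtain ⟨n, rfl⟩ := Nat.exists_eq_add_of_le' hm
  rw [innerWeight, Polynomial.eval_mul, Polynomial.eval_C, eval_one_chainPoly, Nat.add_sub_cancel]

lemma relRk_anti {T T' : Set (Set α)} [M.Finite] (h : T ⊆ T') (K : Set α) :
    relRk M T' K ≤ relRk M T K :=
  Nat.sub_le_sub_left (rk_mono (below_mono h K)) _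

open Classical in
/-- The ascent-free nested sets containing the maximal elements of the building set, all other
elements of which have relative rank at least two. -/
def ascentFree [LinearOrder α] (M : Matroid α) (𝒢 : Finset (Set α)) : Finset (Finset (Set α)) :=
  (fullNested M 𝒢).filter fun C =>
    ascents M C = ∅ ∧ ∀ P ∈ C, P ∉ factors 𝒢 M.E → 2 ≤ relRk M C P

open Classical in
/-- The non-maximal elements of the ascent-free nested sets. -/
def gammaFaces [LinearOrder α] (M : Matroid α) (𝒢 : Finset (Set α)) : Finset (Finset (Set α)) :=
  (ascentFree M 𝒢).image fun C => C.filter (· ∉ factors 𝒢 M.E)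

open Classical in
lemma filter_factors_of_mem_fullNested {C : Finset (Set α)} (hC : C ∈ fullNested M 𝒢) :
    C.filter (· ∈ factors 𝒢 M.E) = 𝒢.filter (· ∈ factors 𝒢 M.E) := by
  ext P
  simp only [Finset.mem_filter, and_congr_left_iff]
  exact fun h => ⟨fun _ => mem_of_mem_factors h, fun _ => (mem_fullNested.1 hC).2 h⟩

variable [M.Finite] [M.Loopless] (h𝒢 : IsBuildingSet M 𝒢)

include h𝒢

/-- Removing a maximal member lowers the rank of the join by exactly its relative rank and affects
no other relative rank. -/
lemma sum_relRk (C : Finset (Set α)) (hC : IsNested M 𝒢 C) :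
    ∑ P ∈ C, relRk M C P = rk M (⋃₀ C) := by
  classical
  induction hn : C.card generalizing C with
  | zero =>
    rw [Finset.card_eq_zero] at hn
    simp [hn, rk_empty]
  | succ n ih =>
    obtain ⟨t, ht⟩ := Finset.card_pos.1 (by omega : 0 < C.card)
    obtain ⟨s, hs, -, hmax⟩ := hC.exists_maximal ht
    have hsC : s ∈ C := hs
    have h1 := ih (C.erase s) (by rw [Finset.coe_erase]; exact hC.mono Set.sdiff_subset)
      (by rw [Finset.card_erase_of_mem hsC, hn]; rfl)
    have h2 := hC.rk_sUnion_add h𝒢 hs hmax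
    have h3 : ∑ P ∈ C.erase s, relRk M (C.erase s : Finset (Set α)) P =
        ∑ P ∈ C.erase s, relRk M C P := by
      refine Finset.sum_congr rfl fun P hP => ?_
      rw [relRk, relRk, Finset.coe_erase]
      congr 2
      refine (below_mono Set.sdiff_subset P).antisymm (Set.sUnion_subset fun t ht => ?_)
      refine subset_below ⟨ht.1, fun h => ?_⟩ ht.2
      rw [Set.mem_singleton_iff] at h
      subst h
      exact (Finset.mem_erase.1 hP).1 (hmax P (Finset.mem_erase.1 hP).2 ht.2.subset)
    rw [← Finset.add_sum_erase _ _ hsC, ← h3, h1, Finset.coe_erase]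
    have h4 := hC.rk_below_lt h𝒢 (hC.1 hs)
    rw [relRk]
    omega

lemma sum_relRk_of_mem_fullNested {C : Finset (Set α)} (hC : C ∈ fullNested M 𝒢) :
    ∑ P ∈ C, relRk M C P = rk M M.E := by
  obtain ⟨h1, h2⟩ := mem_fullNested.1 hC
  rw [sum_relRk h𝒢 C h1]
  congr 1
  refine (h1.sUnion_subset_ground h𝒢).antisymm ?_
  rw [← h𝒢.sUnion_factors M.ground_isFlat]
  exact Set.sUnion_subset_sUnion h2

variable [LinearOrder α]

-- The relative ranks add up to the rank of `M`. At `s = 1` each maximal element uses up one unit of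
-- rank and each other element two, while the rest becomes the exponent of `1 + t`.
open Classical in
lemma prod_eval_one_nodeWeight {C : Finset (Set α)} (hC : C ∈ fullNested M 𝒢)
    (h2 : ∀ P ∈ C, P ∉ factors 𝒢 M.E → 2 ≤ relRk M C P) :
    2 * (C.filter (· ∉ factors 𝒢 M.E)).card +
      (𝒢.filter (· ∈ factors 𝒢 M.E)).card ≤ rk M M.E ∧
    ∏ P ∈ C, (nodeWeight M 𝒢 P (relRk M C P)).eval 1 =
      Polynomial.X ^ (C.filter (· ∉ factors 𝒢 M.E)).card * (1 + Polynomial.X : ℤ[X]) ^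
        (rk M M.E - (𝒢.filter (· ∈ factors 𝒢 M.E)).card -
          2 * (C.filter (· ∉ factors 𝒢 M.E)).card) := by
  have hn := (mem_fullNested.1 hC).1
  have hpos : ∀ P ∈ C, 1 ≤ relRk M C P := fun P hP => hn.relRk_pos h𝒢 (hn.1 hP)
  have hsum := sum_relRk_of_mem_fullNested h𝒢 hC
  rw [← Finset.sum_filter_add_sum_filter_not C (· ∈ factors 𝒢 M.E)] at hsum
  have e1 : ∑ P ∈ C with P ∈ factors 𝒢 M.E, relRk M C P =
      ∑ P ∈ C with P ∈ factors 𝒢 M.E, (relRk M C P - 1) +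
        (𝒢.filter (· ∈ factors 𝒢 M.E)).card := by
    rw [← filter_factors_of_mem_fullNested hC, Finset.card_eq_sum_ones, ← Finset.sum_add_distrib]
    exact Finset.sum_congr rfl fun P hP =>
      (Nat.sub_add_cancel (hpos P (Finset.mem_filter.1 hP).1)).symm
  have e2 : ∑ P ∈ C with P ∉ factors 𝒢 M.E, relRk M C P =
      ∑ P ∈ C with P ∉ factors 𝒢 M.E, (relRk M C P - 2) +
        2 * (C.filter (· ∉ factors 𝒢 M.E)).card := by
    rw [Finset.card_eq_sum_ones, Finset.mul_sum, ← Finset.sum_add_distrib]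
    exact Finset.sum_congr rfl fun P hP =>
      (Nat.sub_add_cancel (h2 P (Finset.mem_filter.1 hP).1 (Finset.mem_filter.1 hP).2)).symm
  rw [e1, e2] at hsum
  refine ⟨by omega, ?_⟩
  rw [← Finset.prod_filter_mul_prod_filter_not C (· ∈ factors 𝒢 M.E)]
  have e3 : ∏ P ∈ C with P ∈ factors 𝒢 M.E, (nodeWeight M 𝒢 P (relRk M C P)).eval 1 =
      (1 + Polynomial.X : ℤ[X]) ^ ∑ P ∈ C with P ∈ factors 𝒢 M.E, (relRk M C P - 1) := by
    rw [← Finset.prod_pow_eq_pow_sum]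
    refine Finset.prod_congr rfl fun P hP => ?_
    rw [Finset.mem_filter] at hP
    rw [nodeWeight, if_pos hP.2, eval_one_topWeight (hpos P hP.1)]
  have e4 : ∏ P ∈ C with P ∉ factors 𝒢 M.E, (nodeWeight M 𝒢 P (relRk M C P)).eval 1 =
      Polynomial.X ^ (C.filter (· ∉ factors 𝒢 M.E)).card *
      (1 + Polynomial.X : ℤ[X]) ^ ∑ P ∈ C with P ∉ factors 𝒢 M.E, (relRk M C P - 2) := by
    rw [← Finset.prod_pow_eq_pow_sum, ← Finset.prod_const, ← Finset.prod_mul_distrib]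
    refine Finset.prod_congr rfl fun P hP => ?_
    rw [Finset.mem_filter] at hP
    rw [nodeWeight, if_neg hP.2, eval_one_innerWeight (h2 P hP.1 hP.2)]
  rw [e3, e4, mul_left_comm, ← pow_add]
  congr 2
  omega

lemma ascents_eq_empty_of_subset [DecidableEq (Set α)] {C C' : Finset (Set α)}
    (hC : IsNested M 𝒢 C) (h : C' ⊆ C) (h0 : ascents M C = ∅) : ascents M C' = ∅ := by
  induction hn : (C \ C').card generalizing C with
  | zero =>
    rw [Finset.card_eq_zero, Finset.sdiff_eq_empty_iff_subset] at hn
    rwa [h.antisymm hn]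
  | succ n ih =>
    obtain ⟨X, hX⟩ := Finset.card_pos.1 (by omega : 0 < (C \ C').card)
    rw [Finset.mem_sdiff] at hX
    refine ih (C := C.erase X) (by rw [Finset.coe_erase]; exact hC.mono Set.sdiff_subset)
      (fun Y hY => Finset.mem_erase.2 ⟨fun hYX => hX.2 (hYX ▸ hY), h hY⟩) ?_ ?_
    · rw [Finset.eq_empty_iff_forall_notMem] at h0 ⊢
      intro Z hZ
      rw [mem_ascents, Finset.coe_erase] at hZ
      exact h0 Z (mem_ascents.2 (hZ.of_diff h𝒢 hC hX.1))
    · rw [Finset.erase_sdiff_comm, Finset.card_erase_of_mem (Finset.mem_sdiff.2 hX), hn]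
      rfl

/-- Deleting members creates no ascents (`IsAscent.of_diff`) and can only increase the relative
ranks of those that remain. -/
lemma gammaFaces_down_closed {S S' : Finset (Set α)} (hS : S ∈ gammaFaces M 𝒢) (h : S' ⊆ S) :
    S' ∈ gammaFaces M 𝒢 := by
  classical
  rw [gammaFaces, Finset.mem_image] at hS ⊢
  obtain ⟨C, hC, rfl⟩ := hS
  rw [ascentFree, Finset.mem_filter] at hC
  obtain ⟨hC, hasc, hrel⟩ := hC
  obtain ⟨hn, hmax⟩ := mem_fullNested.1 hC
  have hsub : C.filter (· ∈ factors 𝒢 M.E) ∪ S' ⊆ C :=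
    Finset.union_subset (Finset.filter_subset _ _) (h.trans (Finset.filter_subset _ _))
  refine ⟨C.filter (· ∈ factors 𝒢 M.E) ∪ S', ?_, ?_⟩
  · rw [ascentFree, Finset.mem_filter, mem_fullNested]
    refine ⟨⟨hn.mono (Finset.coe_subset.2 hsub), fun P hP => ?_⟩,
      ascents_eq_empty_of_subset h𝒢 hn hsub hasc, fun P hP hPm => ?_⟩
    · exact Finset.mem_union_left _ (Finset.mem_filter.2 ⟨hmax hP, hP⟩)
    · exact (hrel P (hsub hP) hPm).trans (relRk_anti (Finset.coe_subset.2 hsub) P)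
  · ext P
    simp only [Finset.mem_filter, Finset.mem_union]
    constructor
    · rintro ⟨⟨-, hP⟩ | hP, hPm⟩
      · exact absurd hP hPm
      · exact hP
    · exact fun hP => ⟨Or.inr hP, (Finset.mem_filter.1 (h hP)).2⟩

lemma empty_mem_gammaFaces : ∅ ∈ gammaFaces M 𝒢 := by
  classical
  have hcoe : ((𝒢.filter (· ∈ factors 𝒢 M.E) : Finset (Set α)) : Set (Set α)) =
      factors 𝒢 M.E := by
    ext P
    simp only [Finset.coe_filter, Set.mem_ofPred_eq, and_iff_right_iff_imp]
    exact fun h => mem_of_mem_factors h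
  have hmem : 𝒢.filter (· ∈ factors 𝒢 M.E) ∈ fullNested M 𝒢 := by
    rw [mem_fullNested, hcoe]
    have h0 : IsNested M 𝒢 (∅ : Set (Set α)) :=
      ⟨Set.empty_subset _, fun A hA _ hA' => by
        obtain ⟨x, hx⟩ := hA'.nonempty
        exact absurd (hA hx) (Set.notMem_empty x)⟩
    exact ⟨by simpa using h0.union_factors h𝒢, subset_rfl⟩
  rw [gammaFaces, Finset.mem_image]
  refine ⟨𝒢.filter (· ∈ factors 𝒢 M.E), ?_, ?_⟩
  · rw [ascentFree, Finset.mem_filter]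
    refine ⟨hmem, ?_, fun P hP hPm => absurd (Finset.mem_filter.1 hP).2 hPm⟩
    rw [Finset.eq_empty_iff_forall_notMem]
    intro X hX
    rw [mem_ascents] at hX
    obtain ⟨hXC, P, hP, -⟩ := hX
    exact notMem_factors_of_isParent h𝒢 hmem hP (Finset.mem_filter.1 hXC).2
  · ext P
    simp only [Finset.mem_filter, Finset.notMem_empty, iff_false]
    exact fun h => h.2 h.1.2

open Classical in
lemma card_le_of_mem_gammaFaces {S : Finset (Set α)} (hS : S ∈ gammaFaces M 𝒢) :
    2 * S.card + (𝒢.filter (· ∈ factors 𝒢 M.E)).card ≤ rk M M.E := by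
  rw [gammaFaces, Finset.mem_image] at hS
  obtain ⟨C, hC, rfl⟩ := hS
  rw [ascentFree, Finset.mem_filter] at hC
  convert (prod_eval_one_nodeWeight h𝒢 hC.1 hC.2.2).1

open Classical in
/-- The γ-expansion of the Hilbert series of the Chow ring of a complete built matroid. -/
theorem sum_eval_zero_eq_sum_gammaFaces (hc : IsCompleteFor M 𝒢) :
    ∑ C ∈ fullNested M 𝒢, ∏ P ∈ C, (nodeWeight M 𝒢 P (relRk M C P)).eval 0 =
      ∑ S ∈ gammaFaces M 𝒢, Polynomial.X ^ S.card * (1 + Polynomial.X : ℤ[X]) ^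
        (rk M M.E - (𝒢.filter (· ∈ factors 𝒢 M.E)).card - 2 * S.card) := by
  rw [sum_eval_zero_eq_sum_eval_one h𝒢 hc, gammaFaces, Finset.sum_image]
  · have hsub : ascentFree M 𝒢 ⊆ (fullNested M 𝒢).filter (fun C => ascents M C = ∅) := by
      intro C hC
      rw [ascentFree, Finset.mem_filter] at hC
      exact Finset.mem_filter.2 ⟨hC.1, hC.2.1⟩
    refine (Finset.sum_subset hsub fun C hC hC' => ?_).symm.trans
      (Finset.sum_congr rfl fun C hC => ?_)
    -- A non-maximal node of relative rank one has weight zero, so only the nested sets in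
    -- `ascentFree` contribute.
    · rw [Finset.mem_filter] at hC
      have : ∃ P ∈ C, P ∉ factors 𝒢 M.E ∧ relRk M C P < 2 := by
        by_contra! hcon
        exact hC' (Finset.mem_filter.2 ⟨hC.1, hC.2, hcon⟩)
      obtain ⟨P, hP, hPm, hlt⟩ := this
      refine Finset.prod_eq_zero hP ?_
      rw [nodeWeight, if_neg hPm, eval_one_innerWeight_of_lt hlt]
    · rw [ascentFree, Finset.mem_filter] at hC
      convert (prod_eval_one_nodeWeight h𝒢 hC.1 hC.2.2).2
  · intro C hC C' hC' h
    simp only [ascentFree, Finset.coe_filter, Set.mem_ofPred_eq] at hC hC'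
    simp only at h
    rw [← Finset.filter_union_filter_not_eq (· ∈ factors 𝒢 M.E) C, h,
      filter_factors_of_mem_fullNested hC.1, ← filter_factors_of_mem_fullNested hC'.1,
      Finset.filter_union_filter_not_eq]

end Gamma

/-! ### Ballot sets -/

/-- A set of natural numbers is ballot if it contains at most half of every initial segment. -/
def IsBallot (B : Finset ℕ) : Prop := ∀ j, 2 * (B.filter (· < j)).card ≤ j

instance : DecidablePred IsBallot := fun _ => Classical.propDecidable _

lemma IsBallot.mono {B B' : Finset ℕ} (hB : IsBallot B) (h : B' ⊆ B) : IsBallot B' := fun j =>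
  (Nat.mul_le_mul_left 2 (Finset.card_le_card (Finset.filter_subset_filter _ h))).trans (hB j)

lemma isBallot_empty : IsBallot ∅ := fun j => by simp

lemma filter_lt_eq_self {B : Finset ℕ} {n j : ℕ} (h : B ⊆ Finset.range n) (hj : n ≤ j) :
    B.filter (· < j) = B :=
  Finset.filter_true_of_mem fun _ hb => (Finset.mem_range.1 (h hb)).trans_le hj

lemma IsBallot.two_mul_card_le {B : Finset ℕ} {n : ℕ} (hB : IsBallot B)
    (h : B ⊆ Finset.range n) : 2 * B.card ≤ n := by
  have := hB n
  rwa [filter_lt_eq_self h le_rfl] at this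

lemma isBallot_insert_last {B : Finset ℕ} {n : ℕ} (h : B ⊆ Finset.range n) :
    IsBallot (insert n B) ↔ IsBallot B ∧ 2 * (B.card + 1) ≤ n + 1 := by
  have hn : n ∉ B := fun hn => by simpa using h hn
  have hsub : insert n B ⊆ Finset.range (n + 1) := by
    rw [Finset.range_add_one]
    exact Finset.insert_subset_insert _ h
  have hcard : (insert n B).card = B.card + 1 := Finset.card_insert_of_notMem hn
  constructor
  · intro hB
    refine ⟨hB.mono (Finset.subset_insert _ _), ?_⟩
    rw [← hcard]
    exact hB.two_mul_card_le hsub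
  · rintro ⟨hB, hle⟩ j
    rcases Nat.lt_or_ge n j with hj | hj
    · rw [filter_lt_eq_self hsub hj, hcard]
      omega
    · rw [Finset.filter_insert, if_neg (by omega)]
      exact hB j

open Classical in
/-- A ballot set which is not too large can be enlarged. -/
lemma IsBallot.exists_insert {B : Finset ℕ} {n : ℕ} (hB : IsBallot B) (h : B ⊆ Finset.range n)
    (hn : 2 * B.card + 2 ≤ n) : ∃ b < n, b ∉ B ∧ IsBallot (insert b B) := by
  have hne : (Finset.range n \ B).Nonempty := by
    rw [← Finset.card_pos, Finset.card_sdiff_of_subset h, Finset.card_range]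
    omega
  -- Insert the largest missing element. Everything after it is already in `B`, so for `j > b` the
  -- count below `j` is far enough from the bound to allow one more.
  obtain ⟨b, hb, hmax⟩ := Finset.exists_max_image _ id hne
  rw [Finset.mem_sdiff, Finset.mem_range] at hb
  refine ⟨b, hb.1, hb.2, fun j => ?_⟩
  rcases Nat.lt_or_ge b j with hj | hj
  · rw [Finset.filter_insert, if_pos hj, Finset.card_insert_of_notMem (by simp [hb.2])]
    have h1 : (B.filter (· < j)).card + (n - j) ≤ B.card := by
      rw [← Finset.card_filter_add_card_filter_not (s := B) (· < j), ← Nat.card_Ico]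
      refine Nat.add_le_add_left (Finset.card_le_card fun x hx => ?_) _
      rw [Finset.mem_Ico] at hx
      rw [Finset.mem_filter]
      refine ⟨?_, by omega⟩
      by_contra hxB
      have := hmax x (Finset.mem_sdiff.2 ⟨Finset.mem_range.2 hx.2, hxB⟩)
      simp only [id] at this
      omega
    omega
  · rw [Finset.filter_insert, if_neg (by omega)]
    exact hB j

/-- The ballot subsets of `{0, …, n - 1}` with `k` elements. -/
def ballots (n k : ℕ) : Finset (Finset ℕ) :=
  (Finset.powersetCard k (Finset.range n)).filter IsBallot

lemma mem_ballots {n k : ℕ} {B : Finset ℕ} :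
    B ∈ ballots n k ↔ B ⊆ Finset.range n ∧ B.card = k ∧ IsBallot B := by
  rw [ballots, Finset.mem_filter, Finset.mem_powersetCard, and_assoc]

lemma card_ballots_zero (n : ℕ) : (ballots n 0).card = 1 := by
  rw [Finset.card_eq_one]
  refine ⟨∅, ?_⟩
  ext B
  rw [mem_ballots, Finset.mem_singleton]
  refine ⟨fun h => Finset.card_eq_zero.1 h.2.1, ?_⟩
  rintro rfl
  exact ⟨Finset.empty_subset _, rfl, isBallot_empty⟩

lemma ballots_eq_empty {n k : ℕ} (h : n < 2 * k) : ballots n k = ∅ := by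
  rw [Finset.eq_empty_iff_forall_notMem]
  intro B hB
  rw [mem_ballots] at hB
  have := hB.2.2.two_mul_card_le hB.1
  omega

/-- Split according to whether `n` is a member. The hypothesis is exactly what makes adding `n` to a
ballot set of size `k` legitimate. -/
lemma card_ballots_succ {n k : ℕ} (h : 2 * (k + 1) ≤ n + 1) :
    (ballots (n + 1) (k + 1)).card = (ballots n (k + 1)).card + (ballots n k).card := by
  classical
  have hins : Set.InjOn (insert n) (ballots n k : Set (Finset ℕ)) := by
    intro B hB B' hB' he
    have hn : ∀ B ∈ ballots n k, n ∉ B := fun B hB hn => by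
      simpa using (mem_ballots.1 hB).1 hn
    rw [← Finset.erase_insert (hn B hB), he, Finset.erase_insert (hn B' hB')]
  rw [← Finset.card_image_of_injOn hins, ← Finset.card_union_of_disjoint]
  · congr 1
    ext B
    simp only [Finset.mem_union, Finset.mem_image, mem_ballots]
    constructor
    · rintro ⟨hB, hc, hb⟩
      by_cases hn : n ∈ B
      · refine Or.inr ⟨B.erase n, ⟨?_, ?_, hb.mono (Finset.erase_subset _ _)⟩,
          Finset.insert_erase hn⟩
        · rwa [Finset.range_add_one, ← Finset.insert_erase hn,
            Finset.insert_subset_insert_iff (Finset.notMem_erase _ _)] at hB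
        · rw [Finset.card_erase_of_mem hn, hc, Nat.add_sub_cancel]
      · rw [Finset.range_add_one, Finset.subset_insert_iff_of_notMem hn] at hB
        exact Or.inl ⟨hB, hc, hb⟩
    · rintro (⟨hB, hc, hb⟩ | ⟨B, ⟨hB, hc, hb⟩, rfl⟩)
      · exact ⟨hB.trans (Finset.range_subset_range.2 (Nat.le_succ n)), hc, hb⟩
      · refine ⟨?_, ?_, ?_⟩
        · rw [Finset.range_add_one]
          exact Finset.insert_subset_insert _ hB
        · rw [Finset.card_insert_of_notMem (fun hn => by simpa using hB hn), hc]
        · rw [isBallot_insert_last hB, hc]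
          exact ⟨hb, h⟩
  · rw [Finset.disjoint_left]
    intro B hB hB'
    rw [Finset.mem_image] at hB'
    obtain ⟨B', -, rfl⟩ := hB'
    simpa using (mem_ballots.1 hB).1 (Finset.mem_insert_self _ _)

/-- The ballot theorem. -/
lemma card_ballots_add_choose (n : ℕ) : ∀ k, 2 * (k + 1) ≤ n + 1 →
    (ballots n (k + 1)).card + n.choose k = n.choose (k + 1) := by
  induction n with
  | zero => intro k hk; omega
  | succ n ih =>
    intro k hk
    rcases Nat.lt_or_ge (n + 1) (2 * (k + 1)) with h | h
    -- On the boundary `n + 1 = 2k + 1` there are no ballot sets and the two binomial coefficients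
    -- are equal by symmetry.
    · rw [ballots_eq_empty h, Finset.card_empty, zero_add]
      exact Nat.choose_symm_of_eq_add (by omega)
    · rw [card_ballots_succ h]
      have h1 := ih k h
      cases k with
      | zero =>
        rw [card_ballots_zero]
        simp only [Nat.choose_zero_right, zero_add, Nat.choose_one_right] at h1 ⊢
        omega
      | succ k =>
        have h2 := ih k (by omega)
        rw [Nat.choose_succ_succ n k, Nat.choose_succ_succ n (k + 1)]
        simp only [Nat.succ_eq_add_one]
        omega

/-! ### Pure `f`-vectors from families of finite sets -/

/-- A down-closed family of finite sets all of whose maximal members have the same cardinality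
yields a pure `f`-vector. -/
lemma isPureFVector_of_family {W : Type*} (F : Finset (Finset W)) (h0 : ∅ ∈ F)
    (hdown : ∀ s ∈ F, ∀ t ⊆ s, t ∈ F) {m : ℕ} (hpure : ∀ s ∈ F, ∃ t ∈ F, s ⊆ t ∧ t.card = m)
    {f : ℕ → ℤ} (hf : ∀ i ≤ m, f i = ((F.filter (·.card = i)).card : ℤ)) :
    IsPureFVector m f := by
  classical
  -- Vertices are restricted to the singletons in `F`, because every vertex of the complex must be a
  -- face; relabelling by `Fin n` gives a finite vertex set in `Type`.
  have hfin : Finite {w : W // {w} ∈ F} :=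
    Finite.of_injective (fun w => (⟨{w.1}, w.2⟩ : F)) fun a b h => by
      simpa [Subtype.ext_iff] using h
  obtain ⟨n, ⟨e⟩⟩ := Finite.exists_equiv_fin {w : W // {w} ∈ F}
  let emb : Fin n ↪ W := e.symm.toEmbedding.trans (Function.Embedding.subtype _)
  have hemb : ∀ v, {emb v} ∈ F := fun v => (e.symm v).2
  have hsurj : ∀ s ∈ F, ∃ t : Finset (Fin n), t.map emb = s := by
    intro s hs
    refine ⟨Finset.univ.filter fun v => emb v ∈ s, ?_⟩
    ext w
    simp only [Finset.mem_map, Finset.mem_filter, Finset.mem_univ, true_and]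
    constructor
    · rintro ⟨v, hv, rfl⟩
      exact hv
    · intro hw
      have hw' : {w} ∈ F := hdown s hs _ (Finset.singleton_subset_iff.2 hw)
      have : emb (e ⟨w, hw'⟩) = w := by simp [emb]
      exact ⟨e ⟨w, hw'⟩, by rwa [this], this⟩
  let K : AbstractSimplicialComplex (Fin n) :=
    { faces := {s | s.Nonempty ∧ s.map emb ∈ F}
      isRelLowerSet_faces := fun s hs => ⟨hs.1, fun t hts ht =>
        ⟨ht, hdown _ hs.2 _ (Finset.map_subset_map.2 hts)⟩⟩
      singleton_mem := fun v => ⟨Finset.singleton_nonempty v, by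
        rw [Finset.map_singleton]
        exact hemb v⟩ }
  have hK : ∀ s, s ∈ allFaces K ↔ s.map emb ∈ F := by
    intro s
    rcases s.eq_empty_or_nonempty with rfl | hs
    · simp [allFaces, h0]
    · refine ⟨?_, fun h => Or.inr ⟨hs, h⟩⟩
      rintro (rfl | h)
      · simp at hs
      · exact h.2
  have hext : ∀ s ∈ allFaces K, ∃ t ∈ allFaces K, s ⊆ t ∧ t.card = m := by
    intro s hs
    obtain ⟨t, ht, hst, hc⟩ := hpure _ ((hK s).1 hs)
    obtain ⟨t, rfl⟩ := hsurj t ht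
    exact ⟨t, (hK t).2 ht, Finset.map_subset_map.1 hst, by rwa [Finset.card_map] at hc⟩
  have hmax : ∀ s, Maximal (· ∈ allFaces K) s → s.card = m := by
    intro s hs
    obtain ⟨t, ht, hst, hc⟩ := hext s hs.prop
    rw [hs.eq_of_le ht hst, hc]
  refine ⟨Fin n, inferInstance, K, fun s t hs ht => (hmax s hs).trans (hmax t ht).symm, ?_, ?_, ?_⟩
  · intro s hs
    obtain ⟨t, -, hst, hc⟩ := hext s hs
    exact hc ▸ Finset.card_le_card hst
  · obtain ⟨t, ht, -, hc⟩ := hext ∅ (Or.inl rfl)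
    exact ⟨t, ht, hc⟩
  · intro i hi
    rw [hf i hi, ← Set.ncard_coe_finset]
    congr 1
    refine (Set.ncard_congr (fun s _ => s.map emb) ?_ ?_ ?_).symm
    · intro s hs
      simp only [Finset.coe_filter, Set.mem_ofPred_eq, Finset.card_map]
      exact ⟨(hK s).1 hs.1, hs.2⟩
    · intro s t _ _ h
      exact Finset.map_injective emb h
    · intro s hs
      simp only [Finset.coe_filter, Set.mem_ofPred_eq] at hs
      obtain ⟨t, rfl⟩ := hsurj s hs.1
      rw [Finset.card_map] at hs
      exact ⟨t, ⟨(hK t).2 hs.1, hs.2⟩, rfl⟩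

/-! ### γ-expansions -/

/-- The polynomial with a given γ-expansion. -/
def gammaPoly {V : Type*} (Γ : Finset (Finset V)) (D : ℕ) : ℤ[X] :=
  ∑ S ∈ Γ, Polynomial.X ^ S.card * (1 + Polynomial.X : ℤ[X]) ^ (D - 2 * S.card)

lemma coeff_X_pow_mul_one_add_X_pow (s n i : ℕ) :
    (Polynomial.X ^ s * (1 + Polynomial.X : ℤ[X]) ^ n).coeff i =
      if s ≤ i then (n.choose (i - s) : ℤ) else 0 := by
  rw [Polynomial.coeff_X_pow_mul', Polynomial.coeff_one_add_X_pow]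

/-- With `n = D - 2s`, the entry is the difference of consecutive binomial coefficients of `n` at `i
- s` and `i - s - 1`. The ballot theorem says what it counts. -/
lemma gEntry_X_pow_mul_one_add_X_pow {D s i : ℕ} (hs : 2 * s ≤ D) (hi : 2 * i ≤ D) :
    gEntry (Polynomial.X ^ s * (1 + Polynomial.X : ℤ[X]) ^ (D - 2 * s)) i =
      if s ≤ i then ((ballots (D - 2 * s) (i - s)).card : ℤ) else 0 := by
  cases i with
  | zero =>
    rw [gEntry, coeff_X_pow_mul_one_add_X_pow]
    split_ifs
    · simp [card_ballots_zero]
    · rfl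
  | succ i =>
    rw [gEntry, coeff_X_pow_mul_one_add_X_pow, coeff_X_pow_mul_one_add_X_pow]
    rcases lt_trichotomy s (i + 1) with h | h | h
    · rw [if_pos h.le, if_pos (by omega), if_pos h.le]
      have := card_ballots_add_choose (D - 2 * s) (i - s) (by omega)
      rw [show i - s + 1 = i + 1 - s by omega] at this
      rw [← this]
      push_cast
      ring
    · subst h
      rw [if_pos le_rfl, if_neg (by omega), if_pos le_rfl]
      simp [card_ballots_zero]
    · rw [if_neg (by omega), if_neg (by omega), if_neg (by omega), sub_zero]

lemma gEntry_sum {ι : Type*} (A : Finset ι) (p : ι → ℤ[X]) (i : ℕ) :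
    gEntry (∑ a ∈ A, p a) i = ∑ a ∈ A, gEntry (p a) i := by
  cases i with
  | zero => simp only [gEntry, Polynomial.finsetSum_coeff]
  | succ i => simp only [gEntry, Polynomial.finsetSum_coeff, Finset.sum_sub_distrib]

/-! ### Pure complexes and log-concavity from γ-vectors. -/

section Gamma

variable {V : Type*} {Γ : Finset (Finset V)} {D : ℕ}

lemma natDegree_gammaPoly (h0 : ∅ ∈ Γ) (hD : ∀ S ∈ Γ, 2 * S.card ≤ D) :
    (gammaPoly Γ D).natDegree = D := by
  refine Polynomial.natDegree_eq_of_le_of_coeff_ne_zero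
    (Polynomial.natDegree_sum_le_of_forall_le _ _ fun S hS => ?_) ?_
  · rw [Polynomial.natDegree_le_iff_coeff_eq_zero]
    intro N hN
    have := hD S hS
    rw [coeff_X_pow_mul_one_add_X_pow, if_pos (by omega), Nat.choose_eq_zero_of_lt (by omega),
      Nat.cast_zero]
  · rw [gammaPoly, Polynomial.finsetSum_coeff, Finset.sum_eq_single_of_mem ∅ h0]
    · simp [Polynomial.coeff_one_add_X_pow]
    · intro S hS hne
      have := hD S hS
      have := Finset.card_pos.2 (Finset.nonempty_iff_ne_empty.2 hne)
      rw [coeff_X_pow_mul_one_add_X_pow, if_pos (by omega), Nat.choose_eq_zero_of_lt (by omega),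
        Nat.cast_zero]

open Classical in
/-- The family of the disjoint unions of a member `S` of `Γ` and of a ballot subset of
`{0, …, D - 2 |S| - 1}`. -/
def ballotFamily (Γ : Finset (Finset V)) (D : ℕ) : Finset (Finset (V ⊕ ℕ)) :=
  (Γ.sigma fun S => (Finset.range (D - 2 * S.card)).powerset.filter IsBallot).image
    fun p => p.1.disjSum p.2

lemma mem_ballotFamily {s : Finset (V ⊕ ℕ)} : s ∈ ballotFamily Γ D ↔ s.toLeft ∈ Γ ∧
    s.toRight ⊆ Finset.range (D - 2 * s.toLeft.card) ∧ IsBallot s.toRight := by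
  classical
  rw [ballotFamily, Finset.mem_image]
  simp only [Finset.mem_sigma, Finset.mem_filter, Finset.mem_powerset]
  constructor
  · rintro ⟨⟨S, B⟩, h, rfl⟩
    simpa using h
  · exact fun h => ⟨⟨s.toLeft, s.toRight⟩, h, Finset.toLeft_disjSum_toRight⟩

lemma card_ballotFamily (i : ℕ) : ((ballotFamily Γ D).filter (·.card = i)).card =
    ∑ S ∈ Γ, if S.card ≤ i then (ballots (D - 2 * S.card) (i - S.card)).card else 0 := by
  classical
  have h : ∀ S : Finset V,
      (if S.card ≤ i then (ballots (D - 2 * S.card) (i - S.card)).card else 0) =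
      (if S.card ≤ i then ballots (D - 2 * S.card) (i - S.card) else ∅).card := by
    intro S
    split_ifs <;> simp
  simp_rw [h]
  rw [← Finset.card_sigma]
  symm
  refine Finset.card_nbij' (fun p => p.1.disjSum p.2) (fun s => ⟨s.toLeft, s.toRight⟩) ?_ ?_ ?_ ?_
  · rintro ⟨S, B⟩ hp
    simp only [Finset.coe_sigma, Set.mem_sigma_iff, Finset.mem_coe] at hp
    simp only [Finset.coe_filter, Set.mem_ofPred_eq, mem_ballotFamily, Finset.toLeft_disjSum,
      Finset.toRight_disjSum, Finset.card_disjSum]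
    obtain ⟨hS, hB⟩ := hp
    split_ifs at hB with hle
    · rw [mem_ballots] at hB
      exact ⟨⟨hS, hB.1, hB.2.2⟩, by omega⟩
    · simp at hB
  · intro s hs
    simp only [Finset.coe_filter, Set.mem_ofPred_eq, mem_ballotFamily] at hs
    have hc := Finset.card_toLeft_add_card_toRight (u := s)
    simp only [Finset.coe_sigma, Set.mem_sigma_iff, Finset.mem_coe]
    refine ⟨hs.1.1, ?_⟩
    rw [if_pos (by omega), mem_ballots]
    exact ⟨hs.1.2.1, by omega, hs.1.2.2⟩
  · rintro ⟨S, B⟩ _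
    simp
  · intro s _
    exact Finset.toLeft_disjSum_toRight

/-- The `g`-vector of a polynomial, the γ-vector of which is the `f`-vector of a simplicial complex,
is a pure `f`-vector. -/
theorem isPureFVector_gammaPoly (h0 : ∅ ∈ Γ) (hdown : ∀ S ∈ Γ, ∀ S' ⊆ S, S' ∈ Γ)
    (hD : ∀ S ∈ Γ, 2 * S.card ≤ D) : IsPureFVector (D / 2) (gEntry (gammaPoly Γ D)) := by
  classical
  -- Purity comes from the ballot part alone: with the face of `Γ` fixed, the ballot set grows until
  -- the total size is `⌊D/2⌋`, even if that face is not maximal in `Γ`.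
  have hext : ∀ n, ∀ s ∈ ballotFamily Γ D, s.card + n = D / 2 →
      ∃ t ∈ ballotFamily Γ D, s ⊆ t ∧ t.card = D / 2 := by
    intro n
    induction n with
    | zero => exact fun s hs hn => ⟨s, hs, subset_rfl, hn⟩
    | succ n ih =>
      intro s hs hn
      obtain ⟨h1, h2, h3⟩ := mem_ballotFamily.1 hs
      have hc := Finset.card_toLeft_add_card_toRight (u := s)
      obtain ⟨b, hb, hbs, hbal⟩ := h3.exists_insert h2 (by omega)
      have hbs' : Sum.inr b ∉ s := by rwa [Finset.mem_toRight] at hbs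
      obtain ⟨t, ht, hst, htc⟩ := ih (insert (Sum.inr b) s) (by
        rw [mem_ballotFamily, Finset.toLeft_insert_inr, Finset.toRight_insert_inr]
        refine ⟨h1, Finset.insert_subset (Finset.mem_range.2 hb) h2, ?_⟩
        convert hbal) (by
        rw [Finset.card_insert_of_notMem hbs']
        omega)
      exact ⟨t, ht, (Finset.subset_insert _ _).trans hst, htc⟩
  refine isPureFVector_of_family (ballotFamily Γ D) ?_ ?_ ?_ ?_
  · rw [mem_ballotFamily]
    have hL : (∅ : Finset (V ⊕ ℕ)).toLeft = ∅ := by ext; simp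
    have hR : (∅ : Finset (V ⊕ ℕ)).toRight = ∅ := by ext; simp
    rw [hL, hR]
    exact ⟨h0, Finset.empty_subset _, isBallot_empty⟩
  · intro s hs t hts
    rw [mem_ballotFamily] at hs ⊢
    have hL := Finset.toLeft_subset_toLeft hts
    have hR := Finset.toRight_subset_toRight hts
    refine ⟨hdown _ hs.1 _ hL, hR.trans (hs.2.1.trans (Finset.range_subset_range.2 ?_)),
      hs.2.2.mono hR⟩
    have := Finset.card_le_card hL
    omega
  · intro s hs
    obtain ⟨h1, h2, h3⟩ := mem_ballotFamily.1 hs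
    have hc := Finset.card_toLeft_add_card_toRight (u := s)
    have := hD _ h1
    have := h3.two_mul_card_le h2
    exact hext (D / 2 - s.card) s hs (by omega)
  · intro i hi
    rw [card_ballotFamily, gammaPoly, gEntry_sum]
    push_cast
    exact Finset.sum_congr rfl fun S hS => gEntry_X_pow_mul_one_add_X_pow (hD S hS) (by omega)

/-- The number of two-element members of a down-closed family is at most the square of the number of
its one-element members. -/
lemma card_filter_card_eq_two_le (hdown : ∀ S ∈ Γ, ∀ S' ⊆ S, S' ∈ Γ) :
    (Γ.filter (·.card = 2)).card ≤ (Γ.filter (·.card = 1)).card ^ 2 := by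
  classical
  have h : Γ.filter (·.card = 2) ⊆
      ((Γ.filter (·.card = 1)) ×ˢ (Γ.filter (·.card = 1))).image fun p => p.1 ∪ p.2 := by
    intro S hS
    rw [Finset.mem_filter, Finset.card_eq_two] at hS
    obtain ⟨hS, a, b, -, rfl⟩ := hS
    simp only [Finset.mem_image, Finset.mem_product, Finset.mem_filter]
    exact ⟨({a}, {b}), ⟨⟨hdown _ hS _ (by simp), rfl⟩, ⟨hdown _ hS _ (by simp), rfl⟩⟩, rfl⟩
  refine (Finset.card_le_card h).trans (Finset.card_image_le.trans ?_)
  rw [Finset.card_product, sq]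

/-- For `D ≤ 5` every face has at most two elements. -/
lemma gammaPoly_eq (h0 : ∅ ∈ Γ) (hD : ∀ S ∈ Γ, 2 * S.card ≤ D) (hD5 : D ≤ 5) :
    gammaPoly Γ D = (1 + Polynomial.X) ^ D +
      ((Γ.filter (·.card = 1)).card : ℤ[X]) *
        (Polynomial.X ^ 1 * (1 + Polynomial.X : ℤ[X]) ^ (D - 2)) +
      ((Γ.filter (·.card = 2)).card : ℤ[X]) *
        (Polynomial.X ^ 2 * (1 + Polynomial.X : ℤ[X]) ^ (D - 4)) := by
  have hmaps : Set.MapsTo Finset.card (Γ : Set (Finset V)) (Finset.range 3 : Set ℕ) := by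
    intro S hS
    have := hD S hS
    rw [Finset.mem_coe, Finset.mem_range]
    omega
  have h1 : Γ.filter (·.card = 0) = {∅} := by
    ext S
    simp only [Finset.mem_filter, Finset.card_eq_zero, Finset.mem_singleton,
      and_iff_right_iff_imp]
    rintro rfl
    exact h0
  have hc : ∀ j, ∑ S ∈ Γ with S.card = j,
      Polynomial.X ^ S.card * (1 + Polynomial.X : ℤ[X]) ^ (D - 2 * S.card) =
      ((Γ.filter (·.card = j)).card : ℤ[X]) *
        (Polynomial.X ^ j * (1 + Polynomial.X : ℤ[X]) ^ (D - 2 * j)) := by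
    intro j
    rw [← nsmul_eq_mul, ← Finset.sum_const]
    exact Finset.sum_congr rfl fun S hS => by rw [(Finset.mem_filter.1 hS).2]
  rw [gammaPoly, ← Finset.sum_fiberwise_of_maps_to hmaps]
  simp only [Finset.sum_range_succ, Finset.sum_range_zero, hc]
  simp [h1]

/-- Each inequality is quadratic in the nonnegative numbers `a = γ₁` and `b = γ₂` and follows from
`b ≤ a²`. -/
lemma isLogConcave_gammaPoly (h0 : ∅ ∈ Γ) (hdown : ∀ S ∈ Γ, ∀ S' ⊆ S, S' ∈ Γ)
    (hD : ∀ S ∈ Γ, 2 * S.card ≤ D) (hD5 : D ≤ 5) : IsLogConcave (gammaPoly Γ D) := by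
  intro i hi hiD
  rw [natDegree_gammaPoly h0 hD] at hiD
  have h2 := card_filter_card_eq_two_le hdown
  have h4 : D < 4 → (Γ.filter (·.card = 2)).card = 0 := by
    intro h
    rw [Finset.card_eq_zero, Finset.filter_eq_empty_iff]
    intro S hS hc
    have := hD S hS
    omega
  rw [gammaPoly_eq h0 hD hD5]
  generalize (Γ.filter (·.card = 1)).card = a at *
  generalize (Γ.filter (·.card = 2)).card = b at *
  have hcoeff : ∀ k, ((1 + Polynomial.X) ^ D +
      (a : ℤ[X]) * (Polynomial.X ^ 1 * (1 + Polynomial.X : ℤ[X]) ^ (D - 2)) +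
      (b : ℤ[X]) * (Polynomial.X ^ 2 * (1 + Polynomial.X : ℤ[X]) ^ (D - 4))).coeff k =
      D.choose k + a * (if 1 ≤ k then ((D - 2).choose (k - 1) : ℤ) else 0) +
        b * (if 2 ≤ k then ((D - 4).choose (k - 2) : ℤ) else 0) := by
    intro k
    rw [Polynomial.coeff_add, Polynomial.coeff_add, Polynomial.coeff_one_add_X_pow,
      Polynomial.coeff_natCast_mul, Polynomial.coeff_natCast_mul,
      coeff_X_pow_mul_one_add_X_pow, coeff_X_pow_mul_one_add_X_pow]
  rw [hcoeff, hcoeff, hcoeff]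
  have h2' : (b : ℤ) ≤ (a : ℤ) ^ 2 := by exact_mod_cast h2
  have ha : (0 : ℤ) ≤ a := Int.natCast_nonneg a
  have hb : (0 : ℤ) ≤ b := Int.natCast_nonneg b
  interval_cases D
  · omega
  · omega
  · obtain rfl : i = 1 := by omega
    simp only [h4 (by norm_num)]
    norm_num [Nat.choose]
    exact (by linarith : (1 : ℤ) ≤ 2 + a).trans (le_abs_self _)
  · simp only [h4 (by norm_num)]
    interval_cases i <;> simp [Nat.choose] <;> nlinarith
  · interval_cases i <;> simp [Nat.choose] <;> nlinarith
  · interval_cases i <;> simp [Nat.choose] <;> nlinarith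

end Gamma

end BuiltMatroid

end

/-! ### Assembly of the corollary. -/

theorem corollary1p6 {α : Type*} (M : Matroid α) [M.Finite] [M.Loopless] (𝒢 : Finset (Set α))
    (h𝒢 : BuiltMatroid.IsBuildingSet M 𝒢) (hc : BuiltMatroid.IsComplete M 𝒢) :
    ∃ H : Polynomial ℤ,
      (H : PowerSeries ℤ) = BuiltMatroid.chowSeries M 𝒢 ∧
      (H.natDegree : ℕ∞) + (BuiltMatroid.factors 𝒢 M.E).encard = M.eRank ∧
      BuiltMatroid.IsPureFVector (H.natDegree / 2) (BuiltMatroid.gEntry H) ∧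
      (M.eRank ≤ 6 → BuiltMatroid.IsLogConcave H) := by
  classical
  obtain ⟨_, hc⟩ := hc
  set m := (𝒢.filter (· ∈ BuiltMatroid.factors 𝒢 M.E)).card with hm
  set D := BuiltMatroid.rk M M.E - m with hD
  have hcoe : ((𝒢.filter (· ∈ BuiltMatroid.factors 𝒢 M.E) : Finset (Set α)) : Set (Set α)) =
      BuiltMatroid.factors 𝒢 M.E := by
    ext P
    simp only [Finset.coe_filter, Set.mem_ofPred_eq, and_iff_right_iff_imp]
    exact fun h => BuiltMatroid.mem_of_mem_factors h
  have hrank : M.eRank = (BuiltMatroid.rk M M.E : ℕ∞) := by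
    rw [BuiltMatroid.coe_rk, Matroid.eRk_ground]
  have h0 := BuiltMatroid.empty_mem_gammaFaces h𝒢
  have hdown : ∀ S ∈ BuiltMatroid.gammaFaces M 𝒢, ∀ S' ⊆ S, S' ∈ BuiltMatroid.gammaFaces M 𝒢 :=
    fun S hS S' h => BuiltMatroid.gammaFaces_down_closed h𝒢 hS h
  have hle : ∀ S ∈ BuiltMatroid.gammaFaces M 𝒢, 2 * S.card + m ≤ BuiltMatroid.rk M M.E := by
    intro S hS
    convert BuiltMatroid.card_le_of_mem_gammaFaces h𝒢 hS
  have hD2 : ∀ S ∈ BuiltMatroid.gammaFaces M 𝒢, 2 * S.card ≤ D := fun S hS => by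
    have := hle S hS
    omega
  have hmD : D + m = BuiltMatroid.rk M M.E := by
    have := hle ∅ h0
    omega
  have hdeg := BuiltMatroid.natDegree_gammaPoly h0 hD2
  refine ⟨BuiltMatroid.gammaPoly (BuiltMatroid.gammaFaces M 𝒢) D, ?_, ?_, ?_, ?_⟩
  · ext k
    rw [Polynomial.coeff_coe, BuiltMatroid.chowSeries, PowerSeries.coeff_mk,
      BuiltMatroid.finrank_chowPiece_eq_coeff h𝒢,
      BuiltMatroid.sum_eval_zero_eq_sum_gammaFaces h𝒢 hc, BuiltMatroid.gammaPoly]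
  · rw [hdeg, hrank, ← hcoe, Set.encard_coe_eq_coe_finsetCard, ← hm, ← hmD]
    push_cast
    rfl
  · rw [hdeg]
    exact BuiltMatroid.isPureFVector_gammaPoly h0 hdown hD2
  · intro h6
    refine BuiltMatroid.isLogConcave_gammaPoly h0 hdown hD2 ?_
    have h6' : BuiltMatroid.rk M M.E ≤ 6 := by
      rw [hrank] at h6
      exact_mod_cast h6
    -- With no maximal elements the ground set is empty and `D = 0`. Otherwise at least one unit of
    -- rank is subtracted, so rank at most six gives `D ≤ 5`.
    rcases Nat.eq_zero_or_pos m with h | h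
    · have h1 : BuiltMatroid.factors 𝒢 M.E = ∅ := by
        rw [← hcoe, Finset.card_eq_zero.1 (hm.symm.trans h), Finset.coe_empty]
      have h2 := h𝒢.sUnion_factors M.ground_isFlat
      rw [h1, Set.sUnion_empty] at h2
      rw [← h2, BuiltMatroid.rk_empty] at hmD
      omega
    · omega
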